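/- Let $L$ be a simple complex algebraic group (a connected Zariski closed subgroup of $\mathrm{GL}_n(\mathbb C)$ whose Lie algebra $\mathfrak l$ is simple), and let $\mathfrak l=\mathfrak l_{-1}\oplus\mathfrak l_0\oplus\mathfrak l_1$ be a short grading, i.e. a $\mathbb Z$-grading of the Lie algebra $\mathfrak l$ whose non-zero parts are exactly those of degrees $-1,0,1$. There is a unique $\xi\in\mathfrak l$ with $\mathfrak l_k=\{x\in\mathfrak l : [\xi,x]=kx\}$ for all $k$. Let $G$ be the identity component of the centralizer of $\xi$ in $L$; it acts on $\mathfrak l_{\pm1}$ by the adjoint action. Let $\mathfrak t\subset\mathfrak l_0$ be a Cartan subalgebra of $\mathfrak l$ (the Lie algebra of a maximal torus of $G$), let $\Delta$ be the root system of $(\mathfrak l,\mathfrak t)$, and let $\Delta_1\subset\Delta$ be the set of roots whose root spaces lie in $\mathfrak l_1$. Let $\alpha_1,\dots,\alpha_r$ be any sequence of pairwise orthogonal long roots in $\Delta_1$ that is maximal, i.e. no long root of $\Delta_1$ is orthogonal to all $\alpha_i$. Choose non-zero root vectors $e_{\alpha_i}$, $e_{-\alpha_i}$ for $\alpha_i$,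 $-\alpha_i$. For $k=0,\dots,r$ put $e_k=e_{\alpha_1}+\dots+e_{\alpha_k}$ and $f_k=e_{-\alpha_1}+\dots+e_{-\alpha_k}$ (so $e_0=f_0=0$), and let $\mathcal O_k=G\cdot e_k$, $\mathcal O'_k=G\cdot f_k$. Then: (a) $\mathfrak l_1=\bigsqcup_{k=0}^r\mathcal O_k$ and $\mathfrak l_{-1}=\bigsqcup_{k=0}^r\mathcal O'_k$. (b) For $0\le i,j\le r$: $\mathcal O_i\subset\overline{\mathcal O_j}$ if and only if $i\le j$, if and only if $\mathcal O'_i\subset\overline{\mathcal O'_j}$ (Zariski closures). (c) Identify $\mathfrak l_{-1}$ with $\mathfrak l_1^*$ by the Killing form. For $k=0,\dots,r$, $\mathcal O_k$ corresponds to $\mathcal O'_{r-k}$ in the Pyasetskii pairing, that is, the projectivizations of $\overline{\mathcal O_k}\subset\mathfrak l_1$ and $\overline{\mathcal O'_{r-k}}\subset\mathfrak l_1^*$ are projectively dual to each other. Here, for an irreducible closed cone $Y\subset V$, the dual cone in $V^*$ is the Zariski closure of the set of linear forms vanishing on the tangent space of $Y$ at some smooth point of $Y$ (so $\{0\}$ and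 $V^*$ are dual to $V$ and $\{0\}$, respectively). (d) Suppose that the root vectors are normalized by $[e_{\alpha_i},e_{-\alpha_i}]=\alpha_i^\vee$, where $\alpha_i^\vee\in\mathfrak t$ is the coroot. For $1\le k\le r$ let $h_k=\alpha_1^\vee+\dots+\alpha_k^\vee$. Then $\langle e_k,h_k,f_k\rangle$ is a homogeneous $\mathfrak{sl}_2$-subalgebra: $(e_k,h_k,f_k)$ is an $\mathfrak{sl}_2$-triple with $e_k\in\mathfrak l_1$, $h_k\in\mathfrak l_0$, $f_k\in\mathfrak l_{-1}$. -/

import Mathlib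

open Module Topology

attribute [local instance 100] LieRing.ofAssociativeRing

noncomputable section

namespace ShortGrading

/-! ### The Zariski topology on a finite-dimensional complex vector space -/

section Zariski

variable {V W : Type*} [AddCommGroup V] [Module ℂ V] [AddCommGroup W] [Module ℂ W]

/-- Polynomial functions on `V` are polynomials in the linear forms on `V` (no basis is chosen);
`polyEval p v` is the value at `v` of the polynomial function given by `p`. -/
def polyEval (p : MvPolynomial (Dual ℂ V) ℂ) (v : V) : ℂ :=
  MvPolynomial.eval (fun φ : Dual ℂ V => φ v) p

/-- The ideal `I(S)` of polynomial functions that vanish on `S`, as a set. -/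
def vanishing (S : Set V) : Set (MvPolynomial (Dual ℂ V) ℂ) :=
  {p | ∀ s ∈ S, polyEval p s = 0}

/-- The Zariski closure of `S`: the common zeros of all polynomial functions vanishing on `S`. -/
def zariskiClosure (S : Set V) : Set V :=
  {v | ∀ p ∈ vanishing S, polyEval p v = 0}

theorem subset_zariskiClosure (S : Set V) : S ⊆ zariskiClosure S :=
  fun _ hv _ hp => hp _ hv

theorem zariskiClosure_mono {S T : Set V} (h : S ⊆ T) : zariskiClosure S ⊆ zariskiClosure T :=
  fun _ hv p hp => hv p fun s hs => hp s (h hs)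

variable (V) in
/-- The Zariski topology: the closed sets are the common zero sets of polynomial functions. -/
@[reducible] def zariskiTopology : TopologicalSpace V :=
  TopologicalSpace.ofClosed {Z | zariskiClosure Z ⊆ Z}
    (fun v hv => by
      have h := hv 1 (fun s hs => hs.elim)
      simp [polyEval] at h)
    (fun A hA v hv Z hZ => hA hZ (zariskiClosure_mono (Set.sInter_subset_of_mem hZ) hv))
    (fun A hA B hB v hv => by
      by_contra hn
      rw [Set.mem_union, not_or] at hn
      have h1 : v ∉ zariskiClosure A := fun h => hn.1 (hA h)
      have h2 : v ∉ zariskiClosure B := fun h => hn.2 (hB h)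
      simp only [zariskiClosure, Set.mem_ofPred_eq, not_forall] at h1 h2
      obtain ⟨p, hp, hpv⟩ := h1
      obtain ⟨q, hq, hqv⟩ := h2
      have h := hv (p * q) (by
        rintro s (hs | hs)
        · simp only [polyEval, map_mul]
          exact mul_eq_zero_of_left (hp s hs) _
        · simp only [polyEval, map_mul]
          exact mul_eq_zero_of_right _ (hq s hs))
      simp only [polyEval, map_mul] at h
      exact (mul_eq_zero.1 h).elim hpv hqv)

theorem isClosed_zariski_iff {Z : Set V} :
    IsClosed[zariskiTopology V] Z ↔ zariskiClosure Z ⊆ Z := by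
  rw [← @isOpen_compl_iff _ _ (zariskiTopology V)]
  change Zᶜᶜ ∈ {Z : Set V | zariskiClosure Z ⊆ Z} ↔ _
  rw [compl_compl]
  rfl

/-- Linear maps are continuous for the Zariski topologies. -/
theorem continuous_zariski (f : V →ₗ[ℂ] W) :
    Continuous[zariskiTopology V, zariskiTopology W] f := by
  let := zariskiTopology V
  let := zariskiTopology W
  refine continuous_iff_isClosed.2 fun Z hZ => ?_
  rw [isClosed_zariski_iff] at hZ ⊢
  intro v hv
  refine hZ fun p hp => ?_
  have key : ∀ u : V, polyEval (MvPolynomial.rename (fun φ : Dual ℂ W => φ ∘ₗ f) p) u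
      = polyEval p (f u) := by
    intro u
    simp only [polyEval, MvPolynomial.eval_rename]
    rfl
  rw [← key]
  exact hv _ fun s hs => (key s).trans (hp _ hs)

/-! ### Tangent spaces, smooth points, projective duality of cones -/

/-- The differential at `v` of the polynomial function given by `p`, as a linear form on `V`:
apply to `p` the derivation sending each linear form `φ` to the constant `φ w`, and evaluate
at `v`. -/
def differential (p : MvPolynomial (Dual ℂ V) ℂ) (v : V) : V →ₗ[ℂ] ℂ where
  toFun w := polyEval (MvPolynomial.mkDerivation ℂ
    (fun φ : Dual ℂ V => (MvPolynomial.C (φ w) : MvPolynomial (Dual ℂ V) ℂ)) p) v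
  map_add' w w' := by
    have h : MvPolynomial.mkDerivation ℂ
        (fun φ : Dual ℂ V => (MvPolynomial.C (φ (w + w')) : MvPolynomial (Dual ℂ V) ℂ))
        = MvPolynomial.mkDerivation ℂ (fun φ => MvPolynomial.C (φ w))
          + MvPolynomial.mkDerivation ℂ (fun φ => MvPolynomial.C (φ w')) :=
      MvPolynomial.derivation_ext (by simp [MvPolynomial.mkDerivation_X])
    rw [h]
    simp [polyEval]
  map_smul' c w := by
    have h : MvPolynomial.mkDerivation ℂ
        (fun φ : Dual ℂ V => (MvPolynomial.C (φ (c • w)) : MvPolynomial (Dual ℂ V) ℂ))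
        = c • MvPolynomial.mkDerivation ℂ (fun φ => MvPolynomial.C (φ w)) :=
      MvPolynomial.derivation_ext
        (by simp [MvPolynomial.mkDerivation_X, MvPolynomial.smul_eq_C_mul])
    rw [h]
    simp [polyEval, MvPolynomial.smul_eq_C_mul]

/-- The tangent space `T_y Y ⊆ V` of a subvariety `Y` of the vector space `V` at `y`: the common
kernel of the differentials at `y` of the polynomials in the ideal of `Y`. -/
def tangentSpace (Y : Set V) (y : V) : Submodule ℂ V :=
  ⨅ p ∈ vanishing Y, LinearMap.ker (differential p y)

/-- Smooth points of an irreducible subvariety `Y` of `V`: the points of `Y` where the tangent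
space has the smallest possible dimension (which is the dimension of `Y`). -/
def IsSmoothPoint (Y : Set V) (y : V) : Prop :=
  y ∈ Y ∧ ∀ z ∈ Y, finrank ℂ (tangentSpace Y y) ≤ finrank ℂ (tangentSpace Y z)

/-- Projective duality on the level of cones.  For an irreducible closed cone `Y = Cone X` in `V`
this is the cone over the dual variety of `X`: the Zariski closure in the dual space of the set of
linear forms that vanish on the tangent space of `Y` at some smooth point of `Y`. Thus the dual of
the cone `{0}` (over the empty variety) is the whole dual space, and the dual of `V` is `{0}`. -/
def dualCone (Y : Set V) : Set (Dual ℂ V) :=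
  zariskiClosure {φ | ∃ y, IsSmoothPoint Y y ∧ ∀ v ∈ tangentSpace Y y, φ v = 0}

/-- An orbit `O` in `V` corresponds to an orbit `O'` in the dual space under the Pyasetskii pairing
if the projectivization of the closure of `O'` is the projective dual of the projectivization
of the closure of `O`. -/
def PyasetskiiCorresponds (O : Set V) (O' : Set (Dual ℂ V)) : Prop :=
  dualCone (zariskiClosure O) = zariskiClosure O'

end Zariski

/-! ### Linear algebraic groups -/

section Groups

variable {n : ℕ}

variable (n) in
/-- The Zariski topology on `GL_n(ℂ)`, induced from the space of matrices. -/
@[reducible] def zariskiGL : TopologicalSpace (GL (Fin n) ℂ) :=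
  (zariskiTopology (Matrix (Fin n) (Fin n) ℂ)).induced Units.val

theorem continuous_mul_left_zariskiGL (g : GL (Fin n) ℂ) :
    Continuous[zariskiGL n, zariskiGL n] (fun x => g * x) := by
  let := zariskiTopology (Matrix (Fin n) (Fin n) ℂ)
  let := zariskiGL n
  have h := continuous_zariski
    (LinearMap.mulLeft ℂ (g : Matrix (Fin n) (Fin n) ℂ))
  exact continuous_induced_rng.2 (h.comp continuous_induced_dom)

theorem mul_mem_connectedComponentIn_zariskiGL (C : Subgroup (GL (Fin n) ℂ))
    (g : GL (Fin n) ℂ) (hg : g ∈ C)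
    (hor : g ∈ @connectedComponentIn _ (zariskiGL n) (C : Set (GL (Fin n) ℂ)) 1 ∨
      g⁻¹ ∈ @connectedComponentIn _ (zariskiGL n) (C : Set (GL (Fin n) ℂ)) 1)
    (x : GL (Fin n) ℂ)
    (hx : x ∈ @connectedComponentIn _ (zariskiGL n) (C : Set (GL (Fin n) ℂ)) 1) :
    g * x ∈ @connectedComponentIn _ (zariskiGL n) (C : Set (GL (Fin n) ℂ)) 1 := by
  let := zariskiGL n
  have one_mem : (1 : GL (Fin n) ℂ) ∈ connectedComponentIn (C : Set (GL (Fin n) ℂ)) 1 :=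
    mem_connectedComponentIn C.one_mem
  have hpre : IsPreconnected ((fun x => g * x) ''
      connectedComponentIn (C : Set (GL (Fin n) ℂ)) 1) :=
    isPreconnected_connectedComponentIn.image _ (continuous_mul_left_zariskiGL g).continuousOn
  have hsub : (fun x => g * x) '' connectedComponentIn (C : Set (GL (Fin n) ℂ)) 1 ⊆ C := by
    rintro _ ⟨y, hy, rfl⟩
    exact C.mul_mem hg (connectedComponentIn_subset _ _ hy)
  rcases hor with h | h
  · have h1 := hpre.subset_connectedComponentIn (x := g) ⟨1, one_mem, mul_one g⟩ hsub
    rw [← connectedComponentIn_eq h] at h1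
    exact h1 ⟨x, hx, rfl⟩
  · exact hpre.subset_connectedComponentIn ⟨g⁻¹, h, mul_inv_cancel g⟩ hsub ⟨x, hx, rfl⟩

/-- The identity component of a subgroup of `GL_n(ℂ)`: its connected component at `1` for the
Zariski topology. -/
def identityComponent (C : Subgroup (GL (Fin n) ℂ)) : Subgroup (GL (Fin n) ℂ) where
  carrier := @connectedComponentIn _ (zariskiGL n) (C : Set (GL (Fin n) ℂ)) 1
  one_mem' := @mem_connectedComponentIn _ (zariskiGL n) _ _ C.one_mem
  mul_mem' {a b} ha hb := mul_mem_connectedComponentIn_zariskiGL C a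
    (@connectedComponentIn_subset _ (zariskiGL n) _ _ _ ha) (Or.inl ha) b hb
  inv_mem' {a} ha := by
    have h := mul_mem_connectedComponentIn_zariskiGL C a⁻¹
      (C.inv_mem (@connectedComponentIn_subset _ (zariskiGL n) _ _ _ ha))
      (Or.inr (by rwa [inv_inv])) 1 (@mem_connectedComponentIn _ (zariskiGL n) _ _ C.one_mem)
    rwa [mul_one] at h

/-- `L` is a connected linear algebraic group: a Zariski closed connected subgroup of `GL_n(ℂ)`. -/
structure IsConnectedAlgebraicGroup (L : Subgroup (GL (Fin n) ℂ)) : Prop where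
  isClosed : IsClosed[zariskiGL n] (L : Set (GL (Fin n) ℂ))
  connected : identityComponent L = L

/-- `𝔩` is the Lie algebra of the algebraic group `L`: it consists of the matrices `X` such
that `exp (t X)` lies in `L` for all complex `t`. -/
def IsLieAlgebraOf (L : Subgroup (GL (Fin n) ℂ))
    (𝔩 : LieSubalgebra ℂ (Matrix (Fin n) (Fin n) ℂ)) : Prop :=
  ∀ X : Matrix (Fin n) (Fin n) ℂ,
    X ∈ 𝔩 ↔ ∀ t : ℂ, ∃ g ∈ L, (g : Matrix (Fin n) (Fin n) ℂ) = NormedSpace.exp (t • X)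

/-- The centralizer in `L` of a matrix `ξ` (the stabilizer of `ξ` for the adjoint action). -/
def centralizerIn (L : Subgroup (GL (Fin n) ℂ)) (ξ : Matrix (Fin n) (Fin n) ℂ) :
    Subgroup (GL (Fin n) ℂ) where
  carrier := {g | g ∈ L ∧ (g : Matrix (Fin n) (Fin n) ℂ) * ξ = ξ * g}
  one_mem' := ⟨L.one_mem, by simp⟩
  mul_mem' := by
    rintro a b ⟨ha, ha'⟩ ⟨hb, hb'⟩
    refine ⟨L.mul_mem ha hb, ?_⟩
    rw [Units.val_mul, mul_assoc, hb', ← mul_assoc, ha', mul_assoc]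
  inv_mem' := by
    rintro a ⟨ha, ha'⟩
    refine ⟨L.inv_mem ha, ?_⟩
    rw [Units.inv_mul_eq_iff_eq_mul, ← mul_assoc, ha', mul_assoc, Units.mul_inv, mul_one]

/-- The orbit in `𝔩` of `x` under the adjoint action (conjugation of matrices) of `G`. -/
def adOrbit {𝔩 : LieSubalgebra ℂ (Matrix (Fin n) (Fin n) ℂ)}
    (G : Subgroup (GL (Fin n) ℂ)) (x : 𝔩) : Set 𝔩 :=
  {y | ∃ g ∈ G, (y : Matrix (Fin n) (Fin n) ℂ) =
    (g : Matrix (Fin n) (Fin n) ℂ) * (x : Matrix (Fin n) (Fin n) ℂ) *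
      ((g⁻¹ : GL (Fin n) ℂ) : Matrix (Fin n) (Fin n) ℂ)}

end Groups

/-! ### Gradings and roots -/

section Lie

variable {𝔩 : Type*} [LieRing 𝔩] [LieAlgebra ℂ 𝔩]

/-- A `ℤ`-grading is short if exactly the parts of degrees `-1`, `0`, `1` are non-zero. -/
def IsShort (ℒ : ℤ → Submodule ℂ 𝔩) : Prop :=
  ∀ k, ℒ k ≠ ⊥ ↔ k = -1 ∨ k = 0 ∨ k = 1

/-- `ξ` is the element that defines the grading: `ℒ k` is the `k`-eigenspace of `ad ξ`. -/
def IsGradingElement (ℒ : ℤ → Submodule ℂ 𝔩) (ξ : 𝔩) : Prop :=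
  ∀ (k : ℤ) (x : 𝔩), x ∈ ℒ k ↔ ⁅ξ, x⁆ = (k : ℂ) • x

/-- The partial sum `v_1 + … + v_k` of a finite sequence `v_1, …, v_r`. -/
def partialSum {M : Type*} [AddCommMonoid M] {r : ℕ} (v : Fin r → M) (k : ℕ) : M :=
  ∑ i with i.val < k, v i

variable [FiniteDimensional ℂ 𝔩] [LieAlgebra.IsKilling ℂ 𝔩]
  (H : LieSubalgebra ℂ 𝔩) [H.IsCartanSubalgebra]

/-- A long root: a root of maximal length, for the canonical Weyl-invariant form. -/
def IsLong (α : H.root) : Prop :=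
  ∀ β : H.root, ((LieAlgebra.IsKilling.rootSystem H).posRootForm ℤ).rootLength β ≤
    ((LieAlgebra.IsKilling.rootSystem H).posRootForm ℤ).rootLength α

/-- The coroot `α^∨` of a root `α`, as an element of `𝔩`. -/
def corootElement (α : H.root) : 𝔩 :=
  ((LieAlgebra.IsKilling.coroot α.1 : H) : 𝔩)

/-- `Δ_k`: the roots whose root space lies in the part of degree `k`. -/
def rootsOfDegree (ℒ : ℤ → Submodule ℂ 𝔩) (k : ℤ) : Set H.root :=
  {α | (LieAlgebra.rootSpace H α.1).toSubmodule ≤ ℒ k}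

/-- `α_1, …, α_r` is a maximal sequence of pairwise orthogonal long roots in `Δ_1`: it cannot be
extended by a further long root of `Δ_1` orthogonal to all its members. -/
structure IsMaximalOrthogonalLong (ℒ : ℤ → Submodule ℂ 𝔩) {r : ℕ} (α : Fin r → H.root) :
    Prop where
  mem : ∀ i, α i ∈ rootsOfDegree H ℒ 1
  long : ∀ i, IsLong H (α i)
  orthogonal : ∀ i j, i ≠ j → (LieAlgebra.IsKilling.rootSystem H).IsOrthogonal (α i) (α j)
  maximal : ∀ β ∈ rootsOfDegree H ℒ 1, IsLong H β →
    ∃ i, ¬ (LieAlgebra.IsKilling.rootSystem H).IsOrthogonal (α i) β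

end Lie

end ShortGrading

end

/-!
The grading is by the eigenvalues of `ad ξ`, and `ξ` lies in the Cartan subalgebra. For a set `T`
of indices let `e_T = ∑_{i ∈ T} e_i`, and define `f_T` and `h_T` in the same way, with coroots in
the case of `h_T`. Since a root of degree one pairs to at most two with a sum of coroots of
orthogonal long roots of degree one, the eigenvalues of `ad h_T` on `𝔩_1` are `0`, `1` and `2`.

*Orbits.* By irreducibility of the root system and maximality of the sequence, the span of the
orbit of a non-zero `y ∈ 𝔩_1` contains some `e_j`, so `y` can be moved until its part of weight two
for `α_j^∨`, which is a multiple `c e_j`, is not zero. A single exponential, of `c⁻¹ [f_j, y₁]`,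
then removes the part `y₁` of weight one. The rest commutes with `α_j^∨` and is treated in the same
way inside the centralizer of `α_j^∨`; thus every `y` is conjugate to some `e_T`, and sets `T` of
the same size give the same orbit.

*Closures.* The rank of `(ad x)²` is lower semicontinuous and increases with the size of `T`,
whereas rescaling the summands of `e_T` shows that `e_{T'}` is in the closure of the orbit of `e_T`
if `T' ⊆ T`.

*Duality.* The tangent space of the closure of the orbit at `e_T` is the sum of the eigenspaces of
`h_T` on `𝔩_1` for `1` and `2`: the minors of `(ad x)²` bound it from above and the orbit itself
from below. Its annihilator for the Killing form is the centralizer of `h_T` in `𝔩_{-1}`, and by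
the normal forms in that centralizer the dual cone is the closure of the orbit of `f_{Tᶜ}`.

The statements on `𝔩_{-1}` are those on `𝔩_1` for the grading element `-ξ`.
-/

noncomputable section

namespace ShortGrading

open LieAlgebra LieAlgebra.IsKilling

/-! ### Long roots and degrees -/

section RootPairing

variable {ι K M N : Type*} [Field K] [CharZero K] [AddCommGroup M] [Module K M]
  [AddCommGroup N] [Module K N] {P : RootPairing ι K M N} [P.IsCrystallographic]

theorem pairingIn_reflectionPerm_left (a b c : ι) :
    P.pairingIn ℤ (P.reflectionPerm a b) c =
      P.pairingIn ℤ b c - P.pairingIn ℤ b a * P.pairingIn ℤ a c := by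
  have hroot : P.root (P.reflectionPerm a b) =
      (1 : ℤ) • P.root b + (-P.pairingIn ℤ b a) • P.root a := by
    rw [P.root_reflectionPerm, P.reflection_apply_root' ℤ, one_smul, neg_smul, sub_eq_add_neg]
  rw [P.pairingIn_eq_add_of_root_eq_smul_add_smul hroot]
  simp only [smul_eq_mul]
  ring

theorem pairingIn_eq_zero_comm {a b : ι} : P.pairingIn ℤ a b = 0 ↔ P.pairingIn ℤ b a = 0 :=
  have : Module.IsReflexive K M := .of_isPerfPair P.toLinearMap
  P.pairingIn_eq_zero_iff

variable (P) in
theorem exists_pairingIn_ne_zero_and_ne_zero [P.IsIrreducible] (i j : ι) :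
    ∃ k, P.pairingIn ℤ k i ≠ 0 ∧ P.pairingIn ℤ k j ≠ 0 := by
  by_contra! hij
  let q := Submodule.span K (P.root '' {k | P.pairingIn ℤ k i ≠ 0})
  have root_mem {k : ι} (hk : P.pairingIn ℤ k i ≠ 0) : P.root k ∈ q :=
    Submodule.subset_span ⟨k, hk, rfl⟩
  -- a reflection in a root orthogonal to `i` preserves the pairing with `i`
  have hq (a : ι) : q ∈ Module.End.invtSubmodule (P.reflection a : M →ₗ[K] M) := by
    refine Submodule.span_le.mpr ?_
    rintro _ ⟨k, hk, rfl⟩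
    change P.reflection a (P.root k) ∈ q
    by_cases ha : P.pairingIn ℤ a i = 0
    · rw [← P.root_reflectionPerm]
      exact root_mem (by rwa [pairingIn_reflectionPerm_left, ha, mul_zero, sub_zero])
    · rw [P.reflection_apply_root]
      exact q.sub_mem (root_mem hk) (q.smul_mem _ (root_mem ha))
  have hq_ne_bot : q ≠ ⊥ :=
    Submodule.ne_bot_iff _ |>.mpr ⟨P.root i, root_mem (by simp), P.ne_zero i⟩
  have hq_top : q = ⊤ :=
    RootPairing.IsIrreducible.eq_top_of_invtSubmodule_reflection (P := P) q hq hq_ne_bot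
  have hle : q ≤ LinearMap.ker (P.coroot' j) := by
    refine Submodule.span_le.mpr ?_
    rintro _ ⟨k, hk, rfl⟩
    change P.pairing k j = 0
    rw [← P.algebraMap_pairingIn ℤ, hij k hk, map_zero]
  have hjj : P.pairing j j = 0 := hle (hq_top ▸ Submodule.mem_top (x := P.root j))
  simp at hjj

variable (P) in
/-- A long root: a root of maximal length, for the canonical Weyl-invariant form. -/
def IsLongRoot [Fintype ι] (a : ι) : Prop :=
  ∀ b, (P.posRootForm ℤ).rootLength b ≤ (P.posRootForm ℤ).rootLength a

theorem IsLongRoot.pairingIn_mem [Fintype ι] {a b : ι} (ha : IsLongRoot P a) (hab : b ≠ a)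
    (hab' : P.root b ≠ -P.root a) : P.pairingIn ℤ b a ∈ ({-1, 0, 1} : Set ℤ) := by
  by_contra h
  exact (ha b).not_gt ((P.posRootForm ℤ).rootLength_lt_of_pairingIn_notMem
    (fun h => hab (P.root.injective h)) hab' h)

variable (P) in
theorem exists_isLongRoot_pairingIn_pos [Fintype ι] [P.IsIrreducible] (b : ι) :
    ∃ c, IsLongRoot P c ∧ 0 < P.pairingIn ℤ c b := by
  have : Nonempty ι := ⟨b⟩
  let B := P.posRootForm ℤ
  obtain ⟨l, hl⟩ := Finite.exists_max B.rootLength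
  obtain ⟨k, hk, hkb⟩ := P.exists_form_eq_form_and_form_ne_zero B.toInvariantForm b l
  have hkl : B.rootLength k = B.rootLength l :=
    FaithfulSMul.algebraMap_injective ℤ K (by simpa only [B.algebraMap_rootLength] using! hk)
  have hk_long : IsLongRoot P k := fun c => (hl c).trans_eq hkl.symm
  have hkb_ne : P.pairingIn ℤ k b ≠ 0 := fun h => hkb <|
    (B.toInvariantForm.apply_root_root_zero_iff b k).mpr <| by
      rw [← P.algebraMap_pairingIn ℤ, pairingIn_eq_zero_comm.mp h, map_zero]
  rcases hkb_ne.lt_or_gt with h | h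
  · refine ⟨P.reflectionPerm k k, fun c => ?_, ?_⟩
    · exact (hk_long c).trans_eq (B.rootLength_reflectionPerm_self k).symm
    · rwa [P.pairingIn_reflectionPerm_self_left, neg_pos]
  · exact ⟨k, hk_long, h⟩

theorem IsLongRoot.two_le_pairingIn [Fintype ι] {b c : ι} (hc : IsLongRoot P c)
    (hb : ¬ IsLongRoot P b) (hcb : 0 < P.pairingIn ℤ c b) : 2 ≤ P.pairingIn ℤ c b := by
  by_contra hlt
  have hone : P.pairingIn ℤ c b = 1 := by omega
  exact hb fun x => (hc x).trans ((P.posRootForm ℤ).rootLength_le_of_pairingIn_eq (.inr hone))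

variable (P) in
/-- The degrees of the roots in a short grading: degree functions with values `-1`, `0`, `1`.
Additivity is encoded through reflections, as `d (b - ⟨b, a^∨⟩ a) = d b - ⟨b, a^∨⟩ d a`. -/
structure IsShortDegree (d : ι → ℤ) : Prop where
  mem : ∀ a, d a = -1 ∨ d a = 0 ∨ d a = 1
  reflectionPerm : ∀ a b, d (P.reflectionPerm a b) = d b - P.pairingIn ℤ b a * d a

namespace IsShortDegree

variable {d : ι → ℤ} (hd : IsShortDegree P d)
include hd

theorem degree_neg (a : ι) : d (P.reflectionPerm a a) = -d a := by
  rw [hd.reflectionPerm, P.pairingIn_same]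
  ring

omit [CharZero K] in
theorem pairingIn_nonneg {a b : ι} (ha : d a = 1) (hb : d b = 1) : 0 ≤ P.pairingIn ℤ b a := by
  have h := hd.reflectionPerm a b
  have := hd.mem (P.reflectionPerm a b)
  rw [ha, hb] at h
  omega

section Orthogonal

variable {κ : Type*} {a : κ → ι} (ha : ∀ i, d (a i) = 1)
  (horth : Pairwise fun i j => P.pairingIn ℤ (a i) (a j) = 0)
include ha horth

theorem exists_degree_eq_sub_sum (T : Finset κ) (b : ι) :
    ∃ c, d c = d b - ∑ i ∈ T, P.pairingIn ℤ b (a i) := by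
  classical
  suffices ∃ c, d c = d b - ∑ i ∈ T, P.pairingIn ℤ b (a i) ∧
      ∀ x, (∀ i ∈ T, P.pairingIn ℤ (a i) x = 0) → P.pairingIn ℤ c x = P.pairingIn ℤ b x from
    this.imp fun _ => And.left
  induction T using Finset.induction_on with
  | empty => exact ⟨b, by simp, fun _ _ => rfl⟩
  | insert i T hi ih =>
    obtain ⟨c, hc, hcx⟩ := ih
    have hci : P.pairingIn ℤ c (a i) = P.pairingIn ℤ b (a i) :=
      hcx (a i) fun j hj => horth (ne_of_mem_of_not_mem hj hi)
    refine ⟨P.reflectionPerm (a i) c, ?_, fun x hx => ?_⟩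
    · rw [hd.reflectionPerm, hc, ha, hci, Finset.sum_insert hi]
      ring
    · rw [pairingIn_reflectionPerm_left, hx i (Finset.mem_insert_self _ _),
        hcx x fun j hj => hx j (Finset.mem_insert_of_mem hj)]
      ring

theorem sum_pairingIn_le_two (T : Finset κ) {b : ι} (hb : d b = 1) :
    ∑ i ∈ T, P.pairingIn ℤ b (a i) ≤ 2 := by
  obtain ⟨c, hc⟩ := hd.exists_degree_eq_sub_sum ha horth T b
  have := hd.mem c
  omega

end Orthogonal

theorem exists_isLongRoot [Fintype ι] [P.IsIrreducible] {b : ι} (hb : d b = 1) :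
    ∃ c, IsLongRoot P c ∧ d c = 1 ∧ P.pairingIn ℤ c b ≠ 0 ∧
      ∀ a, d a = 1 → P.pairingIn ℤ b a = 0 → P.pairingIn ℤ c a = 0 := by
  by_cases hb_long : IsLongRoot P b
  · exact ⟨b, hb_long, hb, by simp, fun _ _ h => h⟩
  obtain ⟨c, hc_long, hcb⟩ := exists_isLongRoot_pairingIn_pos P b
  have hcb_ge := hc_long.two_le_pairingIn hb_long hcb
  let c' := P.reflectionPerm b c
  have hc'_deg : d c' = d c - P.pairingIn ℤ c b := by rw [hd.reflectionPerm, hb, mul_one]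
  have hc_mem := hd.mem c
  have hc'_mem := hd.mem c'
  have hc_deg : d c = 1 := by omega
  refine ⟨c, hc_long, hc_deg, by omega, fun a ha hba => ?_⟩
  -- `-s_b(c)` also has degree one, and pairs with `a` to `-⟨c, a⟩`
  have hneg : 0 ≤ P.pairingIn ℤ (P.reflectionPerm c' c') a :=
    hd.pairingIn_nonneg ha (by rw [hd.degree_neg]; omega)
  rw [P.pairingIn_reflectionPerm_self_left, pairingIn_reflectionPerm_left, hba] at hneg
  have hpos := hd.pairingIn_nonneg ha hc_deg
  omega

theorem exists_degree_one [P.IsIrreducible] {a : ι} (ha : d a = 1) (b : ι) :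
    ∃ c, d c = 1 ∧ P.pairingIn ℤ c a ≠ 0 ∧ P.pairingIn ℤ c b ≠ 0 := by
  by_cases hab : P.pairingIn ℤ a b = 0
  swap
  · exact ⟨a, ha, by simp, hab⟩
  suffices ∃ c, d c ≠ 0 ∧ P.pairingIn ℤ c a ≠ 0 ∧ P.pairingIn ℤ c b ≠ 0 by
    obtain ⟨c, hc, hca, hcb⟩ := this
    rcases hd.mem c with h | h | h
    · exact ⟨P.reflectionPerm c c, by rw [hd.degree_neg, h, neg_neg], by simpa, by simpa⟩
    · exact absurd h hc
    · exact ⟨c, h, hca, hcb⟩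
  obtain ⟨c, hca, hcb⟩ := exists_pairingIn_ne_zero_and_ne_zero P a b
  by_cases hc : d c = 0
  · refine ⟨P.reflectionPerm a c, ?_, ?_, ?_⟩
    · rwa [hd.reflectionPerm, hc, ha, mul_one, zero_sub, neg_ne_zero]
    · rw [pairingIn_reflectionPerm_left, P.pairingIn_same]
      omega
    · rwa [pairingIn_reflectionPerm_left, hab, mul_zero, sub_zero]
  · exact ⟨c, hc, hca, hcb⟩

theorem exists_sum_pairingIn_eq_one [P.IsIrreducible] {κ : Type*} {a : κ → ι}
    (ha : ∀ i, d (a i) = 1) (horth : Pairwise fun i j => P.pairingIn ℤ (a i) (a j) = 0)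
    {T : Finset κ} (hT : T.Nonempty) {b : ι} (hb : d b = 1)
    (hbT : ∑ i ∈ T, P.pairingIn ℤ b (a i) = 0) :
    ∃ c, d c = 1 ∧ P.pairingIn ℤ b c ≠ 0 ∧ ∑ i ∈ T, P.pairingIn ℤ c (a i) = 1 := by
  obtain ⟨i, hi⟩ := hT
  obtain ⟨c, hc, hci, hcb⟩ := hd.exists_degree_one (ha i) b
  refine ⟨c, hc, fun h => hcb (pairingIn_eq_zero_comm.mp h), ?_⟩
  have hpos : 0 < ∑ i ∈ T, P.pairingIn ℤ c (a i) :=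
    Finset.sum_pos' (fun j _ => hd.pairingIn_nonneg (ha j) hc)
      ⟨i, hi, (hd.pairingIn_nonneg (ha i) hc).lt_of_ne' hci⟩
  have hle := hd.sum_pairingIn_le_two ha horth T hc
  by_contra hne
  have htwo : ∑ i ∈ T, P.pairingIn ℤ c (a i) = 2 := by omega
  -- `s_b(c)` has degree at most zero, and subtracting two from its degree leads below `-1`
  have htwo' : ∑ i ∈ T, P.pairingIn ℤ (P.reflectionPerm b c) (a i) = 2 := by
    simp only [pairingIn_reflectionPerm_left, Finset.sum_sub_distrib, ← Finset.mul_sum, hbT, htwo,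
      mul_zero, sub_zero]
  obtain ⟨c', hc'⟩ := hd.exists_degree_eq_sub_sum ha horth T (P.reflectionPerm b c)
  rw [htwo', hd.reflectionPerm, hc, hb] at hc'
  have hc'_mem := hd.mem c'
  have hcb_nonneg := hd.pairingIn_nonneg hb hc
  omega

end IsShortDegree

end RootPairing

/-! ### Eigenspaces of the adjoint action and frames -/

section Eigenspace

variable {R 𝔩 : Type*} [CommRing R] [LieRing 𝔩] [LieAlgebra R 𝔩]

/-- The eigenspace of `ad x` for the eigenvalue `k`. -/
def lieEigenspace (x : 𝔩) (k : R) : Submodule R 𝔩 :=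
  (ad R 𝔩 x).eigenspace k

theorem mem_lieEigenspace {x : 𝔩} {k : R} {y : 𝔩} : y ∈ lieEigenspace x k ↔ ⁅x, y⁆ = k • y :=
  Module.End.mem_eigenspace_iff

theorem mem_lieEigenspace_zero {x y : 𝔩} : y ∈ lieEigenspace x (0 : R) ↔ ⁅x, y⁆ = 0 := by
  rw [mem_lieEigenspace, zero_smul]

theorem lie_mem_lieEigenspace {x y z : 𝔩} {a b c : R} (hy : y ∈ lieEigenspace x a)
    (hz : z ∈ lieEigenspace x b) (h : a + b = c) : ⁅y, z⁆ ∈ lieEigenspace x c := by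
  rw [mem_lieEigenspace] at *
  rw [leibniz_lie, hy, hz, smul_lie, lie_smul, ← add_smul, h]

theorem mem_lieEigenspace_sum_smul {ι : Type*} [Fintype ι] {x : ι → 𝔩} {y : 𝔩} {i : ι} {k : R}
    (a : ι → R) (hi : y ∈ lieEigenspace (x i) k)
    (hne : ∀ j ≠ i, y ∈ lieEigenspace (x j) (0 : R)) :
    y ∈ lieEigenspace (∑ j, a j • x j) (a i * k) := by
  rw [mem_lieEigenspace, sum_lie, Finset.sum_eq_single i, smul_lie, mem_lieEigenspace.mp hi,
    smul_smul]
  · intro j _ hji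
    rw [smul_lie, mem_lieEigenspace_zero.mp (hne j hji), smul_zero]
  · exact fun h => (h (Finset.mem_univ i)).elim

theorem lieEigenspace_neg (x : 𝔩) (k : R) : lieEigenspace (-x) k = lieEigenspace x (-k) := by
  ext y
  rw [mem_lieEigenspace, mem_lieEigenspace, neg_lie, neg_smul, neg_eq_iff_eq_neg]

theorem eq_zero_of_mem_lieEigenspace [IsDomain R] [IsTorsionFree R 𝔩] {x y : 𝔩} {a b : R}
    (ha : y ∈ lieEigenspace x a) (hb : y ∈ lieEigenspace x b) (h : a ≠ b) : y = 0 :=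
  (Submodule.disjoint_def.mp ((ad R 𝔩 x).disjoint_genEigenspace h 1 1)) y ha hb

/-- Subspaces that are stable under the adjoint action of the elements of `K`. -/
def IsLieStable (K N : Submodule R 𝔩) : Prop :=
  ∀ h ∈ K, ∀ y ∈ N, ⁅h, y⁆ ∈ N

variable {K K' N N' : Submodule R 𝔩}

theorem IsLieStable.mono_left (hN : IsLieStable K' N) (hK : K ≤ K') : IsLieStable K N :=
  fun h hh => hN h (hK hh)

theorem IsLieStable.top : IsLieStable K (⊤ : Submodule R 𝔩) :=
  fun _ _ _ _ => Submodule.mem_top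

theorem IsLieStable.inf (hN : IsLieStable K N) (hN' : IsLieStable K N') :
    IsLieStable K (N ⊓ N') :=
  fun h hh y hy => ⟨hN h hh y hy.1, hN' h hh y hy.2⟩

theorem IsLieStable.lieEigenspace {H : LieSubalgebra R 𝔩} [IsLieAbelian H] {x : 𝔩}
    (hx : x ∈ H) (k : R) : IsLieStable H (lieEigenspace x k) := by
  intro h hh y hy
  have hxh : ⁅x, h⁆ = 0 :=
    congrArg Subtype.val (LieModule.IsTrivial.trivial (⟨x, hx⟩ : H) (⟨h, hh⟩ : H))
  exact lie_mem_lieEigenspace (mem_lieEigenspace_zero.mpr hxh) hy (zero_add k)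

end Eigenspace

section Roots

variable {𝔩 : Type*} [LieRing 𝔩] [LieAlgebra ℂ 𝔩] [FiniteDimensional ℂ 𝔩]
  [LieAlgebra.IsKilling ℂ 𝔩] {H : LieSubalgebra ℂ 𝔩} [H.IsCartanSubalgebra]

theorem lie_cartan_eq_zero {x h : 𝔩} (hx : x ∈ H) (hh : h ∈ H) : ⁅x, h⁆ = 0 :=
  congrArg Subtype.val (LieModule.IsTrivial.trivial (⟨x, hx⟩ : H) (⟨h, hh⟩ : H))

theorem mem_lieEigenspace_of_mem_rootSpace {β : H.root} {v : 𝔩} (hv : v ∈ rootSpace H β.1)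
    {h : 𝔩} (hh : h ∈ H) : v ∈ lieEigenspace h (β.1 ⟨h, hh⟩) :=
  mem_lieEigenspace.mpr (lie_eq_smul_of_mem_rootSpace hv ⟨h, hh⟩)

theorem corootElement_mem (a : H.root) : corootElement H a ∈ H :=
  Subtype.property _

theorem mem_lieEigenspace_corootElement {β : H.root} {v : 𝔩} (hv : v ∈ rootSpace H β.1)
    (a : H.root) :
    v ∈ lieEigenspace (corootElement H a) ((rootSystem H).pairingIn ℤ β a : ℂ) := by
  have h : ((rootSystem H).pairingIn ℤ β a : ℂ) = β.1 (coroot a.1) := by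
    rw [← rootSystem_pairing_apply, ← (rootSystem H).algebraMap_pairingIn ℤ β a]
    rfl
  exact h ▸ mem_lieEigenspace_of_mem_rootSpace hv (corootElement_mem a)

theorem coe_reflectionPerm_self (a : H.root) :
    (((rootSystem H).reflectionPerm a a).1 : LieModule.Weight ℂ H 𝔩) = -a.1 := by
  have h := (rootSystem H).root_reflectionPerm a a
  rw [RootPairing.reflection_apply_self] at h
  ext x
  exact LinearMap.congr_fun h x

theorem corootElement_reflectionPerm_self (a : H.root) :
    corootElement H ((rootSystem H).reflectionPerm a a) = -corootElement H a := by
  rw [corootElement, coe_reflectionPerm_self, coroot_neg]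
  rfl

theorem exists_eq_smul_of_mem_rootSpace {β : H.root} {v w : 𝔩} (hv : v ∈ rootSpace H β.1)
    (hv0 : v ≠ 0) (hw : w ∈ rootSpace H β.1) : ∃ c : ℂ, w = c • v := by
  have hdim := finrank_rootSpace_eq_one β.1 (LieSubalgebra.isNonZero_coe_root β)
  obtain ⟨c, hc⟩ := (finrank_eq_one_iff_of_nonzero' (⟨v, hv⟩ : rootSpace H β.1)
    (by simpa [Subtype.ext_iff] using hv0)).1 hdim ⟨w, hw⟩
  exact ⟨c, (congrArg Subtype.val hc).symm⟩

theorem exists_lie_eq_corootElement {β : H.root} {v : 𝔩} (hv : v ∈ rootSpace H β.1) (hv0 : v ≠ 0) :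
    ∃ v' ∈ rootSpace H ((rootSystem H).reflectionPerm β β).1, ⁅v, v'⁆ = corootElement H β := by
  obtain ⟨h, e', f', ht, he', hf'⟩ :=
    exists_isSl2Triple_of_weight_isNonZero (LieSubalgebra.isNonZero_coe_root β)
  obtain ⟨c, rfl⟩ := exists_eq_smul_of_mem_rootSpace hv hv0 he'
  refine ⟨c • f', Submodule.smul_mem _ _ (by rwa [coe_reflectionPerm_self]), ?_⟩
  rw [lie_smul, ← smul_lie, ht.lie_e_f]
  exact ht.h_eq_coroot (LieSubalgebra.isNonZero_coe_root β) he' hf'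

theorem lie_lie_eq_pairingIn_smul {β δ : H.root} {v v' w : 𝔩} (hv : ⁅v, v'⁆ = corootElement H β)
    (hw : w ∈ rootSpace H δ.1) (hwv : ⁅w, v⁆ = 0) :
    ⁅⁅w, v'⁆, v⁆ = ((rootSystem H).pairingIn ℤ δ β : ℂ) • w := by
  rw [lie_lie, hwv, lie_zero, sub_zero, ← lie_skew v' v, hv, lie_neg, lie_skew,
    mem_lieEigenspace.mp (mem_lieEigenspace_corootElement hw β)]

omit [LieAlgebra.IsKilling ℂ 𝔩] in
theorem IsLieStable.le_of_rootVector_mem {N N' : Submodule ℂ 𝔩} (hN : IsLieStable H N)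
    (hroot : ∀ β : H.root, ∀ v ∈ N, v ∈ rootSpace H β.1 → v ∈ N')
    (hcartan : ∀ v ∈ N, v ∈ H → v ∈ N') : N ≤ N' := by
  intro y hy
  let L : LieSubmodule ℂ H 𝔩 := { N with lie_mem := fun {h y} hy => hN h h.2 y hy }
  have hmem : (⟨y, hy⟩ : L) ∈ ⨆ χ : H → ℂ, LieModule.genWeightSpace L χ :=
    LieModule.iSup_genWeightSpace_eq_top ℂ H L ▸ LieSubmodule.mem_top _
  refine LieSubmodule.iSup_induction (motive := fun x : L => (x : 𝔩) ∈ N') _ hmem (fun χ v hv => ?_)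
    N'.zero_mem (fun _ _ => N'.add_mem)
  have hvχ : (v : 𝔩) ∈ rootSpace H χ :=
    LieModule.map_genWeightSpace_le L.incl (LieSubmodule.mem_map_of_mem hv)
  rcases eq_or_ne χ 0 with rfl | hχ
  · exact hcartan _ v.2 (by simpa [rootSpace_zero_eq] using hvχ)
  · rcases eq_or_ne (v : 𝔩) 0 with hv0 | hv0
    · exact hv0 ▸ N'.zero_mem
    · have hne : rootSpace H χ ≠ ⊥ := fun h => hv0 (by simpa [h] using hvχ)
      exact hroot ⟨⟨χ, hne⟩, Finset.mem_filter.mpr ⟨Finset.mem_univ _, hχ⟩⟩ v v.2 hvχ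

/-- The sum of the coroots with index in `T`. Its eigenvalues on a part of a short grading are
the invariants by which the orbits of sums of orthogonal root vectors are told apart. -/
def corootSum {κ : Type*} (α : κ → H.root) (T : Finset κ) : 𝔩 :=
  ∑ i ∈ T, corootElement H (α i)

variable {κ : Type*} {α : κ → H.root}

theorem corootSum_mem (T : Finset κ) : corootSum α T ∈ H :=
  sum_mem fun _ _ => corootElement_mem _

theorem corootSum_singleton (i : κ) : corootSum α {i} = corootElement H (α i) :=
  Finset.sum_singleton _ _

theorem corootSum_reflectionPerm (T : Finset κ) :
    corootSum (fun i => (rootSystem H).reflectionPerm (α i) (α i)) T = -corootSum α T := by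
  simp only [corootSum, corootElement_reflectionPerm_self, Finset.sum_neg_distrib]

theorem mem_lieEigenspace_corootSum {β : H.root} {v : 𝔩} (hv : v ∈ rootSpace H β.1)
    (T : Finset κ) : v ∈ lieEigenspace (corootSum α T)
      ((∑ i ∈ T, (rootSystem H).pairingIn ℤ β (α i) : ℤ) : ℂ) := by
  rw [mem_lieEigenspace, corootSum, sum_lie, Int.cast_sum, Finset.sum_smul]
  exact Finset.sum_congr rfl fun i _ => mem_lieEigenspace.mp (mem_lieEigenspace_corootElement hv _)

end Roots

section Frame

variable {𝔩 : Type*} [LieRing 𝔩] [LieAlgebra ℂ 𝔩] [FiniteDimensional ℂ 𝔩]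
  [LieAlgebra.IsKilling ℂ 𝔩] (H : LieSubalgebra ℂ 𝔩) [H.IsCartanSubalgebra] {κ : Type*}

variable {H} in
/-- The eigenspace of the sum of the coroots with index in `T` on the part of degree one. -/
def weightPart (ξ : 𝔩) (α : κ → H.root) (T : Finset κ) (k : ℂ) : Submodule ℂ 𝔩 :=
  lieEigenspace ξ 1 ⊓ lieEigenspace (corootSum α T) k

/-- A frame of a short grading: the grading element `ξ`, which lies in the Cartan subalgebra `H`,
the degrees `d` of the roots, a maximal family of pairwise orthogonal long roots `α i` of degree
one, and root vectors `e i`, `f i` for `α i`, `-α i` normalized by `⁅e i, f i⁆ = (α i)^∨`. -/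
structure IsFrame (ξ : 𝔩) (d : H.root → ℤ) (α : κ → H.root) (e f : κ → 𝔩) : Prop where
  mem_cartan : ξ ∈ H
  apply_eq : ∀ β : H.root, β.1 ⟨ξ, mem_cartan⟩ = d β
  degree_mem : ∀ β, d β = -1 ∨ d β = 0 ∨ d β = 1
  degree_one : ∀ i, d (α i) = 1
  long : ∀ i, IsLongRoot (rootSystem H) (α i)
  orthogonal : Pairwise fun i j => (rootSystem H).pairingIn ℤ (α i) (α j) = 0
  maximal : ∀ β, d β = 1 → IsLongRoot (rootSystem H) β →
    ∃ i, (rootSystem H).pairingIn ℤ (α i) β ≠ 0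
  triple : ∀ i, IsSl2Triple (corootElement H (α i)) (e i) (f i)
  e_mem : ∀ i, e i ∈ rootSpace H (α i).1
  f_mem : ∀ i, f i ∈ rootSpace H ((rootSystem H).reflectionPerm (α i) (α i)).1

variable {H} {ξ : 𝔩} {d : H.root → ℤ} {α : κ → H.root} {e f : κ → 𝔩}

namespace IsFrame

variable (F : IsFrame H ξ d α e f)
include F

theorem mem_grading {β : H.root} {v : 𝔩} (hv : v ∈ rootSpace H β.1) {k : ℤ} (hβ : d β = k) :
    v ∈ lieEigenspace ξ (k : ℂ) := by
  simpa only [← hβ, ← F.apply_eq] using mem_lieEigenspace_of_mem_rootSpace hv F.mem_cartan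

theorem cartan_mem_grading {h : 𝔩} (hh : h ∈ H) : h ∈ lieEigenspace ξ (0 : ℂ) :=
  mem_lieEigenspace_zero.mpr (lie_cartan_eq_zero F.mem_cartan hh)

theorem isShortDegree : IsShortDegree (rootSystem H) d where
  mem := F.degree_mem
  reflectionPerm a b := by
    have h := LinearMap.congr_fun ((rootSystem H).root_reflectionPerm a b) ⟨ξ, F.mem_cartan⟩
    rw [RootPairing.reflection_apply_root' ℤ] at h
    simp only [rootSystem_root_apply, LieModule.Weight.toLinear_apply, LinearMap.sub_apply,
      LinearMap.smul_apply, F.apply_eq, zsmul_eq_mul] at h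
    exact_mod_cast h

theorem e_mem_grading (i : κ) : e i ∈ lieEigenspace ξ (1 : ℂ) :=
  Int.cast_one (R := ℂ) ▸ F.mem_grading (F.e_mem i) (F.degree_one i)

theorem f_mem_grading (i : κ) : f i ∈ lieEigenspace ξ (-1 : ℂ) := by
  simpa using F.mem_grading (F.f_mem i) (k := -1)
    (by rw [F.isShortDegree.degree_neg, F.degree_one])

theorem sum_e_mem_grading (T : Finset κ) : ∑ i ∈ T, e i ∈ lieEigenspace ξ (1 : ℂ) :=
  sum_mem fun i _ => F.e_mem_grading i

theorem sum_f_mem_grading (T : Finset κ) : ∑ i ∈ T, f i ∈ lieEigenspace ξ (-1 : ℂ) :=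
  sum_mem fun i _ => F.f_mem_grading i

theorem neg : IsFrame H (-ξ) (fun β => -d β)
    (fun i => (rootSystem H).reflectionPerm (α i) (α i)) f e where
  mem_cartan := H.neg_mem F.mem_cartan
  apply_eq β := by
    have h : (⟨-ξ, H.neg_mem F.mem_cartan⟩ : H) = -⟨ξ, F.mem_cartan⟩ := rfl
    rw [h, ← LieModule.Weight.toLinear_apply, map_neg, LieModule.Weight.toLinear_apply,
      F.apply_eq, Int.cast_neg]
  degree_mem β := by have := F.degree_mem β; omega
  degree_one i := by rw [F.isShortDegree.degree_neg, F.degree_one, neg_neg]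
  long i β := ((rootSystem H).posRootForm ℤ).rootLength_reflectionPerm_self (α i) ▸ F.long i β
  orthogonal i j hij := by
    simpa using F.orthogonal hij
  maximal β hβ hlong := by
    have hlong' : IsLongRoot (rootSystem H) ((rootSystem H).reflectionPerm β β) := fun γ =>
      ((rootSystem H).posRootForm ℤ).rootLength_reflectionPerm_self β ▸ hlong γ
    simpa using F.maximal _ ((F.isShortDegree.degree_neg β).trans hβ) hlong'
  triple i := by
    rw [corootElement_reflectionPerm_self]
    exact (F.triple i).symm
  e_mem := F.f_mem
  f_mem i := by
    simpa only [coe_reflectionPerm_self, neg_neg] using F.e_mem i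

theorem isLieStable_grading (k : ℂ) : IsLieStable H (lieEigenspace ξ k) :=
  .lieEigenspace F.mem_cartan k

theorem eq_zero_of_degree {k : ℂ} (h0 : k ≠ 0) (h1 : k ≠ 1) (hneg : k ≠ -1) {y : 𝔩}
    (hy : y ∈ lieEigenspace ξ k) : y = 0 := by
  suffices h : lieEigenspace ξ k ≤ ⊥ from h hy
  refine (F.isLieStable_grading k).le_of_rootVector_mem (fun β v hv hvβ => ?_) (fun v hv hvH => ?_)
  · refine eq_zero_of_mem_lieEigenspace hv (F.mem_grading hvβ rfl) ?_
    rcases F.degree_mem β with h | h | h <;> rw [h] <;> simpa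
  · exact eq_zero_of_mem_lieEigenspace hv (F.cartan_mem_grading hvH) h0

theorem lie_eq_zero_of_degree_one {x y : 𝔩} (hx : x ∈ lieEigenspace ξ (1 : ℂ))
    (hy : y ∈ lieEigenspace ξ (1 : ℂ)) : ⁅x, y⁆ = 0 :=
  F.eq_zero_of_degree (k := 2) (by norm_num) (by norm_num) (by norm_num)
    (lie_mem_lieEigenspace hx hy (by norm_num))

theorem le_of_rootVector_mem {N N' : Submodule ℂ 𝔩} (hN : IsLieStable H N)
    (hN1 : N ≤ lieEigenspace ξ 1)
    (hroot : ∀ β : H.root, d β = 1 → ∀ v ∈ N, v ∈ rootSpace H β.1 → v ∈ N') : N ≤ N' := by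
  refine hN.le_of_rootVector_mem (fun β v hv hvβ => ?_) (fun v hv hvH => ?_)
  · by_cases hβ : d β = 1
    · exact hroot β hβ v hv hvβ
    · rw [eq_zero_of_mem_lieEigenspace (hN1 hv) (F.mem_grading hvβ rfl) (mod_cast Ne.symm hβ)]
      exact N'.zero_mem
  · rw [eq_zero_of_mem_lieEigenspace (hN1 hv) (F.cartan_mem_grading hvH) one_ne_zero]
    exact N'.zero_mem

theorem sum_pairingIn_nonneg (T : Finset κ) {β : H.root} (hβ : d β = 1) :
    0 ≤ ∑ i ∈ T, (rootSystem H).pairingIn ℤ β (α i) :=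
  Finset.sum_nonneg fun i _ => F.isShortDegree.pairingIn_nonneg (F.degree_one i) hβ

theorem sum_pairingIn_le_two (T : Finset κ) {β : H.root} (hβ : d β = 1) :
    ∑ i ∈ T, (rootSystem H).pairingIn ℤ β (α i) ≤ 2 :=
  F.isShortDegree.sum_pairingIn_le_two F.degree_one F.orthogonal T hβ

theorem mem_lieEigenspace_corootSum_cases (T : Finset κ) {β : H.root} (hβ : d β = 1) {v : 𝔩}
    (hv : v ∈ rootSpace H β.1) :
    v ∈ lieEigenspace (corootSum α T) (0 : ℂ) ∨ v ∈ lieEigenspace (corootSum α T) (1 : ℂ) ∨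
      v ∈ lieEigenspace (corootSum α T) (2 : ℂ) := by
  have h := mem_lieEigenspace_corootSum (α := α) hv T
  have hmem : ∑ i ∈ T, (rootSystem H).pairingIn ℤ β (α i) = 0 ∨
      ∑ i ∈ T, (rootSystem H).pairingIn ℤ β (α i) = 1 ∨
      ∑ i ∈ T, (rootSystem H).pairingIn ℤ β (α i) = 2 := by
    have := F.sum_pairingIn_nonneg T hβ
    have := F.sum_pairingIn_le_two T hβ
    omega
  rcases hmem with hs | hs | hs <;> rw [hs] at h
  · exact .inl (mod_cast h)
  · exact .inr (.inl (mod_cast h))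
  · exact .inr (.inr (mod_cast h))

theorem le_sup_lieEigenspace_corootSum (T : Finset κ) {N : Submodule ℂ 𝔩}
    (hN : IsLieStable H N) (hN1 : N ≤ lieEigenspace ξ 1) :
    N ≤ N ⊓ lieEigenspace (corootSum α T) 0 ⊔ N ⊓ lieEigenspace (corootSum α T) 1 ⊔
      N ⊓ lieEigenspace (corootSum α T) 2 := by
  refine F.le_of_rootVector_mem hN hN1 fun β hβ v hv hvβ => ?_
  rcases F.mem_lieEigenspace_corootSum_cases T hβ hvβ with h | h | h
  · exact Submodule.mem_sup_left (Submodule.mem_sup_left ⟨hv, h⟩)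
  · exact Submodule.mem_sup_left (Submodule.mem_sup_right ⟨hv, h⟩)
  · exact Submodule.mem_sup_right ⟨hv, h⟩

theorem isLieStable_weightPart (T : Finset κ) (k : ℂ) :
    IsLieStable H (weightPart ξ α T k) :=
  (F.isLieStable_grading 1).inf (.lieEigenspace (corootSum_mem T) k)

theorem eq_zero_of_mem_weightPart (T : Finset κ) {k : ℂ} (h0 : k ≠ 0) (h1 : k ≠ 1) (h2 : k ≠ 2)
    {y : 𝔩} (hy : y ∈ weightPart ξ α T k) : y = 0 := by
  suffices h : weightPart ξ α T k ≤ ⊥ from h hy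
  refine F.le_of_rootVector_mem (F.isLieStable_weightPart T k) inf_le_left fun β hβ v hv hvβ => ?_
  rcases F.mem_lieEigenspace_corootSum_cases T hβ hvβ with h | h | h
  · exact eq_zero_of_mem_lieEigenspace hv.2 h h0
  · exact eq_zero_of_mem_lieEigenspace hv.2 h h1
  · exact eq_zero_of_mem_lieEigenspace hv.2 h h2

theorem root_ne_neg {β : H.root} (hβ : d β = 1) (i : κ) :
    (rootSystem H).root β ≠ -(rootSystem H).root (α i) := by
  intro h
  have hξ := LinearMap.congr_fun h ⟨ξ, F.mem_cartan⟩
  simp only [rootSystem_root_apply, LinearMap.neg_apply, LieModule.Weight.toLinear_apply,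
    F.apply_eq, hβ, F.degree_one] at hξ
  norm_num at hξ

theorem weightPart_two_le_span (i : κ) :
    weightPart ξ α {i} 2 ≤ Submodule.span ℂ {e i} := by
  refine F.le_of_rootVector_mem (F.isLieStable_weightPart {i} 2) inf_le_left fun β hβ v hv hvβ => ?_
  rcases eq_or_ne v 0 with rfl | hv0
  · exact Submodule.zero_mem _
  have htwo : (rootSystem H).pairingIn ℤ β (α i) = 2 := by
    by_contra hne
    rw [weightPart, corootSum_singleton] at hv
    exact hv0 (eq_zero_of_mem_lieEigenspace hv.2 (mem_lieEigenspace_corootElement hvβ _)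
      (mod_cast Ne.symm hne))
  obtain rfl : β = α i := by
    by_contra hβi
    have hmem := (F.long i).pairingIn_mem hβi (F.root_ne_neg hβ i)
    simp [htwo] at hmem
  obtain ⟨c, rfl⟩ := exists_eq_smul_of_mem_rootSpace (F.e_mem i) (F.triple i).e_ne_zero hvβ
  exact Submodule.smul_mem _ _ (Submodule.mem_span_singleton_self _)

theorem e_mem_lieEigenspace_two (i : κ) : e i ∈ lieEigenspace (corootElement H (α i)) (2 : ℂ) := by
  simpa using mem_lieEigenspace_corootElement (F.e_mem i) (α i)

theorem e_mem_lieEigenspace_zero {i j : κ} (hij : i ≠ j) :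
    e j ∈ lieEigenspace (corootElement H (α i)) (0 : ℂ) := by
  simpa [F.orthogonal hij.symm] using mem_lieEigenspace_corootElement (F.e_mem j) (α i)

theorem f_mem_lieEigenspace_neg_two (i : κ) :
    f i ∈ lieEigenspace (corootElement H (α i)) (-2 : ℂ) := by
  simpa using mem_lieEigenspace_corootElement (F.f_mem i) (α i)

theorem f_mem_lieEigenspace_zero {i j : κ} (hij : i ≠ j) :
    f j ∈ lieEigenspace (corootElement H (α i)) (0 : ℂ) := by
  simpa [F.orthogonal hij.symm] using mem_lieEigenspace_corootElement (F.f_mem j) (α i)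

theorem lie_e_f_of_ne {i j : κ} (hij : i ≠ j) : ⁅e i, f j⁆ = 0 := by
  have he_two := F.e_mem_lieEigenspace_two i
  have hf_zero := F.f_mem_lieEigenspace_zero hij
  -- `⁅e i, f j⁆` has weight two for the coroot of `α i`, but it is killed by `e i` and `f i`
  have hee : ⁅e i, ⁅e i, f j⁆⁆ = 0 := by
    refine F.eq_zero_of_mem_weightPart {i} (k := 4) (by norm_num) (by norm_num) (by norm_num)
      ⟨?_, ?_⟩
    · exact lie_mem_lieEigenspace (F.e_mem_grading i)
        (lie_mem_lieEigenspace (F.e_mem_grading i) (F.f_mem_grading j) rfl) (by norm_num)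
    · rw [corootSum_singleton]
      exact lie_mem_lieEigenspace he_two (lie_mem_lieEigenspace he_two hf_zero rfl) (by norm_num)
  have hff : ⁅f i, f j⁆ = 0 :=
    F.neg.lie_eq_zero_of_degree_one (F.neg.e_mem_grading i) (F.neg.e_mem_grading j)
  have hfe : ⁅f i, ⁅e i, f j⁆⁆ = 0 := by
    rw [leibniz_lie, hff, lie_zero, add_zero, ← lie_skew (f i) (e i), (F.triple i).lie_e_f, neg_lie,
      mem_lieEigenspace_zero.mp hf_zero, neg_zero]
  refine eq_zero_of_mem_lieEigenspace (x := corootElement H (α i)) (b := (0 : ℂ))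
    (lie_mem_lieEigenspace he_two hf_zero (add_zero 2)) ?_ two_ne_zero
  rw [mem_lieEigenspace_zero, ← (F.triple i).lie_e_f, lie_lie, hee, hfe, lie_zero, lie_zero,
    sub_zero]

theorem lie_sum_e_sum_f (T : Finset κ) : ⁅∑ i ∈ T, e i, ∑ i ∈ T, f i⁆ = corootSum α T := by
  rw [sum_lie, corootSum]
  refine Finset.sum_congr rfl fun i hi => ?_
  rw [lie_sum, Finset.sum_eq_single_of_mem i hi, (F.triple i).lie_e_f]
  exact fun j _ hj => F.lie_e_f_of_ne hj.symm

theorem e_mem_lieEigenspace_corootSum_of_notMem {T : Finset κ} {j : κ} (hj : j ∉ T) :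
    e j ∈ lieEigenspace (corootSum α T) (0 : ℂ) := by
  rw [mem_lieEigenspace_zero, corootSum, sum_lie]
  exact Finset.sum_eq_zero fun i hi =>
    mem_lieEigenspace_zero.mp (F.e_mem_lieEigenspace_zero (ne_of_mem_of_not_mem hi hj))

theorem e_mem_lieEigenspace_corootSum {T : Finset κ} {j : κ} (hj : j ∈ T) :
    e j ∈ lieEigenspace (corootSum α T) (2 : ℂ) := by
  rw [mem_lieEigenspace, corootSum, sum_lie, Finset.sum_eq_single_of_mem j hj]
  · exact mem_lieEigenspace.mp (F.e_mem_lieEigenspace_two j)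
  · exact fun i _ hi => mem_lieEigenspace_zero.mp (F.e_mem_lieEigenspace_zero hi)

theorem sum_e_mem_lieEigenspace_corootSum (T : Finset κ) :
    ∑ i ∈ T, e i ∈ lieEigenspace (corootSum α T) (2 : ℂ) :=
  sum_mem fun _ hi => F.e_mem_lieEigenspace_corootSum hi

theorem sum_f_mem_lieEigenspace_corootSum (T : Finset κ) :
    ∑ i ∈ T, f i ∈ lieEigenspace (corootSum α T) (-2 : ℂ) := by
  simpa only [corootSum_reflectionPerm, lieEigenspace_neg] using
    F.neg.sum_e_mem_lieEigenspace_corootSum T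

theorem isSl2Triple_sum {T : Finset κ} (hT : T.Nonempty) :
    IsSl2Triple (corootSum α T) (∑ i ∈ T, e i) (∑ i ∈ T, f i) where
  h_ne_zero h := by
    obtain ⟨i, hi⟩ := hT
    have he := mem_lieEigenspace.mp (F.e_mem_lieEigenspace_corootSum hi)
    rw [h, zero_lie] at he
    exact (F.triple i).e_ne_zero ((smul_eq_zero.1 he.symm).resolve_left two_ne_zero)
  lie_e_f := F.lie_sum_e_sum_f T
  lie_h_e_nsmul := by
    rw [mem_lieEigenspace.mp (F.sum_e_mem_lieEigenspace_corootSum T)]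
    norm_cast
  lie_h_f_nsmul := by
    rw [mem_lieEigenspace.mp (F.sum_f_mem_lieEigenspace_corootSum T), neg_smul]
    norm_cast

end IsFrame

section AdSq

/-- The rank of `(ad x)²`. On sums of root vectors of a frame it increases with the number of
summands, and it is lower semicontinuous, so it separates the closures of their orbits. -/
def adSqRank (x : 𝔩) : ℕ :=
  finrank ℂ (LinearMap.range (ad ℂ 𝔩 x ^ 2))

omit [FiniteDimensional ℂ 𝔩] [LieAlgebra.IsKilling ℂ 𝔩] in
theorem ad_sq_apply (x y : 𝔩) : (ad ℂ 𝔩 x ^ 2) y = ⁅x, ⁅x, y⁆⁆ := by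
  rw [pow_two, Module.End.mul_apply, ad_apply, ad_apply]

namespace IsFrame

variable (F : IsFrame H ξ d α e f)
include F

theorem lie_lie_eq_zero_of_degree_nonneg {x y : 𝔩} (hx : x ∈ lieEigenspace ξ (1 : ℂ)) {k : ℂ}
    (hk : k = 0 ∨ k = 1) (hy : y ∈ lieEigenspace ξ k) : ⁅x, ⁅x, y⁆⁆ = 0 := by
  have hxy := lie_mem_lieEigenspace hx (lie_mem_lieEigenspace hx hy rfl) rfl
  rcases hk with rfl | rfl
  all_goals exact F.eq_zero_of_degree (by norm_num) (by norm_num) (by norm_num) hxy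

theorem lie_lie_mem_weightPart_two (T : Finset κ) {β : H.root} (hβ : d β = -1) {v : 𝔩}
    (hv : v ∈ rootSpace H β.1) :
    ⁅∑ i ∈ T, e i, ⁅∑ i ∈ T, e i, v⁆⁆ ∈ weightPart ξ α T 2 := by
  have hdeg : ⁅∑ i ∈ T, e i, ⁅∑ i ∈ T, e i, v⁆⁆ ∈ lieEigenspace ξ (1 : ℂ) :=
    lie_mem_lieEigenspace (F.sum_e_mem_grading T)
      (lie_mem_lieEigenspace (F.sum_e_mem_grading T) (F.mem_grading hv hβ) rfl) (by norm_num)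
  refine ⟨hdeg, ?_⟩
  have hle := F.neg.sum_pairingIn_le_two T (β := β) (by rw [hβ, neg_neg])
  simp only [RootPairing.pairingIn_reflectionPerm_self_right, Finset.sum_neg_distrib] at hle
  have hwt := mem_lieEigenspace_corootSum (α := α) hv T
  generalize ∑ i ∈ T, (rootSystem H).pairingIn ℤ β (α i) = s at hle hwt
  have hmem : ⁅∑ i ∈ T, e i, ⁅∑ i ∈ T, e i, v⁆⁆ ∈ lieEigenspace (corootSum α T) (4 + (s : ℂ)) :=
    lie_mem_lieEigenspace (F.sum_e_mem_lieEigenspace_corootSum T)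
      (lie_mem_lieEigenspace (F.sum_e_mem_lieEigenspace_corootSum T) hwt rfl) (by ring)
  rcases eq_or_ne s (-2) with rfl | hs
  · convert hmem using 2
    norm_num
  · have h0 : 4 + s ≠ 0 := by omega
    have h1 : 4 + s ≠ 1 := by omega
    have h2 : 4 + s ≠ 2 := by omega
    rw [F.eq_zero_of_mem_weightPart T (k := 4 + (s : ℂ)) (by exact_mod_cast h0)
      (by exact_mod_cast h1) (by exact_mod_cast h2) ⟨hdeg, hmem⟩]
    exact Submodule.zero_mem _

theorem range_ad_sq_le (T : Finset κ) :
    LinearMap.range (ad ℂ 𝔩 (∑ i ∈ T, e i) ^ 2) ≤ weightPart ξ α T 2 := by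
  rw [← Submodule.map_top, Submodule.map_le_iff_le_comap]
  have hzero {k : ℂ} (hk : k = 0 ∨ k = 1) {v : 𝔩} (hv : v ∈ lieEigenspace ξ k) :
      ⁅∑ i ∈ T, e i, ⁅∑ i ∈ T, e i, v⁆⁆ ∈ weightPart ξ α T 2 := by
    rw [F.lie_lie_eq_zero_of_degree_nonneg (F.sum_e_mem_grading T) hk hv]
    exact Submodule.zero_mem _
  refine (IsLieStable.top (K := H.toSubmodule)).le_of_rootVector_mem
    (fun β v _ hv => ?_) (fun v _ hv => ?_)
  all_goals rw [Submodule.mem_comap, ad_sq_apply]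
  · rcases F.degree_mem β with h | h | h
    · exact F.lie_lie_mem_weightPart_two T h hv
    · exact hzero (.inl Int.cast_zero) (F.mem_grading hv h)
    · exact hzero (.inr Int.cast_one) (F.mem_grading hv h)
  · exact hzero (.inl rfl) (F.cartan_mem_grading hv)

theorem le_range_ad_sq (T : Finset κ) :
    weightPart ξ α T 2 ≤ LinearMap.range (ad ℂ 𝔩 (∑ i ∈ T, e i) ^ 2) := by
  rintro y ⟨hy1, hy⟩
  set x := ∑ i ∈ T, e i
  set x' := ∑ i ∈ T, f i
  have hxx' : ⁅x, x'⁆ = corootSum α T := F.lie_sum_e_sum_f T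
  have hxy : ⁅x, y⁆ = 0 := F.lie_eq_zero_of_degree_one (F.sum_e_mem_grading T) hy1
  have hlie_one : ⁅x, ⁅x', y⁆⁆ = (2 : ℂ) • y := by
    rw [leibniz_lie, hxx', hxy, lie_zero, add_zero, mem_lieEigenspace.mp hy]
  have hlie_two : ⁅x, ⁅x', ⁅x', y⁆⁆⁆ = (2 : ℂ) • ⁅x', y⁆ := by
    have hweight := lie_mem_lieEigenspace (F.sum_f_mem_lieEigenspace_corootSum T) hy
      (neg_add_cancel 2)
    rw [leibniz_lie, hxx', hlie_one, mem_lieEigenspace_zero.mp hweight, zero_add, lie_smul]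
  refine ⟨(4⁻¹ : ℂ) • ⁅x', ⁅x', y⁆⁆, ?_⟩
  rw [map_smul, ad_sq_apply, hlie_two, lie_smul, hlie_one, smul_smul, smul_smul]
  norm_num

theorem range_ad_sq (T : Finset κ) :
    LinearMap.range (ad ℂ 𝔩 (∑ i ∈ T, e i) ^ 2) = weightPart ξ α T 2 :=
  (F.range_ad_sq_le T).antisymm (F.le_range_ad_sq T)

theorem weightPart_two_mono {S T : Finset κ} (hST : S ⊆ T) :
    weightPart ξ α S 2 ≤ weightPart ξ α T 2 := by
  refine F.le_of_rootVector_mem (F.isLieStable_weightPart S 2) inf_le_left fun β hβ v hv hvβ => ?_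
  refine ⟨hv.1, ?_⟩
  rcases eq_or_ne v 0 with rfl | hv0
  · exact Submodule.zero_mem _
  have hS : ∑ i ∈ S, (rootSystem H).pairingIn ℤ β (α i) = 2 := by
    by_contra hne
    exact hv0 (eq_zero_of_mem_lieEigenspace hv.2 (mem_lieEigenspace_corootSum hvβ S)
      (mod_cast Ne.symm hne))
  have hle : ∑ i ∈ S, (rootSystem H).pairingIn ℤ β (α i) ≤
      ∑ i ∈ T, (rootSystem H).pairingIn ℤ β (α i) :=
    Finset.sum_le_sum_of_subset_of_nonneg hST
      fun i _ _ => F.isShortDegree.pairingIn_nonneg (F.degree_one i) hβ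
  have hT := (F.sum_pairingIn_le_two T hβ).antisymm (hS ▸ hle)
  have hmem := mem_lieEigenspace_corootSum (α := α) hvβ T
  rw [hT] at hmem
  exact mod_cast hmem

theorem adSqRank_lt {S T : Finset κ} (hST : S ⊂ T) :
    adSqRank (∑ i ∈ S, e i) < adSqRank (∑ i ∈ T, e i) := by
  rw [adSqRank, adSqRank, F.range_ad_sq, F.range_ad_sq]
  refine Submodule.finrank_lt_finrank_of_lt
    (SetLike.lt_iff_le_and_exists.mpr ⟨F.weightPart_two_mono hST.1, ?_⟩)
  obtain ⟨i, hiT, hiS⟩ := Finset.exists_of_ssubset hST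
  exact ⟨e i, ⟨F.e_mem_grading i, F.e_mem_lieEigenspace_corootSum hiT⟩, fun h =>
    (F.triple i).e_ne_zero (eq_zero_of_mem_lieEigenspace h.2
      (F.e_mem_lieEigenspace_corootSum_of_notMem hiS) two_ne_zero)⟩

theorem adSqRank_le_one (i : κ) : adSqRank (e i) ≤ 1 := by
  rw [adSqRank, ← Finset.sum_singleton e i, F.range_ad_sq]
  exact (Submodule.finrank_mono (F.weightPart_two_le_span i)).trans
    (finrank_span_singleton (F.triple i).e_ne_zero).le

end IsFrame

end AdSq

end Frame

/-! ### Normal forms of the elements of degree one -/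

section Action

variable {𝔩 : Type*} [LieRing 𝔩] [LieAlgebra ℂ 𝔩] {𝒢 : Type*} [Group 𝒢]

/-- `γ` is the one-parameter group `t ↦ exp (t z)` for the action `ρ`; differentiability is tested
on linear forms, so that no norm on `𝔩` is chosen. -/
structure IsExpCurve (ρ : Representation ℂ 𝒢 𝔩) (z : 𝔩) (γ : ℂ → 𝒢) : Prop where
  map_zero : γ 0 = 1
  hasDerivAt : ∀ (x : 𝔩) (φ : Dual ℂ 𝔩) (t : ℂ),
    HasDerivAt (fun t => φ (ρ (γ t) x)) (φ (ρ (γ t) ⁅z, x⁆)) t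

/-- An action of a group by automorphisms of the Lie algebra that fix `ξ`, such that the group
contains the exponentials of the elements of the centralizer of `ξ`. -/
structure IsGradedAction (ξ : 𝔩) (ρ : Representation ℂ 𝒢 𝔩) : Prop where
  map_lie : ∀ (g : 𝒢) (x y : 𝔩), ρ g ⁅x, y⁆ = ⁅ρ g x, ρ g y⁆
  map_grading : ∀ g, ρ g ξ = ξ
  exists_isExpCurve : ∀ z ∈ lieEigenspace ξ (0 : ℂ), ∃ γ, IsExpCurve ρ z γ

variable {ξ : 𝔩} {ρ : Representation ℂ 𝒢 𝔩}

namespace IsGradedAction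

variable (A : IsGradedAction ξ ρ)
include A

theorem neg : IsGradedAction (-ξ) ρ where
  map_lie := A.map_lie
  map_grading g := by rw [map_neg, A.map_grading]
  exists_isExpCurve z hz := A.exists_isExpCurve z (by simpa [lieEigenspace_neg] using hz)

theorem map_mem_lieEigenspace (g : 𝒢) {x y : 𝔩} {k : ℂ} (hy : y ∈ lieEigenspace x k) :
    ρ g y ∈ lieEigenspace (ρ g x) k := by
  rw [mem_lieEigenspace, ← A.map_lie, mem_lieEigenspace.mp hy, map_smul]

theorem map_mem_grading (g : 𝒢) {y : 𝔩} {k : ℂ} (hy : y ∈ lieEigenspace ξ k) :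
    ρ g y ∈ lieEigenspace ξ k := by
  simpa only [A.map_grading] using A.map_mem_lieEigenspace g hy

theorem range_ad_sq (g : 𝒢) (x : 𝔩) :
    LinearMap.range (ad ℂ 𝔩 (ρ g x) ^ 2) = (LinearMap.range (ad ℂ 𝔩 x ^ 2)).map (ρ g) := by
  have hcomm : (ad ℂ 𝔩 (ρ g x) ^ 2) ∘ₗ ρ g = ρ g ∘ₗ (ad ℂ 𝔩 x ^ 2) := by
    ext y
    simp only [LinearMap.comp_apply, ad_sq_apply, A.map_lie]
  rw [← LinearMap.range_comp, ← hcomm,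
    LinearMap.range_comp_of_range_eq_top _ (LinearMap.range_eq_top.mpr (ρ.apply_bijective g).2)]

theorem adSqRank_map (g : 𝒢) (x : 𝔩) : adSqRank (ρ g x) = adSqRank x := by
  rw [adSqRank, A.range_ad_sq]
  exact (Submodule.equivMapOfInjective _ (ρ.apply_bijective g).1 _).finrank_eq.symm

end IsGradedAction

theorem eq_of_forall_hasDerivAt_zero {V : Type*} [AddCommGroup V] [Module ℂ V] {u : ℂ → V}
    (hu : ∀ (φ : Dual ℂ V) (t : ℂ), HasDerivAt (fun t => φ (u t)) 0 t) (s t : ℂ) : u s = u t := by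
  rw [← sub_eq_zero, ← forall_dual_apply_eq_zero_iff ℂ]
  intro φ
  rw [map_sub, sub_eq_zero]
  exact is_const_of_deriv_eq_zero (fun t => (hu φ t).differentiableAt) (fun t => (hu φ t).deriv) s t

namespace IsExpCurve

variable {z : 𝔩} {γ : ℂ → 𝒢} (E : IsExpCurve ρ z γ)
include E

theorem map_eigenvector {x : 𝔩} {c : ℂ} (hx : x ∈ lieEigenspace z c) (t : ℂ) :
    ρ (γ t) x = Complex.exp (t * c) • x := by
  have hconst : Complex.exp (-(t * c)) • ρ (γ t) x = Complex.exp (-(0 * c)) • ρ (γ 0) x := by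
    refine eq_of_forall_hasDerivAt_zero (u := fun t => Complex.exp (-(t * c)) • ρ (γ t) x)
      (fun φ s => ?_) t 0
    have hexp : HasDerivAt (fun s : ℂ => Complex.exp (-(s * c)))
        (Complex.exp (-(s * c)) * -(1 * c)) s :=
      (((hasDerivAt_id s).mul_const c).neg).cexp
    have hmul := hexp.mul (E.hasDerivAt x φ s)
    simp only [mem_lieEigenspace.mp hx, map_smul, smul_eq_mul] at hmul ⊢
    exact hmul.congr_deriv (by ring)
  rw [E.map_zero, map_one, zero_mul, neg_zero, Complex.exp_zero, one_smul, Module.End.one_apply]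
    at hconst
  conv_rhs => rw [← hconst, smul_smul, ← Complex.exp_add, add_neg_cancel, Complex.exp_zero,
    one_smul]

theorem map_of_lie_eq_zero {x : 𝔩} (hx : ⁅z, x⁆ = 0) (t : ℂ) : ρ (γ t) x = x := by
  simpa using E.map_eigenvector (mem_lieEigenspace_zero.mpr hx) t

theorem map_inv_of_nilpotent {x : 𝔩} (hx : ⁅z, ⁅z, ⁅z, x⁆⁆⁆ = 0) (t : ℂ) :
    ρ (γ t)⁻¹ x = x - t • ⁅z, x⁆ + (t ^ 2 / 2) • ⁅z, ⁅z, x⁆⁆ := by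
  let u (t : ℂ) : 𝔩 := ρ (γ t) (x - t • ⁅z, x⁆ + (t ^ 2 / 2) • ⁅z, ⁅z, x⁆⁆)
  have hconst : u t = u 0 := by
    refine eq_of_forall_hasDerivAt_zero (fun φ s => ?_) t 0
    have h₀ := E.hasDerivAt x φ s
    have h₁ := (hasDerivAt_id s).mul (E.hasDerivAt ⁅z, x⁆ φ s)
    have h₂ := (((hasDerivAt_id s).pow 2).div_const 2).mul (E.hasDerivAt ⁅z, ⁅z, x⁆⁆ φ s)
    simp only [u, map_add, map_sub, map_smul, smul_eq_mul]
    refine ((h₀.sub h₁).add h₂).congr_deriv ?_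
    simp [hx]
  have hzero : u 0 = x := by simp [u, E.map_zero]
  exact (ρ.inv_apply_eq_iff).mpr (hconst.trans hzero).symm

theorem lie_mem_of_forall_map_mem {N : Submodule ℂ 𝔩} {y : 𝔩} (hN : ∀ t, ρ (γ t) y ∈ N) :
    ⁅z, y⁆ ∈ N := by
  rw [← Subspace.forall_mem_dualAnnihilator_apply_eq_zero_iff]
  intro φ hφ
  have hderiv := E.hasDerivAt y φ 0
  simp only [fun t => (Submodule.mem_dualAnnihilator φ).mp hφ _ (hN t), E.map_zero, map_one,
    Module.End.one_apply] at hderiv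
  exact hderiv.unique (hasDerivAt_const _ _)

end IsExpCurve

end Action

section Orbits

variable {𝔩 : Type*} [LieRing 𝔩] [LieAlgebra ℂ 𝔩] [FiniteDimensional ℂ 𝔩]
  [LieAlgebra.IsKilling ℂ 𝔩] {H : LieSubalgebra ℂ 𝔩} [H.IsCartanSubalgebra]
  {κ : Type*} {ξ : 𝔩} {d : H.root → ℤ} {α : κ → H.root} {e f : κ → 𝔩}
  {𝒢 : Type*} [Group 𝒢] {ρ : Representation ℂ 𝒢 𝔩} {S : Finset κ}

variable (ξ α) in
/-- The elements of degree `k` on which the coroots with index in `S` act trivially. For `k = 0`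
this is the Lie algebra of `corootStabilizer α ρ S`. -/
def orthogonalPart (S : Finset κ) (k : ℂ) : Submodule ℂ 𝔩 :=
  lieEigenspace ξ k ⊓ ⨅ i ∈ S, lieEigenspace (corootElement H (α i)) 0

variable (α ρ) in
/-- The elements of the group that fix the coroots with index in `S`. -/
def corootStabilizer (S : Finset κ) : Subgroup 𝒢 where
  carrier := {g | ∀ i ∈ S, ρ g (corootElement H (α i)) = corootElement H (α i)}
  mul_mem' {a b} ha hb i hi := by rw [map_mul, Module.End.mul_apply, hb i hi, ha i hi]
  one_mem' i _ := by rw [map_one, Module.End.one_apply]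
  inv_mem' {a} ha i hi := ρ.inv_apply_eq_iff.mpr (ha i hi).symm

theorem mem_orthogonalPart {k : ℂ} {y : 𝔩} : y ∈ orthogonalPart ξ α S k ↔
    y ∈ lieEigenspace ξ k ∧ ∀ i ∈ S, y ∈ lieEigenspace (corootElement H (α i)) (0 : ℂ) := by
  simp [orthogonalPart]

theorem lie_mem_orthogonalPart {a b c : ℂ} {x y : 𝔩} (hx : x ∈ orthogonalPart ξ α S a)
    (hy : y ∈ orthogonalPart ξ α S b) (h : a + b = c) : ⁅x, y⁆ ∈ orthogonalPart ξ α S c := by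
  rw [mem_orthogonalPart] at hx hy ⊢
  exact ⟨lie_mem_lieEigenspace hx.1 hy.1 h,
    fun i hi => lie_mem_lieEigenspace (hx.2 i hi) (hy.2 i hi) (add_zero 0)⟩

theorem mem_orthogonalPart_of_mem_rootSpace {β : H.root} {v : 𝔩} {k : ℂ}
    (hv : v ∈ rootSpace H β.1) (hvk : v ∈ lieEigenspace ξ k)
    (hβ : ∀ i ∈ S, (rootSystem H).pairingIn ℤ β (α i) = 0) : v ∈ orthogonalPart ξ α S k := by
  refine mem_orthogonalPart.mpr ⟨hvk, fun i hi => ?_⟩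
  simpa only [hβ i hi, Int.cast_zero] using mem_lieEigenspace_corootElement hv (α i)

theorem pairingIn_eq_zero_of_mem_orthogonalPart {β : H.root} {v : 𝔩} {k : ℂ}
    (hv : v ∈ rootSpace H β.1) (hv0 : v ≠ 0) (hvS : v ∈ orthogonalPart ξ α S k) {i : κ}
    (hi : i ∈ S) : (rootSystem H).pairingIn ℤ β (α i) = 0 := by
  by_contra hne
  exact hv0 (eq_zero_of_mem_lieEigenspace ((mem_orthogonalPart.mp hvS).2 i hi)
    (mem_lieEigenspace_corootElement hv _) (mod_cast Ne.symm hne))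

theorem orthogonalPart_insert [DecidableEq κ] (j : κ) (k : ℂ) :
    orthogonalPart ξ α (insert j S) k =
      orthogonalPart ξ α S k ⊓ lieEigenspace (corootElement H (α j)) 0 := by
  rw [orthogonalPart, orthogonalPart, Finset.iInf_insert, inf_assoc,
    inf_comm (lieEigenspace (corootElement H (α j)) 0)]

theorem corootStabilizer_anti {S' : Finset κ} (h : S ⊆ S') :
    corootStabilizer α ρ S' ≤ corootStabilizer α ρ S :=
  fun _ hg i hi => hg i (h hi)

theorem mem_corootStabilizer_of_fixes_cartan {g : 𝒢} (hg : ∀ h ∈ H, ρ g h = h) :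
    g ∈ corootStabilizer α ρ S :=
  fun _ _ => hg _ (corootElement_mem _)

theorem IsExpCurve.mem_corootStabilizer {z : 𝔩} {γ : ℂ → 𝒢} (E : IsExpCurve ρ z γ)
    (hz : z ∈ orthogonalPart ξ α S 0) (t : ℂ) : γ t ∈ corootStabilizer α ρ S := fun i hi =>
  E.map_of_lie_eq_zero (by
    rw [← lie_skew, mem_lieEigenspace_zero.mp ((mem_orthogonalPart.mp hz).2 i hi), neg_zero]) t

/-- The span of the orbit of `y` under the stabilizer of the coroots with index in `S`. -/
def orbitSpan (α : κ → H.root) (ρ : Representation ℂ 𝒢 𝔩) (S : Finset κ) (y : 𝔩) :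
    Submodule ℂ 𝔩 :=
  Submodule.span ℂ ((fun g => ρ g y) '' corootStabilizer α ρ S)

theorem map_mem_orbitSpan {g : 𝒢} (hg : g ∈ corootStabilizer α ρ S) (y : 𝔩) :
    ρ g y ∈ orbitSpan α ρ S y :=
  Submodule.subset_span ⟨g, hg, rfl⟩

theorem mem_orbitSpan_self (y : 𝔩) : y ∈ orbitSpan α ρ S y := by
  simpa using map_mem_orbitSpan (one_mem (corootStabilizer α ρ S)) y

theorem orbitSpan_le_comap {g : 𝒢} (hg : g ∈ corootStabilizer α ρ S) (y : 𝔩) :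
    orbitSpan α ρ S y ≤ (orbitSpan α ρ S y).comap (ρ g) := by
  refine Submodule.span_le.mpr ?_
  rintro _ ⟨g', hg', rfl⟩
  simpa using map_mem_orbitSpan (mul_mem hg hg') y

namespace IsGradedAction

variable (A : IsGradedAction ξ ρ)
include A

theorem map_mem_orthogonalPart {g : 𝒢} (hg : g ∈ corootStabilizer α ρ S) {k : ℂ} {y : 𝔩}
    (hy : y ∈ orthogonalPart ξ α S k) : ρ g y ∈ orthogonalPart ξ α S k := by
  rw [mem_orthogonalPart] at hy ⊢
  exact ⟨A.map_mem_grading g hy.1,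
    fun i hi => by simpa only [hg i hi] using A.map_mem_lieEigenspace g (hy.2 i hi)⟩

theorem orbitSpan_le_orthogonalPart {k : ℂ} {y : 𝔩} (hy : y ∈ orthogonalPart ξ α S k) :
    orbitSpan α ρ S y ≤ orthogonalPart ξ α S k := by
  rw [orbitSpan, Submodule.span_le]
  rintro _ ⟨g, hg, rfl⟩
  exact A.map_mem_orthogonalPart hg hy

theorem isLieStable_orbitSpan (y : 𝔩) :
    IsLieStable (orthogonalPart ξ α S 0) (orbitSpan α ρ S y) := by
  intro z hz x hx
  obtain ⟨γ, E⟩ := A.exists_isExpCurve z (mem_orthogonalPart.mp hz).1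
  exact E.lie_mem_of_forall_map_mem fun t =>
    orbitSpan_le_comap (E.mem_corootStabilizer hz t) y hx

end IsGradedAction

namespace IsFrame

variable (F : IsFrame H ξ d α e f)
include F

theorem cartan_le_orthogonalPart : H.toSubmodule ≤ orthogonalPart ξ α S 0 := fun _ hh =>
  mem_orthogonalPart.mpr ⟨F.cartan_mem_grading hh, fun _ _ =>
    mem_lieEigenspace_zero.mpr (lie_cartan_eq_zero (corootElement_mem _) hh)⟩

theorem e_mem_orthogonalPart {i : κ} (hi : i ∉ S) : e i ∈ orthogonalPart ξ α S 1 :=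
  mem_orthogonalPart.mpr ⟨F.e_mem_grading i,
    fun _ hk => F.e_mem_lieEigenspace_zero (ne_of_mem_of_not_mem hk hi)⟩

theorem f_mem_orthogonalPart {i : κ} (hi : i ∉ S) : f i ∈ orthogonalPart ξ α S (-1) :=
  mem_orthogonalPart.mpr ⟨F.f_mem_grading i,
    fun _ hk => F.f_mem_lieEigenspace_zero (ne_of_mem_of_not_mem hk hi)⟩

theorem mem_of_pairingIn_ne_zero {N : Submodule ℂ 𝔩} (hN : IsLieStable (orthogonalPart ξ α S 0) N)
    (hNS : N ≤ orthogonalPart ξ α S 1) {β δ : H.root} {v w : 𝔩} (hv : v ∈ rootSpace H β.1)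
    (hv0 : v ≠ 0) (hvN : v ∈ N) (hδβ : (rootSystem H).pairingIn ℤ δ β ≠ 0)
    (hw : w ∈ rootSpace H δ.1) (hwS : w ∈ orthogonalPart ξ α S 1) : w ∈ N := by
  obtain ⟨f', hf', hvf'⟩ := exists_lie_eq_corootElement hv hv0
  have hβ : d β = 1 := by
    by_contra hne
    exact hv0 (eq_zero_of_mem_lieEigenspace (mem_orthogonalPart.mp (hNS hvN)).1
      (F.mem_grading hv rfl) (mod_cast Ne.symm hne))
  have hf'S : f' ∈ orthogonalPart ξ α S (-1) := by
    refine mem_orthogonalPart_of_mem_rootSpace hf' ?_ fun i hi => ?_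
    · simpa using F.mem_grading hf' (k := -1) (by rw [F.isShortDegree.degree_neg, hβ])
    · rw [RootPairing.pairingIn_reflectionPerm_self_left,
        pairingIn_eq_zero_of_mem_orthogonalPart hv hv0 (hNS hvN) hi, neg_zero]
  have hwv : ⁅w, v⁆ = 0 := F.lie_eq_zero_of_degree_one (mem_orthogonalPart.mp hwS).1
    (mem_orthogonalPart.mp (hNS hvN)).1
  have hmem : ((rootSystem H).pairingIn ℤ δ β : ℂ) • w ∈ N :=
    lie_lie_eq_pairingIn_smul hvf' hw hwv ▸
      hN _ (lie_mem_orthogonalPart hwS hf'S (add_neg_cancel 1)) _ hvN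
  exact (N.smul_mem_iff (mod_cast hδβ)).mp hmem

/-- A root of `N` can be replaced by a long root that is not orthogonal to it; by maximality of the
frame this long root is in turn not orthogonal to some `α j`. -/
theorem exists_e_mem [(rootSystem H).IsIrreducible] {N : Submodule ℂ 𝔩}
    (hN : IsLieStable (orthogonalPart ξ α S 0) N) (hNS : N ≤ orthogonalPart ξ α S 1)
    (hN0 : N ≠ ⊥) : ∃ j ∉ S, e j ∈ N := by
  by_contra! hcon
  refine hN0 (le_bot_iff.mp (F.le_of_rootVector_mem (hN.mono_left F.cartan_le_orthogonalPart)
    (hNS.trans inf_le_left) fun β hβ v hvN hv => ?_))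
  by_contra hv0
  obtain ⟨δ, hδlong, hδ, hδβ, hδS⟩ := F.isShortDegree.exists_isLongRoot hβ
  have hδS' (i : κ) (hi : i ∈ S) : (rootSystem H).pairingIn ℤ δ (α i) = 0 :=
    hδS _ (F.degree_one i) (pairingIn_eq_zero_of_mem_orthogonalPart hv hv0 (hNS hvN) hi)
  obtain ⟨w, hw, hw0⟩ := δ.1.exists_ne_zero
  have hwN : w ∈ N := F.mem_of_pairingIn_ne_zero hN hNS hv hv0 hvN hδβ hw
    (mem_orthogonalPart_of_mem_rootSpace hw (by simpa using F.mem_grading hw hδ) hδS')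
  obtain ⟨j, hj⟩ := F.maximal δ hδ hδlong
  have hjS : j ∉ S := fun h => hj (pairingIn_eq_zero_comm.mp (hδS' j h))
  exact hcon j hjS (F.mem_of_pairingIn_ne_zero hN hNS hw hw0 hwN hj (F.e_mem j)
    (F.e_mem_orthogonalPart hjS))

theorem lie_lie_f_e {y : 𝔩} {k : ℂ} {j : κ} (hy : y ∈ lieEigenspace ξ (1 : ℂ))
    (hyj : y ∈ lieEigenspace (corootElement H (α j)) k) : ⁅⁅f j, y⁆, e j⁆ = -(k • y) := by
  rw [lie_lie, F.lie_eq_zero_of_degree_one hy (F.e_mem_grading j), lie_zero, zero_sub,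
    ← lie_skew (f j) (e j), (F.triple j).lie_e_f, lie_neg, lie_skew, mem_lieEigenspace.mp hyj]

theorem lie_eq_zero_of_weight_neg_one {w z : 𝔩} {j : κ} (hz : z ∈ lieEigenspace ξ (0 : ℂ))
    (hzj : z ∈ lieEigenspace (corootElement H (α j)) (-1 : ℂ)) (hw : w ∈ lieEigenspace ξ (1 : ℂ))
    (hwj : w ∈ lieEigenspace (corootElement H (α j)) (0 : ℂ)) : ⁅z, w⁆ = 0 := by
  refine F.eq_zero_of_mem_weightPart {j} (k := -1) (by norm_num) (by norm_num) (by norm_num)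
    ⟨lie_mem_lieEigenspace hz hw (zero_add 1), ?_⟩
  rw [corootSum_singleton]
  exact lie_mem_lieEigenspace hzj hwj (add_zero _)

theorem e_notMem_sup_lieEigenspace (j : κ) :
    e j ∉ lieEigenspace (corootElement H (α j)) (0 : ℂ) ⊔
      lieEigenspace (corootElement H (α j)) 1 := by
  intro hmem
  obtain ⟨a, ha, b, hb, hab⟩ := Submodule.mem_sup.mp hmem
  have hb2 : b = (2 : ℂ) • e j := by
    rw [← mem_lieEigenspace.mp (F.e_mem_lieEigenspace_two j), ← hab, lie_add,
      mem_lieEigenspace_zero.mp ha, zero_add, mem_lieEigenspace.mp hb, one_smul]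
  have hb0 : b = 0 := eq_zero_of_mem_lieEigenspace hb
    (hb2 ▸ Submodule.smul_mem _ 2 (F.e_mem_lieEigenspace_two j)) (by norm_num)
  exact (F.triple j).e_ne_zero ((smul_eq_zero.mp (hb2.symm.trans hb0)).resolve_left two_ne_zero)

theorem exists_map_e (A : IsGradedAction ξ ρ) {g : 𝒢} (hg : g ∈ corootStabilizer α ρ S) {i : κ}
    (hi : i ∈ S) : ∃ c : ℂ, c ≠ 0 ∧ ρ g (e i) = c • e i := by
  have hmem : ρ g (e i) ∈ weightPart ξ α {i} 2 := by
    refine ⟨A.map_mem_grading g (F.e_mem_grading i), ?_⟩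
    simpa only [corootSum_singleton, hg i hi, SetLike.mem_coe] using
      A.map_mem_lieEigenspace g (F.e_mem_lieEigenspace_two i)
  obtain ⟨c, hc⟩ := Submodule.mem_span_singleton.mp (F.weightPart_two_le_span i hmem)
  refine ⟨c, fun h0 => (F.triple i).e_ne_zero ((ρ.apply_bijective g).1 ?_), hc.symm⟩
  rw [← hc, h0, zero_smul, map_zero]

section Scaling

variable [Finite κ] (A : IsGradedAction ξ ρ)
include A

theorem exists_scaling (c : κ → ℂ) (hc : ∀ i, c i ≠ 0) :
    ∃ g : 𝒢, (∀ h ∈ H, ρ g h = h) ∧ (∀ i, ρ g (e i) = c i • e i) ∧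
      ∀ i, ρ g (f i) = (c i)⁻¹ • f i := by
  cases nonempty_fintype κ
  let z : 𝔩 := ∑ i, (Complex.log (c i) / 2) • corootElement H (α i)
  have hzH : z ∈ H := sum_mem fun i _ => H.smul_mem _ (corootElement_mem _)
  obtain ⟨γ, E⟩ := A.exists_isExpCurve z (F.cartan_mem_grading hzH)
  refine ⟨γ 1, fun h hh => E.map_of_lie_eq_zero (lie_cartan_eq_zero hzH hh) 1, fun i => ?_,
    fun i => ?_⟩
  · rw [E.map_eigenvector (mem_lieEigenspace_sum_smul _ (F.e_mem_lieEigenspace_two i)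
      fun j hji => F.e_mem_lieEigenspace_zero hji), one_mul, div_mul_cancel₀ _ two_ne_zero,
      Complex.exp_log (hc i)]
  · rw [E.map_eigenvector (mem_lieEigenspace_sum_smul _ (F.f_mem_lieEigenspace_neg_two i)
      fun j hji => F.f_mem_lieEigenspace_zero hji), one_mul, mul_neg,
      div_mul_cancel₀ _ two_ne_zero, Complex.exp_neg, Complex.exp_log (hc i)]

theorem exists_map_sum_smul {T : Finset κ} {b : κ → ℂ} (hb : ∀ i ∈ T, b i ≠ 0) :
    ∃ g : 𝒢, (∀ h ∈ H, ρ g h = h) ∧ ρ g (∑ i ∈ T, b i • e i) = ∑ i ∈ T, e i := by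
  classical
  obtain ⟨g, hgH, hg, -⟩ := F.exists_scaling A (fun i => if i ∈ T then (b i)⁻¹ else 1)
    fun i => by split_ifs with hi <;> simp [hb, hi]
  refine ⟨g, hgH, ?_⟩
  rw [map_sum]
  refine Finset.sum_congr rfl fun i hi => ?_
  rw [map_smul, hg, if_pos hi, smul_smul, mul_inv_cancel₀ (hb i hi), one_smul]

theorem exists_map_smul_add_sum_smul [DecidableEq κ] {T : Finset κ} {j : κ} (hj : j ∉ T)
    {c : ℂ} (hc : c ≠ 0) {b : κ → ℂ} (hb : ∀ i ∈ T, b i ≠ 0) :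
    ∃ g : 𝒢, (∀ h ∈ H, ρ g h = h) ∧
      ρ g (c • e j + ∑ i ∈ T, b i • e i) = ∑ i ∈ insert j T, e i := by
  have hne {i : κ} (hi : i ∈ T) : i ≠ j := ne_of_mem_of_not_mem hi hj
  obtain ⟨g, hgH, hg⟩ := F.exists_map_sum_smul A (T := insert j T) (b := Function.update b j c)
    (by simp +contextual [hc, hb, hne])
  refine ⟨g, hgH, ?_⟩
  rw [← hg, Finset.sum_insert hj, Function.update_self]
  exact congrArg (fun s => ρ g (c • e j + s))
    (Finset.sum_congr rfl fun i hi => by rw [Function.update_of_ne (hne hi)])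

end Scaling

section Classification

variable (A : IsGradedAction ξ ρ)
include A

/-- The component `y₁` is removed by the exponential of `c⁻¹ [f j, y₁]`. -/
theorem exists_map_add_eq_smul_add [DecidableEq κ] {j : κ} (hj : j ∉ S) {y₀ y₁ : 𝔩} {c : ℂ}
    (hc : c ≠ 0)
    (h₀ : y₀ ∈ orthogonalPart ξ α S 1 ⊓ lieEigenspace (corootElement H (α j)) 0)
    (h₁ : y₁ ∈ orthogonalPart ξ α S 1 ⊓ lieEigenspace (corootElement H (α j)) 1) :
    ∃ g ∈ corootStabilizer α ρ S, ∃ y' ∈ orthogonalPart ξ α (insert j S) 1,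
      ρ g (y₀ + y₁ + c • e j) = c • e j + y' := by
  let z : 𝔩 := c⁻¹ • ⁅f j, y₁⁆
  have hz : z ∈ orthogonalPart ξ α S 0 :=
    Submodule.smul_mem _ _ (lie_mem_orthogonalPart (F.f_mem_orthogonalPart hj) h₁.1 (by norm_num))
  have hzj : z ∈ lieEigenspace (corootElement H (α j)) (-1 : ℂ) := Submodule.smul_mem _ _
    (lie_mem_lieEigenspace (F.f_mem_lieEigenspace_neg_two j) h₁.2 (by norm_num))
  have hz_kill {w : 𝔩} (hw : w ∈ orthogonalPart ξ α S 1)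
      (hwj : w ∈ lieEigenspace (corootElement H (α j)) (0 : ℂ)) : ⁅z, w⁆ = 0 :=
    F.lie_eq_zero_of_weight_neg_one hz.1 hzj hw.1 hwj
  have hzy₁ : ⁅z, y₁⁆ ∈ orthogonalPart ξ α S 1 ⊓ lieEigenspace (corootElement H (α j)) 0 :=
    ⟨lie_mem_orthogonalPart hz h₁.1 (zero_add 1), lie_mem_lieEigenspace hzj h₁.2 (by norm_num)⟩
  have hze : ⁅z, c • e j⁆ = -y₁ := by
    rw [smul_lie, lie_smul, smul_smul, inv_mul_cancel₀ hc, one_smul, F.lie_lie_f_e h₁.1.1 h₁.2,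
      one_smul]
  have hz₁ : ⁅z, y₀ + y₁ + c • e j⁆ = ⁅z, y₁⁆ - y₁ := by
    rw [lie_add, lie_add, hz_kill h₀.1 h₀.2, zero_add, hze, sub_eq_add_neg]
  have hz₂ : ⁅z, ⁅z, y₀ + y₁ + c • e j⁆⁆ = -⁅z, y₁⁆ := by
    rw [hz₁, lie_sub, hz_kill hzy₁.1 hzy₁.2, zero_sub]
  have hz₃ : ⁅z, ⁅z, ⁅z, y₀ + y₁ + c • e j⁆⁆⁆ = 0 := by
    rw [hz₂, lie_neg, hz_kill hzy₁.1 hzy₁.2, neg_zero]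
  obtain ⟨γ, E⟩ := A.exists_isExpCurve z hz.1
  refine ⟨(γ (-1))⁻¹, inv_mem (E.mem_corootStabilizer hz _), y₀ + (2⁻¹ : ℂ) • ⁅z, y₁⁆, ?_, ?_⟩
  · rw [orthogonalPart_insert]
    exact Submodule.add_mem _ h₀ (Submodule.smul_mem _ _ hzy₁)
  · rw [E.map_inv_of_nilpotent hz₃, hz₂, hz₁]
    module

theorem exists_map_eq_smul_add [DecidableEq κ] {y : 𝔩} (hy : y ∈ orthogonalPart ξ α S 1) {j : κ}
    (hj : j ∉ S) (hjy : e j ∈ orbitSpan α ρ S y) :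
    ∃ g ∈ corootStabilizer α ρ S, ∃ c : ℂ, c ≠ 0 ∧ ∃ y' ∈ orthogonalPart ξ α (insert j S) 1,
      ρ g y = c • e j + y' := by
  obtain ⟨g, hg, hgy⟩ : ∃ g ∈ corootStabilizer α ρ S, ρ g y ∉
      lieEigenspace (corootElement H (α j)) (0 : ℂ) ⊔
        lieEigenspace (corootElement H (α j)) 1 := by
    by_contra! hcon
    refine F.e_notMem_sup_lieEigenspace j (Submodule.span_le.mpr ?_ hjy)
    rintro _ ⟨g, hg, rfl⟩
    exact hcon g hg
  have hN : IsLieStable H (orbitSpan α ρ S y) :=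
    (A.isLieStable_orbitSpan y).mono_left F.cartan_le_orthogonalPart
  have hNS := A.orbitSpan_le_orthogonalPart hy
  have hdec := F.le_sup_lieEigenspace_corootSum {j} hN (hNS.trans inf_le_left)
    (map_mem_orbitSpan hg y)
  simp only [corootSum_singleton, Submodule.mem_sup] at hdec
  obtain ⟨_, ⟨y₀, h₀, y₁, h₁, rfl⟩, y₂, h₂, hsum⟩ := hdec
  obtain ⟨c, rfl⟩ := Submodule.mem_span_singleton.mp (F.weightPart_two_le_span j
    ⟨(hNS h₂.1).1, by simpa only [corootSum_singleton] using h₂.2⟩)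
  have hc : c ≠ 0 := by
    rintro rfl
    rw [zero_smul, add_zero] at hsum
    exact hgy (hsum ▸ Submodule.add_mem_sup h₀.2 h₁.2)
  obtain ⟨g', hg', y', hy', hgy'⟩ :=
    F.exists_map_add_eq_smul_add A hj hc ⟨hNS h₀.1, h₀.2⟩ ⟨hNS h₁.1, h₁.2⟩
  exact ⟨g' * g, mul_mem hg' hg, c, hc, y', hy',
    by rw [map_mul, Module.End.mul_apply, ← hsum, hgy']⟩

theorem exists_map_smul_add_eq_sum [Finite κ] [DecidableEq κ] {j : κ} {T : Finset κ}
    (hT : Disjoint T (insert j S)) {c : ℂ} (hc : c ≠ 0) {g : 𝒢}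
    (hg : g ∈ corootStabilizer α ρ (insert j S)) {y : 𝔩}
    (hgy : ρ g y = ∑ i ∈ T, e i) :
    ∃ g ∈ corootStabilizer α ρ S, ρ g (c • e j + y) = ∑ i ∈ insert j T, e i := by
  obtain ⟨c', hc', hge⟩ := F.exists_map_e A hg (Finset.mem_insert_self j S)
  obtain ⟨g', hg', hgs⟩ := F.exists_map_smul_add_sum_smul A (b := 1)
    (Finset.disjoint_insert_right.mp hT).1 (mul_ne_zero hc hc') fun _ _ => one_ne_zero
  simp only [Pi.one_apply, one_smul] at hgs
  refine ⟨g' * g, mul_mem (mem_corootStabilizer_of_fixes_cartan hg')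
    (corootStabilizer_anti (Finset.subset_insert j S) hg), ?_⟩
  rw [map_mul, Module.End.mul_apply, map_add, map_smul, hge, smul_smul, hgy, hgs]

variable [(rootSystem H).IsIrreducible]

theorem exists_map_eq_sum [Finite κ] (S : Finset κ) {y : 𝔩} (hy : y ∈ orthogonalPart ξ α S 1) :
    ∃ g ∈ corootStabilizer α ρ S, ∃ T, Disjoint T S ∧ ρ g y = ∑ i ∈ T, e i := by
  classical
  cases nonempty_fintype κ
  induction hn : Sᶜ.card using Nat.strong_induction_on generalizing S y with
  | h n ih =>
  rcases eq_or_ne y 0 with rfl | hy0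
  · exact ⟨1, one_mem _, ∅, Finset.disjoint_empty_left S, by rw [map_zero, Finset.sum_empty]⟩
  obtain ⟨j, hj, hjy⟩ := F.exists_e_mem (A.isLieStable_orbitSpan y)
    (A.orbitSpan_le_orthogonalPart hy)
    (Submodule.ne_bot_iff _ |>.mpr ⟨y, mem_orbitSpan_self y, hy0⟩)
  obtain ⟨g, hg, c, hc, y', hy', hgy⟩ := F.exists_map_eq_smul_add A hy hj hjy
  have hcard : (insert j S)ᶜ.card < n :=
    hn ▸ Finset.card_lt_card (Finset.compl_ssubset_compl.mpr (Finset.ssubset_insert hj))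
  obtain ⟨g', hg', T, hT, hgT⟩ := ih _ hcard _ hy' rfl
  obtain ⟨g'', hg'', hgs⟩ := F.exists_map_smul_add_eq_sum A hT hc hg' hgT
  refine ⟨g'' * g, mul_mem hg'' hg, insert j T, ?_, ?_⟩
  · exact Finset.disjoint_insert_left.mpr ⟨hj, (Finset.disjoint_insert_right.mp hT).2⟩
  · rw [map_mul, Module.End.mul_apply, hgy, hgs]

omit A [(rootSystem H).IsIrreducible] in
theorem pairingIn_eq_zero_of_linked {i j k : κ} (hij : i ≠ j) (hki : k ≠ i) (hkj : k ≠ j)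
    {δ : H.root} (hδ : d δ = 1) (hδi : (rootSystem H).pairingIn ℤ δ (α i) ≠ 0)
    (hδj : (rootSystem H).pairingIn ℤ δ (α j) ≠ 0) :
    (rootSystem H).pairingIn ℤ δ (α k) = 0 := by
  classical
  have hsum := F.sum_pairingIn_le_two {i, j, k} hδ
  rw [Finset.sum_insert (by simp [hij, hki.symm]), Finset.sum_insert (by simp [hkj.symm]),
    Finset.sum_singleton] at hsum
  have hi0 := F.isShortDegree.pairingIn_nonneg (F.degree_one i) hδ
  have hj0 := F.isShortDegree.pairingIn_nonneg (F.degree_one j) hδ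
  have hk0 := F.isShortDegree.pairingIn_nonneg (F.degree_one k) hδ
  lia

theorem e_mem_orbitSpan {i j : κ} (hi : i ∉ S) (hj : j ∉ S) (hij : i ≠ j) :
    e j ∈ orbitSpan α ρ S (e i) := by
  have hN := A.isLieStable_orbitSpan (α := α) (S := S) (e i)
  have hNS := A.orbitSpan_le_orthogonalPart (F.e_mem_orthogonalPart hi)
  obtain ⟨δ, hδ, hδi, hδj⟩ := F.isShortDegree.exists_degree_one (F.degree_one i) (α j)
  obtain ⟨w, hw, hw0⟩ := δ.1.exists_ne_zero
  have hwS : w ∈ orthogonalPart ξ α S 1 :=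
    mem_orthogonalPart_of_mem_rootSpace hw (by simpa using F.mem_grading hw hδ) fun k hk =>
      F.pairingIn_eq_zero_of_linked hij (ne_of_mem_of_not_mem hk hi) (ne_of_mem_of_not_mem hk hj)
        hδ hδi hδj
  have hwN := F.mem_of_pairingIn_ne_zero hN hNS (F.e_mem i) (F.triple i).e_ne_zero
    (mem_orbitSpan_self _) hδi hw hwS
  exact F.mem_of_pairingIn_ne_zero hN hNS hw hw0 hwN (mt pairingIn_eq_zero_comm.mp hδj) (F.e_mem j)
    (F.e_mem_orthogonalPart hj)

theorem exists_map_e_eq [Finite κ] {i j : κ} (hi : i ∉ S) (hj : j ∉ S) (hij : i ≠ j) :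
    ∃ g ∈ corootStabilizer α ρ S, ρ g (e i) = e j := by
  classical
  obtain ⟨g, hg, c, hc, y', hy', hgy⟩ :=
    F.exists_map_eq_smul_add A (F.e_mem_orthogonalPart hi) hj (F.e_mem_orbitSpan A hi hj hij)
  obtain ⟨g', hg', T, hT, hgT⟩ := F.exists_map_eq_sum A (insert j S) hy'
  obtain ⟨g'', hg'', hgs⟩ := F.exists_map_smul_add_eq_sum A hT hc hg' hgT
  have hmap : ρ (g'' * g) (e i) = ∑ i ∈ insert j T, e i := by
    rw [map_mul, Module.End.mul_apply, hgy, hgs]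
  have hrank : adSqRank (∑ i ∈ insert j T, e i) ≤ 1 := by
    rw [← hmap, A.adSqRank_map]
    exact F.adSqRank_le_one i
  have hTe : T = ∅ := by
    by_contra hne
    have hss : {j} ⊂ insert j T := by
      obtain ⟨k, hk⟩ := Finset.nonempty_iff_ne_empty.mpr hne
      refine (Finset.ssubset_iff_of_subset (by simp)).mpr ⟨k, Finset.mem_insert_of_mem hk, ?_⟩
      exact mt Finset.mem_singleton.mp
        (ne_of_mem_of_not_mem hk (Finset.disjoint_insert_right.mp hT).1)
    have h₁ := F.adSqRank_lt hss
    have h₂ := F.adSqRank_lt (Finset.empty_ssubset.mpr (Finset.singleton_nonempty j))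
    lia
  exact ⟨g'' * g, mul_mem hg'' hg, by simpa [hTe] using hmap⟩

theorem exists_map_sum_insert [Finite κ] [DecidableEq κ] {i j : κ} (hi : i ∉ S) (hj : j ∉ S)
    (hij : i ≠ j) :
    ∃ g, ρ g (∑ k ∈ insert i S, e k) = ∑ k ∈ insert j S, e k := by
  obtain ⟨g, hg, hgij⟩ := F.exists_map_e_eq A hi hj hij
  choose! b hb hbe using fun k (hk : k ∈ S) => F.exists_map_e A hg hk
  obtain ⟨g', -, hg'⟩ := F.exists_map_smul_add_sum_smul A hj one_ne_zero hb
  refine ⟨g' * g, ?_⟩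
  rw [map_mul, Module.End.mul_apply, Finset.sum_insert hi, map_add, hgij, map_sum,
    Finset.sum_congr rfl hbe, ← hg', one_smul]

theorem exists_map_sum_eq [Finite κ] {S T : Finset κ} (h : S.card = T.card) :
    ∃ g, ρ g (∑ i ∈ S, e i) = ∑ i ∈ T, e i := by
  classical
  induction hn : (S \ T).card generalizing S with
  | zero =>
    have hST : S ⊆ T := by rwa [Finset.card_eq_zero, Finset.sdiff_eq_empty_iff_subset] at hn
    rw [Finset.eq_of_subset_of_card_le hST h.ge]
    exact ⟨1, by rw [map_one, Module.End.one_apply]⟩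
  | succ n ih =>
    obtain ⟨i, hi⟩ : (S \ T).Nonempty := by rw [← Finset.card_pos]; lia
    obtain ⟨j, hj⟩ : (T \ S).Nonempty := by
      rw [← Finset.card_pos, ← Finset.card_sdiff_comm h]; lia
    rw [Finset.mem_sdiff] at hi hj
    have hjS : j ∉ S.erase i := fun hmem => hj.2 (Finset.mem_of_mem_erase hmem)
    have hcard : (insert j (S.erase i)).card = T.card := by
      rw [Finset.card_insert_of_notMem hjS, Finset.card_erase_add_one hi.1, h]
    have hsdiff : (insert j (S.erase i) \ T).card = n := by
      rw [Finset.insert_sdiff_of_mem _ hj.1, Finset.erase_sdiff_comm,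
        Finset.card_erase_of_mem (Finset.mem_sdiff.mpr hi), hn, Nat.add_sub_cancel]
    obtain ⟨g, hg⟩ := F.exists_map_sum_insert A (Finset.notMem_erase i S) hjS
      (ne_of_mem_of_not_mem hi.1 hj.2)
    rw [Finset.insert_erase hi.1] at hg
    obtain ⟨g', hg'⟩ := ih hcard hsdiff
    exact ⟨g' * g, by rw [map_mul, Module.End.mul_apply, hg, hg']⟩

end Classification

end IsFrame

end Orbits

/-! ### Zariski closures and rank conditions -/

section Zariski

variable {V W : Type*} [AddCommGroup V] [Module ℂ V] [AddCommGroup W] [Module ℂ W]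

theorem vanishing_zariskiClosure (S : Set V) : vanishing (zariskiClosure S) = vanishing S :=
  Set.Subset.antisymm (fun _ hp s hs => hp s (subset_zariskiClosure S hs)) fun _ hp _ hv => hv _ hp

theorem zariskiClosure_subset_of_subset {S T : Set V} (h : S ⊆ zariskiClosure T) :
    zariskiClosure S ⊆ zariskiClosure T := by
  intro v hv p hp
  rw [← vanishing_zariskiClosure] at hp
  exact hv p fun s hs => hp s (h hs)

theorem polyEval_C (c : ℂ) (v : V) : polyEval (MvPolynomial.C c) v = c :=
  MvPolynomial.eval_C c

theorem polyEval_X (φ : Dual ℂ V) (v : V) : polyEval (MvPolynomial.X φ) v = φ v :=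
  MvPolynomial.eval_X φ

theorem polyEval_add (p q : MvPolynomial (Dual ℂ V) ℂ) (v : V) :
    polyEval (p + q) v = polyEval p v + polyEval q v :=
  map_add _ p q

theorem polyEval_mul (p q : MvPolynomial (Dual ℂ V) ℂ) (v : V) :
    polyEval (p * q) v = polyEval p v * polyEval q v :=
  map_mul _ p q

/-- The composition of a polynomial function with a linear map. -/
def polyComp (f : V →ₗ[ℂ] W) (p : MvPolynomial (Dual ℂ W) ℂ) : MvPolynomial (Dual ℂ V) ℂ :=
  MvPolynomial.rename (fun φ : Dual ℂ W => φ ∘ₗ f) p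

theorem polyEval_polyComp (f : V →ₗ[ℂ] W) (p : MvPolynomial (Dual ℂ W) ℂ) (v : V) :
    polyEval (polyComp f p) v = polyEval p (f v) :=
  MvPolynomial.eval_rename _ _ p

theorem map_mem_zariskiClosure (f : V →ₗ[ℂ] W) {S : Set V} {T : Set W} (h : Set.MapsTo f S T)
    {v : V} (hv : v ∈ zariskiClosure S) : f v ∈ zariskiClosure T := by
  intro p hp
  rw [← polyEval_polyComp]
  exact hv _ fun s hs => by rw [polyEval_polyComp]; exact hp _ (h hs)

/-- Functions given by a polynomial in the linear forms. -/
def IsPolyFun (q : V → ℂ) : Prop := ∃ p : MvPolynomial (Dual ℂ V) ℂ, polyEval p = q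

namespace IsPolyFun

theorem const (c : ℂ) : IsPolyFun fun _ : V => c :=
  ⟨MvPolynomial.C c, funext (polyEval_C c)⟩

theorem linear (φ : Dual ℂ V) : IsPolyFun φ :=
  ⟨MvPolynomial.X φ, funext (polyEval_X φ)⟩

theorem mul {q q' : V → ℂ} (h : IsPolyFun q) (h' : IsPolyFun q') :
    IsPolyFun fun v => q v * q' v := by
  obtain ⟨p, rfl⟩ := h
  obtain ⟨p', rfl⟩ := h'
  exact ⟨p * p', funext (polyEval_mul p p')⟩

theorem sum {κ : Type*} (s : Finset κ) {q : κ → V → ℂ} (h : ∀ i ∈ s, IsPolyFun (q i)) :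
    IsPolyFun fun v => ∑ i ∈ s, q i v := by
  choose! p hp using h
  refine ⟨∑ i ∈ s, p i, funext fun v => (map_sum _ p s).trans ?_⟩
  exact Finset.sum_congr rfl fun i hi => congrFun (hp i hi) v

theorem prod {κ : Type*} (s : Finset κ) {q : κ → V → ℂ} (h : ∀ i ∈ s, IsPolyFun (q i)) :
    IsPolyFun fun v => ∏ i ∈ s, q i v := by
  choose! p hp using h
  refine ⟨∏ i ∈ s, p i, funext fun v => (map_prod _ p s).trans ?_⟩
  exact Finset.prod_congr rfl fun i hi => congrFun (hp i hi) v

theorem det {κ : Type*} [Fintype κ] [DecidableEq κ] {q : κ → κ → V → ℂ}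
    (h : ∀ i j, IsPolyFun (q i j)) :
    IsPolyFun fun v => (Matrix.of fun i j => q i j v).det := by
  simp only [Matrix.det_apply']
  exact sum _ fun σ _ => (const _).mul (prod _ fun i _ => h _ _)

theorem bilin [FiniteDimensional ℂ V] (B : V →ₗ[ℂ] V →ₗ[ℂ] ℂ) : IsPolyFun fun v => B v v := by
  let b := Module.finBasis ℂ V
  have hexpand (v : V) : B v v = ∑ i, b.coord i v * B (b i) v := by
    calc B v v = B (∑ i, b.repr v i • b i) v := by rw [b.sum_repr]
      _ = _ := by
        simp only [map_sum, LinearMap.sum_apply, map_smul, LinearMap.smul_apply, smul_eq_mul,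
          Basis.coord_apply]
  rw [funext hexpand]
  exact sum _ fun i _ => (linear _).mul (linear _)

theorem comp {q : W → ℂ} (h : IsPolyFun q) (f : V →ₗ[ℂ] W) : IsPolyFun fun v => q (f v) := by
  obtain ⟨p, rfl⟩ := h
  exact ⟨polyComp f p, funext (polyEval_polyComp f p)⟩

theorem eq_zero_of_mem_zariskiClosure {q : V → ℂ} (h : IsPolyFun q) {S : Set V}
    (hS : ∀ s ∈ S, q s = 0) {v : V} (hv : v ∈ zariskiClosure S) : q v = 0 := by
  obtain ⟨p, rfl⟩ := h
  exact hv p hS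

end IsPolyFun

theorem differential_C (c : ℂ) (y : V) : differential (MvPolynomial.C c) y = 0 := by
  ext v
  simp [differential, polyEval]

theorem differential_X (φ : Dual ℂ V) (y : V) : differential (MvPolynomial.X φ) y = φ := by
  ext v
  simp [differential, polyEval, MvPolynomial.mkDerivation_X]

theorem differential_add (p q : MvPolynomial (Dual ℂ V) ℂ) (y : V) :
    differential (p + q) y = differential p y + differential q y := by
  ext v
  simp [differential, polyEval]

theorem differential_mul (p q : MvPolynomial (Dual ℂ V) ℂ) (y : V) :
    differential (p * q) y = polyEval p y • differential q y + polyEval q y • differential p y := by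
  ext v
  simp [differential, polyEval, Derivation.leibniz]

theorem hasDerivAt_polyEval (p : MvPolynomial (Dual ℂ V) ℂ) {c : ℂ → V} {v : V} {t : ℂ}
    (hc : ∀ φ : Dual ℂ V, HasDerivAt (fun s => φ (c s)) (φ v) t) :
    HasDerivAt (fun s => polyEval p (c s)) (differential p (c t) v) t := by
  induction p using MvPolynomial.induction_on with
  | C a =>
    simpa only [polyEval_C, differential_C, LinearMap.zero_apply] using hasDerivAt_const t a
  | add p q hp hq =>
    simp only [polyEval_add, differential_add, LinearMap.add_apply]
    exact hp.add hq
  | mul_X p φ hp =>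
    simp only [polyEval_mul, polyEval_X, differential_mul, differential_X]
    exact (hp.mul (hc φ)).congr_deriv (by
      simp only [LinearMap.add_apply, LinearMap.smul_apply, smul_eq_mul]
      ring)

theorem hasDerivAt_polyEval_line (p : MvPolynomial (Dual ℂ V) ℂ) (y v : V) (t : ℂ) :
    HasDerivAt (fun s : ℂ => polyEval p (y + s • v)) (differential p (y + t • v) v) t := by
  refine hasDerivAt_polyEval p fun φ => ?_
  simpa using ((hasDerivAt_id t).mul_const (φ v)).const_add (φ y)

theorem polyEval_eq_zero_of_line {p : MvPolynomial (Dual ℂ V) ℂ} {y v : V}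
    (h : ∀ s : ℂ, s ≠ 0 → polyEval p (y + s • v) = 0) : polyEval p y = 0 := by
  have hcont := (hasDerivAt_polyEval_line p y v 0).continuousAt.tendsto
  rw [zero_smul, add_zero] at hcont
  refine tendsto_nhds_unique (hcont.mono_left (nhdsWithin_le_nhds (s := {0}ᶜ)))
    (tendsto_const_nhds.congr' ?_)
  filter_upwards [self_mem_nhdsWithin] with s hs
  exact (h s hs).symm

theorem mem_zariskiClosure_of_line {S : Set V} {y v : V}
    (h : ∀ s : ℂ, s ≠ 0 → y + s • v ∈ S) : y ∈ zariskiClosure S :=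
  fun _ hp => polyEval_eq_zero_of_line fun s hs => hp _ (h s hs)

theorem mem_tangentSpace {Y : Set V} {y v : V} :
    v ∈ tangentSpace Y y ↔ ∀ p ∈ vanishing Y, differential p y v = 0 := by
  simp [tangentSpace]

theorem mem_tangentSpace_of_curve {Y : Set V} {c : ℂ → V} {v : V} (hY : ∀ t, c t ∈ Y)
    (hc : ∀ φ : Dual ℂ V, HasDerivAt (fun s => φ (c s)) (φ v) 0) :
    v ∈ tangentSpace Y (c 0) := by
  rw [mem_tangentSpace]
  intro p hp
  have hderiv := hasDerivAt_polyEval p hc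
  simp only [fun t => hp _ (hY t)] at hderiv
  exact hderiv.unique (hasDerivAt_const _ _)

theorem mem_tangentSpace_of_line {Y : Set V} {y v w : V}
    (h : ∀ s : ℂ, s ≠ 0 → w ∈ tangentSpace Y (y + s • v)) : w ∈ tangentSpace Y y := by
  rw [mem_tangentSpace]
  intro p hp
  exact polyEval_eq_zero_of_line fun s hs => mem_tangentSpace.mp (h s hs) p hp

theorem differential_polyComp (f : V →ₗ[ℂ] W) (p : MvPolynomial (Dual ℂ W) ℂ) (y v : V) :
    differential (polyComp f p) y v = differential p (f y) (f v) := by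
  have h₁ := hasDerivAt_polyEval_line (polyComp f p) y v 0
  have h₂ := hasDerivAt_polyEval_line p (f y) (f v) 0
  simp only [polyEval_polyComp, map_add, map_smul, zero_smul, add_zero] at h₁ h₂
  exact h₁.unique h₂

theorem map_mem_tangentSpace (f : V →ₗ[ℂ] W) {Y : Set V} {Z : Set W} (hf : Set.MapsTo f Y Z)
    {y v : V} (hv : v ∈ tangentSpace Y y) : f v ∈ tangentSpace Z (f y) := by
  rw [mem_tangentSpace] at hv ⊢
  intro p hp
  rw [← differential_polyComp]
  exact hv _ fun s hs => by rw [polyEval_polyComp]; exact hp _ (hf hs)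

theorem IsPolyFun.continuousAt_line {q : V → ℂ} (hq : IsPolyFun q) (y v : V) (t : ℂ) :
    ContinuousAt (fun s : ℂ => q (y + s • v)) t := by
  obtain ⟨p, rfl⟩ := hq
  exact (hasDerivAt_polyEval_line p y v t).continuousAt

theorem IsPolyFun.hasDerivAt_zero_of_mem_tangentSpace {q : V → ℂ} (hq : IsPolyFun q) {Y : Set V}
    (hY : ∀ y ∈ Y, q y = 0) {y v : V} (hv : v ∈ tangentSpace Y y) :
    HasDerivAt (fun s : ℂ => q (y + s • v)) 0 0 := by
  obtain ⟨p, rfl⟩ := hq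
  have hderiv := hasDerivAt_polyEval_line p y v 0
  rwa [zero_smul, add_zero, mem_tangentSpace.mp hv p hY] at hderiv

end Zariski

section Determinantal

theorem hasDerivAt_det_of_col_eq_zero {𝕜 n : Type*} [NontriviallyNormedField 𝕜] [Fintype n]
    [DecidableEq n] {M : 𝕜 → Matrix n n 𝕜} {t : 𝕜} {j : n} {v : n → 𝕜} (hM : ContinuousAt M t)
    (hcol : ∀ i, M t i j = 0) (hv : ∀ i, HasDerivAt (fun s => M s i j) (v i) t) :
    HasDerivAt (fun s => (M s).det) ((M t).updateCol j v).det t := by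
  simp only [hasDerivAt_iff_tendsto_slope] at hv ⊢
  have hdet : (M t).det = 0 := Matrix.det_eq_zero_of_column_eq_zero j hcol
  have hslope (s : 𝕜) : slope (fun s => (M s).det) t s =
      ((M s).updateCol j fun i => slope (fun s => M s i j) t s).det := by
    have hslope_col : (fun i => slope (fun s => M s i j) t s) = (s - t)⁻¹ • fun i => M s i j := by
      ext i
      rw [slope_def_module, hcol, sub_zero, Pi.smul_apply]
    rw [slope_def_module, hdet, sub_zero, hslope_col, Matrix.det_updateCol_smul,
      Matrix.updateCol_eq_self, smul_eq_mul]
  have hcont : Continuous fun N : Matrix n n 𝕜 × (n → 𝕜) => (N.1.updateCol j N.2).det :=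
    (continuous_fst.matrix_updateCol j continuous_snd).matrix_det
  have hlim := (hcont.tendsto (M t, v)).comp
    ((hM.tendsto.mono_left nhdsWithin_le_nhds).prodMk_nhds (tendsto_pi_nhds.mpr hv))
  exact hlim.congr fun s => (hslope s).symm

variable {U V W : Type*} [AddCommGroup U] [Module ℂ U] [AddCommGroup V] [Module ℂ V]
  [AddCommGroup W] [Module ℂ W] [FiniteDimensional ℂ W]

theorem det_eq_zero_of_finrank_range_lt {κ : Type*} [Fintype κ] [DecidableEq κ] (A : U →ₗ[ℂ] W)
    (h : finrank ℂ (LinearMap.range A) < Fintype.card κ) (u : κ → U) (φ : κ → Dual ℂ W) :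
    (Matrix.of fun i j => φ i (A (u j))).det = 0 := by
  let L : (κ → ℂ) →ₗ[ℂ] (κ → ℂ) := LinearMap.pi φ ∘ₗ A ∘ₗ Fintype.linearCombination ℂ u
  have hL : LinearMap.toMatrix' L = Matrix.of fun i j => φ i (A (u j)) := by
    ext i j
    simp [L, LinearMap.toMatrix'_apply]
  rw [← hL, LinearMap.det_toMatrix']
  by_contra hdet
  have hker : LinearMap.ker L = ⊥ := by
    by_contra hne
    exact hdet (LinearMap.det_eq_zero_iff_ker_ne_bot.mpr hne)
  have hrange : LinearMap.range L = ⊤ := LinearMap.ker_eq_bot_iff_range_eq_top.mp hker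
  have hle : finrank ℂ (LinearMap.range L) ≤ finrank ℂ (LinearMap.range A) := by
    rw [LinearMap.range_comp]
    exact (Submodule.finrank_map_le _ _).trans
      (Submodule.finrank_mono (LinearMap.range_comp_le_range _ _))
  rw [hrange, finrank_top, Module.finrank_fintype_fun_eq_card] at hle
  exact hle.not_gt h

theorem exists_dual_families (A : U →ₗ[ℂ] W) :
    ∃ (u : Fin (finrank ℂ (LinearMap.range A)) → U)
      (φ : Fin (finrank ℂ (LinearMap.range A)) → Dual ℂ W),
      (Matrix.of fun i j => φ i (A (u j))) = 1 := by
  let b := Module.finBasis ℂ (LinearMap.range A)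
  choose u hu using fun j => (b j).2
  choose φ hφ using fun i => LinearMap.exists_extend (b.coord i)
  refine ⟨u, φ, ?_⟩
  ext i j
  have hij : φ i (b j) = b.coord i (b j) := LinearMap.congr_fun (hφ i) (b j)
  rw [Matrix.of_apply, hu, hij, Basis.coord_apply, Basis.repr_self, Finsupp.single_apply,
    Matrix.one_apply]
  exact if_congr eq_comm rfl rfl

variable {A : V → U →ₗ[ℂ] W}

theorem finrank_range_le_of_mem_zariskiClosure
    (hA : ∀ (φ : Dual ℂ W) u, IsPolyFun fun x => φ (A x u)) {S : Set V} {m : ℕ}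
    (hS : ∀ s ∈ S, finrank ℂ (LinearMap.range (A s)) ≤ m) {x : V}
    (hx : x ∈ zariskiClosure S) : finrank ℂ (LinearMap.range (A x)) ≤ m := by
  by_contra! hlt
  obtain ⟨u, φ, hone⟩ := exists_dual_families (A x)
  have hdet : (Matrix.of fun i j => φ i (A x (u j))).det = 0 :=
    IsPolyFun.eq_zero_of_mem_zariskiClosure (.det fun i j => hA (φ i) (u j)) (fun s hs =>
      det_eq_zero_of_finrank_range_lt (A s)
        (by rw [Fintype.card_fin]; exact (hS s hs).trans_lt hlt) u φ) hx
  rw [hone, Matrix.det_one] at hdet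
  exact one_ne_zero hdet

/-- The minors of size one larger than the rank of `A x` vanish on `Y`, hence their differentials
vanish on the tangent vectors of `Y` at `x`. -/
theorem mem_range_of_mem_tangentSpace
    (hA : ∀ (φ : Dual ℂ W) u, IsPolyFun fun x => φ (A x u)) {Y : Set V} {x v : V}
    (hY : ∀ y ∈ Y, finrank ℂ (LinearMap.range (A y)) ≤ finrank ℂ (LinearMap.range (A x)))
    (hv : v ∈ tangentSpace Y x) {u : U} {w : W} (hu : A x u = 0)
    (hw : ∀ φ : Dual ℂ W, HasDerivAt (fun s : ℂ => φ (A (x + s • v) u)) (φ w) 0) :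
    w ∈ LinearMap.range (A x) := by
  rw [← Subspace.forall_mem_dualAnnihilator_apply_eq_zero_iff]
  intro ψ hψ
  rw [Submodule.mem_dualAnnihilator] at hψ
  obtain ⟨u₀, φ₀, hone⟩ := exists_dual_families (A x)
  let u' := Sum.elim u₀ fun _ : Unit => u
  let φ := Sum.elim φ₀ fun _ : Unit => ψ
  let M (y : V) := Matrix.of fun i j => φ i (A y (u' j))
  have hM_zero (y : V) (hy : y ∈ Y) : (M y).det = 0 :=
    det_eq_zero_of_finrank_range_lt (A y) (by simpa using Nat.lt_succ_of_le (hY y hy)) u' φ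
  have hderiv : HasDerivAt (fun s : ℂ => (M (x + s • v)).det)
      ((M (x + (0 : ℂ) • v)).updateCol (Sum.inr ()) fun i => φ i w).det 0 := by
    refine hasDerivAt_det_of_col_eq_zero ?_ (fun i => ?_) fun i => hw (φ i)
    · exact continuousAt_pi.mpr fun i => continuousAt_pi.mpr fun j =>
        (hA _ _).continuousAt_line x v 0
    · simp [M, u', hu]
  have hdet : ((M x).updateCol (Sum.inr ()) fun i => φ i w).det = 0 := by
    simpa only [zero_smul, add_zero] using hderiv.unique
      (IsPolyFun.hasDerivAt_zero_of_mem_tangentSpace (.det fun i j => hA (φ i) (u' j)) hM_zero hv)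
  have hblock : ((M x).updateCol (Sum.inr ()) fun i => φ i w) =
      Matrix.fromBlocks 1 (Matrix.of fun i _ => φ₀ i w) 0 (Matrix.of fun _ _ => ψ w) := by
    ext (i | i) (j | j)
    · simp [M, φ, u', ← hone]
    · simp [φ]
    · simp [M, φ, u', hψ]
    · simp [φ]
  simpa [hblock, Matrix.det_fromBlocks_zero₂₁] using hdet

end Determinantal

/-! ### The closure order of the orbits -/

section Orbit

variable {𝒢 V : Type*} [Group 𝒢] [AddCommGroup V] [Module ℂ V] (σ : Representation ℂ 𝒢 V)

/-- The orbit of `x` in a representation. -/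
def repOrbit (x : V) : Set V := Set.range fun g => σ g x

variable {σ} {x y : V}

theorem self_mem_repOrbit (x : V) : x ∈ repOrbit σ x := ⟨1, by simp⟩

theorem mapsTo_repOrbit (g : 𝒢) (x : V) : Set.MapsTo (σ g) (repOrbit σ x) (repOrbit σ x) := by
  rintro _ ⟨g', rfl⟩
  exact ⟨g * g', by simp⟩

theorem repOrbit_subset_of_mem (h : y ∈ repOrbit σ x) : repOrbit σ y ⊆ repOrbit σ x := by
  rintro _ ⟨g, rfl⟩
  exact mapsTo_repOrbit g x h

theorem mem_repOrbit_comm : y ∈ repOrbit σ x ↔ x ∈ repOrbit σ y := by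
  constructor <;>
  · rintro ⟨g, rfl⟩
    exact ⟨g⁻¹, by simp⟩

theorem repOrbit_eq_of_mem (h : y ∈ repOrbit σ x) : repOrbit σ y = repOrbit σ x :=
  (repOrbit_subset_of_mem h).antisymm (repOrbit_subset_of_mem (mem_repOrbit_comm.mp h))

theorem mapsTo_zariskiClosure_repOrbit (g : 𝒢) (x : V) :
    Set.MapsTo (σ g) (zariskiClosure (repOrbit σ x)) (zariskiClosure (repOrbit σ x)) :=
  fun _ hv => map_mem_zariskiClosure (σ g) (mapsTo_repOrbit g x) hv

theorem repOrbit_subset_zariskiClosure (h : x ∈ zariskiClosure (repOrbit σ y)) :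
    repOrbit σ x ⊆ zariskiClosure (repOrbit σ y) := by
  rintro _ ⟨g, rfl⟩
  exact mapsTo_zariskiClosure_repOrbit g y h

theorem tangentSpace_repOrbit_map (x : V) (g : 𝒢) (y : V) :
    tangentSpace (zariskiClosure (repOrbit σ x)) (σ g y) =
      (tangentSpace (zariskiClosure (repOrbit σ x)) y).map (σ g) := by
  apply le_antisymm
  · intro v hv
    refine ⟨σ g⁻¹ v, ?_, by simp⟩
    simpa using map_mem_tangentSpace (σ g⁻¹) (mapsTo_zariskiClosure_repOrbit g⁻¹ x) hv
  · rintro _ ⟨v, hv, rfl⟩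
    exact map_mem_tangentSpace (σ g) (mapsTo_zariskiClosure_repOrbit g x) hv

theorem finrank_tangentSpace_repOrbit_map (x : V) (g : 𝒢) (y : V) :
    finrank ℂ (tangentSpace (zariskiClosure (repOrbit σ x)) (σ g y)) =
      finrank ℂ (tangentSpace (zariskiClosure (repOrbit σ x)) y) := by
  rw [tangentSpace_repOrbit_map]
  exact (Submodule.equivMapOfInjective _ (σ.apply_bijective g).1 _).finrank_eq.symm

theorem isSmoothPoint_map (h : IsSmoothPoint (zariskiClosure (repOrbit σ x)) y) (g : 𝒢) :
    IsSmoothPoint (zariskiClosure (repOrbit σ x)) (σ g y) :=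
  ⟨mapsTo_zariskiClosure_repOrbit g x h.1, fun z hz => by
    rw [finrank_tangentSpace_repOrbit_map]; exact h.2 z hz⟩

end Orbit

section Graded

variable {𝔩 : Type*} [LieRing 𝔩] [LieAlgebra ℂ 𝔩] {𝒢 : Type*} [Group 𝒢] {ξ : 𝔩}
  {ρ : Representation ℂ 𝒢 𝔩}

theorem isPolyFun_ad_sq [FiniteDimensional ℂ 𝔩] (φ : Dual ℂ 𝔩) (u : 𝔩) :
    IsPolyFun fun x => φ ((ad ℂ 𝔩 x ^ 2) u) :=
  .bilin ((LinearMap.mk₂ ℂ (fun x y : 𝔩 => ⁅x, ⁅y, u⁆⁆) (fun _ _ _ => add_lie ..)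
    (fun _ _ _ => smul_lie ..) (fun _ _ _ => by simp) (fun _ _ _ => by simp)).compr₂ φ)

namespace IsGradedAction

variable (A : IsGradedAction ξ ρ)
include A

theorem adSqRank_le_of_mem_zariskiClosure [FiniteDimensional ℂ 𝔩] {x y : 𝔩}
    (hx : x ∈ zariskiClosure (repOrbit ρ y)) : adSqRank x ≤ adSqRank y := by
  refine finrank_range_le_of_mem_zariskiClosure isPolyFun_ad_sq ?_ hx
  rintro _ ⟨g, rfl⟩
  exact (A.adSqRank_map g y).le

/-- The action on the part of degree `k`. -/
def gradedRep (k : ℂ) : Representation ℂ 𝒢 (lieEigenspace ξ k) :=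
  ρ.subrepresentation _ fun g _ hy => A.map_mem_grading g hy

theorem coe_gradedRep {k : ℂ} (g : 𝒢) (y : lieEigenspace ξ k) :
    (A.gradedRep k g y : 𝔩) = ρ g y := rfl

theorem repOrbit_gradedRep {k : ℂ} (y : lieEigenspace ξ k) :
    repOrbit (A.gradedRep k) y = Subtype.val ⁻¹' repOrbit ρ y :=
  Set.ext fun _ => exists_congr fun _ => Subtype.ext_iff

theorem coe_mem_zariskiClosure {k : ℂ} {y z : lieEigenspace ξ k}
    (hz : z ∈ zariskiClosure (repOrbit (A.gradedRep k) y)) :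
    (z : 𝔩) ∈ zariskiClosure (repOrbit ρ (y : 𝔩)) :=
  map_mem_zariskiClosure (lieEigenspace ξ k).subtype
    (fun _ hs => by rwa [A.repOrbit_gradedRep] at hs) hz

end IsGradedAction

end Graded

section Frame

variable {𝔩 : Type*} [LieRing 𝔩] [LieAlgebra ℂ 𝔩] [FiniteDimensional ℂ 𝔩]
  [LieAlgebra.IsKilling ℂ 𝔩] {H : LieSubalgebra ℂ 𝔩} [H.IsCartanSubalgebra]
  {κ : Type*} {ξ : 𝔩} {d : H.root → ℤ} {α : κ → H.root} {e f : κ → 𝔩}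
  {𝒢 : Type*} [Group 𝒢] {ρ : Representation ℂ 𝒢 𝔩} {S T : Finset κ}

namespace IsFrame

variable (F : IsFrame H ξ d α e f)
include F

/-- The sum of the root vectors with index in `T`, as an element of the part of degree one. -/
def sumE (T : Finset κ) : lieEigenspace ξ (1 : ℂ) := ⟨∑ i ∈ T, e i, F.sum_e_mem_grading T⟩

theorem coe_sumE (T : Finset κ) : (F.sumE T : 𝔩) = ∑ i ∈ T, e i := rfl

variable [Finite κ] (A : IsGradedAction ξ ρ)
include A

theorem exists_gradedRep_sumE_eq [DecidableEq κ] (hST : S ⊆ T) {s : ℂ} (hs : s ≠ 0) :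
    ∃ g, (∀ h ∈ H, ρ g h = h) ∧ A.gradedRep 1 g (F.sumE T) = F.sumE S + s • F.sumE (T \ S) := by
  obtain ⟨g, hgH, hg, -⟩ := F.exists_scaling A (fun i => if i ∈ S then 1 else s)
    fun i => by split_ifs <;> simp [hs]
  refine ⟨g, hgH, Subtype.ext ?_⟩
  rw [A.coe_gradedRep, Submodule.coe_add, Submodule.coe_smul, coe_sumE, coe_sumE, coe_sumE,
    map_sum, ← Finset.sum_sdiff hST, add_comm, Finset.smul_sum]
  congr 1 <;> refine Finset.sum_congr rfl fun i hi => ?_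
  · rw [hg, if_pos hi, one_smul]
  · rw [hg, if_neg (Finset.mem_sdiff.mp hi).2]

theorem sumE_mem_zariskiClosure (hST : S ⊆ T) :
    F.sumE S ∈ zariskiClosure (repOrbit (A.gradedRep 1) (F.sumE T)) := by
  classical
  refine mem_zariskiClosure_of_line (v := F.sumE (T \ S)) fun s hs => ?_
  obtain ⟨g, -, hg⟩ := F.exists_gradedRep_sumE_eq A hST hs
  exact ⟨g, hg⟩

variable [(rootSystem H).IsIrreducible]

theorem sum_mem_repOrbit_of_card_eq (h : S.card = T.card) :
    ∑ i ∈ S, e i ∈ repOrbit ρ (∑ i ∈ T, e i) :=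
  F.exists_map_sum_eq A h.symm

theorem sum_mem_zariskiClosure_of_card_le (h : S.card ≤ T.card) :
    ∑ i ∈ S, e i ∈ zariskiClosure (repOrbit ρ (∑ i ∈ T, e i)) := by
  obtain ⟨S', hS'T, hS'⟩ := Finset.exists_subset_card_eq h
  exact repOrbit_subset_zariskiClosure (A.coe_mem_zariskiClosure (F.sumE_mem_zariskiClosure A hS'T))
    (F.sum_mem_repOrbit_of_card_eq A hS'.symm)

theorem card_le_of_mem_zariskiClosure
    (h : ∑ i ∈ S, e i ∈ zariskiClosure (repOrbit ρ (∑ i ∈ T, e i))) : S.card ≤ T.card := by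
  by_contra! hlt
  obtain ⟨S', hS'S, hS'⟩ := Finset.exists_subset_card_eq hlt.le
  obtain ⟨g, hg⟩ := F.exists_map_sum_eq A hS'
  have hlt' : adSqRank (∑ i ∈ S', e i) < adSqRank (∑ i ∈ S, e i) :=
    F.adSqRank_lt (hS'S.ssubset_of_ne fun heq => hlt.ne (heq ▸ hS'.symm))
  refine hlt'.not_ge ?_
  rw [← A.adSqRank_map g (∑ i ∈ S', e i), hg]
  exact A.adSqRank_le_of_mem_zariskiClosure h

theorem repOrbit_subset_zariskiClosure_iff :
    repOrbit ρ (∑ i ∈ S, e i) ⊆ zariskiClosure (repOrbit ρ (∑ i ∈ T, e i)) ↔ S.card ≤ T.card :=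
  ⟨fun h => F.card_le_of_mem_zariskiClosure A (h (self_mem_repOrbit _)),
    fun h => repOrbit_subset_zariskiClosure (F.sum_mem_zariskiClosure_of_card_le A h)⟩

theorem disjoint_repOrbit (h : S.card ≠ T.card) :
    Disjoint (repOrbit ρ (∑ i ∈ S, e i)) (repOrbit ρ (∑ i ∈ T, e i)) := by
  rw [Set.disjoint_left]
  intro y hyS hyT
  have heq : repOrbit ρ (∑ i ∈ S, e i) = repOrbit ρ (∑ i ∈ T, e i) :=
    (repOrbit_eq_of_mem hyS).symm.trans (repOrbit_eq_of_mem hyT)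
  refine h (le_antisymm ?_ ?_) <;> rw [← F.repOrbit_subset_zariskiClosure_iff A, heq] <;>
    exact subset_zariskiClosure _

theorem exists_mem_repOrbit {y : 𝔩} (hy : y ∈ lieEigenspace ξ (1 : ℂ)) :
    ∃ T : Finset κ, y ∈ repOrbit ρ (∑ i ∈ T, e i) := by
  obtain ⟨g, -, T, -, hg⟩ :=
    F.exists_map_eq_sum A ∅ (mem_orthogonalPart.mpr ⟨hy, fun i hi => by simp at hi⟩)
  exact ⟨T, mem_repOrbit_comm.mpr ⟨g, hg⟩⟩

theorem exists_subset_of_mem_zariskiClosure {y : lieEigenspace ξ (1 : ℂ)}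
    (hy : y ∈ zariskiClosure (repOrbit (A.gradedRep 1) (F.sumE T))) :
    ∃ S ⊆ T, y ∈ repOrbit (A.gradedRep 1) (F.sumE S) := by
  obtain ⟨S, hS⟩ := F.exists_mem_repOrbit A y.2
  have hST : S.card ≤ T.card := F.card_le_of_mem_zariskiClosure A
    (repOrbit_subset_zariskiClosure (A.coe_mem_zariskiClosure hy) (mem_repOrbit_comm.mp hS))
  obtain ⟨S', hS'T, hS'⟩ := Finset.exists_subset_card_eq hST
  refine ⟨S', hS'T, ?_⟩
  rw [A.repOrbit_gradedRep]
  exact repOrbit_subset_of_mem (F.sum_mem_repOrbit_of_card_eq A hS'.symm) hS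

end IsFrame

end Frame

/-! ### Tangent spaces and the Pyasetskii pairing -/

section Generic

theorem repOrbit_zero {𝒢 V : Type*} [Group 𝒢] [AddCommGroup V] [Module ℂ V]
    {σ : Representation ℂ 𝒢 V} : repOrbit σ 0 = {0} := by
  simp [repOrbit]

theorem tangentSpace_zariskiClosure_le {V : Type*} [AddCommGroup V] [Module ℂ V] {S : Set V}
    {N : Submodule ℂ V} (hS : S ⊆ N) (y : V) : tangentSpace (zariskiClosure S) y ≤ N := by
  intro v hv
  rw [← Subspace.forall_mem_dualAnnihilator_apply_eq_zero_iff]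
  intro φ hφ
  have hφS : MvPolynomial.X φ ∈ vanishing (zariskiClosure S) := by
    rw [vanishing_zariskiClosure]
    exact fun s hs => (polyEval_X φ s).trans ((Submodule.mem_dualAnnihilator φ).mp hφ s (hS hs))
  simpa only [differential_X] using mem_tangentSpace.mp hv _ hφS

section LieCentralizer

variable {R 𝔩 : Type*} [CommRing R] [LieRing 𝔩] [LieAlgebra R 𝔩] {K N : Submodule R 𝔩}

/-- The elements of a Lie algebra that commute with all elements of a subspace. -/
def lieCentralizer (N : Submodule R 𝔩) : Submodule R 𝔩 := ⨅ u ∈ N, LinearMap.ker (ad R 𝔩 u)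

theorem mem_lieCentralizer {y : 𝔩} : y ∈ lieCentralizer N ↔ ∀ u ∈ N, ⁅u, y⁆ = 0 := by
  simp [lieCentralizer]

theorem IsLieStable.lieCentralizer (hN : IsLieStable K N) : IsLieStable K (lieCentralizer N) := by
  intro h hh y hy
  rw [mem_lieCentralizer] at hy ⊢
  intro u hu
  rw [leibniz_lie, hy u hu, lie_zero, add_zero, ← lie_skew u h, neg_lie, hy _ (hN h hh u hu),
    neg_zero]

end LieCentralizer

section KillingForm

variable {𝔩 : Type*} [LieRing 𝔩] [LieAlgebra ℂ 𝔩] {𝒢 : Type*} [Group 𝒢] {ξ : 𝔩}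
  {ρ : Representation ℂ 𝒢 𝔩}

theorem killingForm_lie_left (x y z : 𝔩) :
    killingForm ℂ 𝔩 ⁅x, y⁆ z = -killingForm ℂ 𝔩 y ⁅x, z⁆ := by
  rw [← lie_skew, map_neg, LinearMap.neg_apply, LieModule.traceForm_apply_lie_apply]

theorem killingForm_eq_zero {a b : ℂ} (hab : a + b ≠ 0) {x y : 𝔩} (hx : x ∈ lieEigenspace ξ a)
    (hy : y ∈ lieEigenspace ξ b) : killingForm ℂ 𝔩 x y = 0 := by
  have hinv := killingForm_lie_left ξ x y
  rw [mem_lieEigenspace.mp hx, mem_lieEigenspace.mp hy, map_smul, map_smul, LinearMap.smul_apply,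
    smul_eq_mul, smul_eq_mul, ← add_eq_zero_iff_eq_neg, ← add_mul] at hinv
  exact (mul_eq_zero.mp hinv).resolve_left hab

theorem IsGradedAction.killingForm_map [FiniteDimensional ℂ 𝔩] (A : IsGradedAction ξ ρ) (g : 𝒢)
    (x y : 𝔩) : killingForm ℂ 𝔩 (ρ g x) (ρ g y) = killingForm ℂ 𝔩 x y :=
  killingForm_of_equiv_apply
    { LinearEquiv.ofBijective (ρ g) (ρ.apply_bijective g) with map_lie' := A.map_lie g _ _ } x y

/-- The restriction of the Killing form to linear forms on the part of degree one. -/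
def killingRestrict (ξ : 𝔩) : 𝔩 →ₗ[ℂ] Dual ℂ (lieEigenspace ξ (1 : ℂ)) :=
  (lieEigenspace ξ (1 : ℂ)).subtype.dualMap ∘ₗ killingForm ℂ 𝔩

theorem killingRestrict_apply (w : 𝔩) (y : lieEigenspace ξ (1 : ℂ)) :
    killingRestrict ξ w y = killingForm ℂ 𝔩 w y := rfl

theorem hasDerivAt_ad_sq (φ : Dual ℂ 𝔩) (x v w : 𝔩) :
    HasDerivAt (fun s : ℂ => φ ((ad ℂ 𝔩 (x + s • v) ^ 2) w)) (φ (⁅x, ⁅v, w⁆⁆ + ⁅v, ⁅x, w⁆⁆)) 0 := by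
  have hexpand (s : ℂ) : φ ((ad ℂ 𝔩 (x + s • v) ^ 2) w) =
      φ ⁅x, ⁅x, w⁆⁆ + s * φ (⁅x, ⁅v, w⁆⁆ + ⁅v, ⁅x, w⁆⁆) + s ^ 2 * φ ⁅v, ⁅v, w⁆⁆ := by
    rw [ad_sq_apply]
    simp only [add_lie, lie_add, smul_lie, lie_smul, map_add, map_smul, smul_eq_mul]
    ring
  simp only [hexpand]
  have hlin := ((hasDerivAt_id (0 : ℂ)).mul_const (φ (⁅x, ⁅v, w⁆⁆ + ⁅v, ⁅x, w⁆⁆))).const_add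
    (φ ⁅x, ⁅x, w⁆⁆)
  exact (hlin.add ((hasDerivAt_pow 2 (0 : ℂ)).mul_const (φ ⁅v, ⁅v, w⁆⁆))).congr_deriv (by simp)

end KillingForm

end Generic

section Frame

variable {𝔩 : Type*} [LieRing 𝔩] [LieAlgebra ℂ 𝔩] [FiniteDimensional ℂ 𝔩]
  [LieAlgebra.IsKilling ℂ 𝔩] {H : LieSubalgebra ℂ 𝔩} [H.IsCartanSubalgebra]
  {κ : Type*} {ξ : 𝔩} {d : H.root → ℤ} {α : κ → H.root} {e f : κ → 𝔩}
  {𝒢 : Type*} [Group 𝒢] {ρ : Representation ℂ 𝒢 𝔩} {S T : Finset κ}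

theorem sum_pairingIn_eq_zero_of_mem_weightPart {β : H.root} {v : 𝔩} (hv : v ∈ rootSpace H β.1)
    (hv0 : v ≠ 0) (hvT : v ∈ weightPart ξ α T 0) :
    ∑ i ∈ T, (rootSystem H).pairingIn ℤ β (α i) = 0 := by
  by_contra hne
  exact hv0 (eq_zero_of_mem_lieEigenspace hvT.2 (mem_lieEigenspace_corootSum hv T)
    (mod_cast Ne.symm hne))

namespace IsFrame

variable (F : IsFrame H ξ d α e f)
include F

theorem sup_lieEigenspace_eq_top :
    lieEigenspace ξ (-1 : ℂ) ⊔ lieEigenspace ξ 0 ⊔ lieEigenspace ξ 1 = ⊤ := by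
  refine top_le_iff.mp (IsLieStable.top.le_of_rootVector_mem (H := H)
    (fun β v _ hv => ?_) fun v _ hv => ?_)
  · have hmem := F.mem_grading hv rfl
    rcases F.degree_mem β with hβ | hβ | hβ <;> rw [hβ] at hmem
    · exact Submodule.mem_sup_left (Submodule.mem_sup_left (mod_cast hmem))
    · exact Submodule.mem_sup_left (Submodule.mem_sup_right (mod_cast hmem))
    · exact Submodule.mem_sup_right (mod_cast hmem)
  · exact Submodule.mem_sup_left (Submodule.mem_sup_right (F.cartan_mem_grading hv))

theorem exists_eq_add_add (x : 𝔩) : ∃ a ∈ lieEigenspace ξ (-1 : ℂ), ∃ b ∈ lieEigenspace ξ (0 : ℂ),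
    ∃ c ∈ lieEigenspace ξ (1 : ℂ), x = a + b + c := by
  have hx : x ∈ lieEigenspace ξ (-1 : ℂ) ⊔ lieEigenspace ξ 0 ⊔ lieEigenspace ξ 1 :=
    F.sup_lieEigenspace_eq_top ▸ Submodule.mem_top
  obtain ⟨_, hab, c, hc, rfl⟩ := Submodule.mem_sup.mp hx
  obtain ⟨a, ha, b, hb, rfl⟩ := Submodule.mem_sup.mp hab
  exact ⟨a, ha, b, hb, c, hc, rfl⟩

theorem eq_zero_of_killingRestrict_eq_zero {w : 𝔩} (hw : w ∈ lieEigenspace ξ (-1 : ℂ))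
    (h : killingRestrict ξ w = 0) : w = 0 := by
  refine (killingForm_nondegenerate ℂ 𝔩).1 w fun x => ?_
  obtain ⟨a, ha, b, hb, c, hc, rfl⟩ := F.exists_eq_add_add x
  have hwc : killingForm ℂ 𝔩 w c = 0 := LinearMap.congr_fun h ⟨c, hc⟩
  rw [map_add, map_add, killingForm_eq_zero (by norm_num) hw ha,
    killingForm_eq_zero (by norm_num) hw hb, hwc, add_zero, add_zero]

theorem exists_killingRestrict_eq (φ : Dual ℂ (lieEigenspace ξ (1 : ℂ))) :
    ∃ w ∈ lieEigenspace ξ (-1 : ℂ), killingRestrict ξ w = φ := by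
  obtain ⟨φ', rfl⟩ := LinearMap.exists_extend φ
  obtain ⟨w, rfl⟩ := (LinearMap.BilinForm.toDual (killingForm ℂ 𝔩)
    (killingForm_nondegenerate ℂ 𝔩)).surjective φ'
  obtain ⟨a, ha, b, hb, c, hc, rfl⟩ := F.exists_eq_add_add w
  refine ⟨a, ha, LinearMap.ext fun y => ?_⟩
  rw [killingRestrict_apply, LinearMap.comp_apply, Submodule.subtype_apply,
    LinearMap.BilinForm.toDual_def, map_add, map_add, LinearMap.add_apply, LinearMap.add_apply,
    killingForm_eq_zero (by norm_num) hb y.2, killingForm_eq_zero (by norm_num) hc y.2, add_zero,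
    add_zero]

theorem weightPart_zero_le_orthogonalPart (T : Finset κ) :
    weightPart ξ α T 0 ≤ orthogonalPart ξ α T 1 := by
  refine F.le_of_rootVector_mem (F.isLieStable_weightPart T 0) inf_le_left fun β hβ v hvT hv => ?_
  rcases eq_or_ne v 0 with rfl | hv0
  · exact Submodule.zero_mem _
  have hpair := sum_pairingIn_eq_zero_of_mem_weightPart hv hv0 hvT
  rw [Finset.sum_eq_zero_iff_of_nonneg
    fun i _ => F.isShortDegree.pairingIn_nonneg (F.degree_one i) hβ] at hpair
  exact mem_orthogonalPart_of_mem_rootSpace hv hvT.1 hpair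

theorem exists_lie_sum_e_eq {u : 𝔩} (hu : u ∈ lieEigenspace ξ (0 : ℂ))
    (huT : u ∈ lieEigenspace (corootSum α T) (1 : ℂ)) :
    ∃ w ∈ lieEigenspace ξ (-1 : ℂ), ⁅∑ i ∈ T, e i, w⁆ = u := by
  refine ⟨⁅∑ i ∈ T, f i, u⁆, lie_mem_lieEigenspace (F.sum_f_mem_grading T) hu (add_zero _), ?_⟩
  have hzero : ⁅∑ i ∈ T, e i, u⁆ = 0 := F.eq_zero_of_mem_weightPart T (k := 3) (by norm_num)
    (by norm_num) (by norm_num) ⟨lie_mem_lieEigenspace (F.sum_e_mem_grading T) hu (add_zero _),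
      lie_mem_lieEigenspace (F.sum_e_mem_lieEigenspace_corootSum T) huT (by norm_num)⟩
  rw [leibniz_lie, F.lie_sum_e_sum_f, hzero, lie_zero, add_zero, mem_lieEigenspace.mp huT, one_smul]

section Nondegenerate

variable [(rootSystem H).IsIrreducible]

theorem exists_lie_rootVector_ne_zero (hT : T.Nonempty) {β : H.root} (hβ : d β = 1)
    (hβT : ∑ i ∈ T, (rootSystem H).pairingIn ℤ β (α i) = 0) {v : 𝔩} (hv : v ∈ rootSpace H β.1)
    (hv0 : v ≠ 0) :
    ∃ u ∈ lieEigenspace ξ (0 : ℂ) ⊓ lieEigenspace (corootSum α T) 1, ⁅u, v⁆ ≠ 0 := by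
  obtain ⟨δ, hδ, hβδ, hδT⟩ :=
    F.isShortDegree.exists_sum_pairingIn_eq_one F.degree_one F.orthogonal hT hβ hβT
  obtain ⟨v', hv', hvv'⟩ := exists_lie_eq_corootElement hv hv0
  obtain ⟨w, hw, hw0⟩ := δ.1.exists_ne_zero
  have hw1 : w ∈ lieEigenspace ξ (1 : ℂ) := by
    simpa only [Int.cast_one] using F.mem_grading hw hδ
  have hv'1 : v' ∈ lieEigenspace ξ (-1 : ℂ) := by
    simpa only [Int.cast_neg, Int.cast_one] using
      F.mem_grading hv' (k := -1) (by rw [F.isShortDegree.degree_neg, hβ])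
  have hwT : w ∈ lieEigenspace (corootSum α T) (1 : ℂ) := by
    simpa only [hδT, Int.cast_one] using mem_lieEigenspace_corootSum (α := α) hw T
  have hv'T : v' ∈ lieEigenspace (corootSum α T) (0 : ℂ) := by
    simpa only [RootPairing.pairingIn_reflectionPerm_self_left, Finset.sum_neg_distrib, hβT,
      neg_zero, Int.cast_zero] using mem_lieEigenspace_corootSum (α := α) hv' T
  refine ⟨⁅w, v'⁆, ⟨lie_mem_lieEigenspace hw1 hv'1 (by norm_num),
    lie_mem_lieEigenspace hwT hv'T (add_zero 1)⟩, ?_⟩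
  rw [lie_lie_eq_pairingIn_smul hvv' hw
    (F.lie_eq_zero_of_degree_one hw1 (mod_cast F.mem_grading hv (k := 1) hβ))]
  exact smul_ne_zero (Int.cast_ne_zero.mpr fun h => hβδ (pairingIn_eq_zero_comm.mp h)) hw0

theorem eq_zero_of_mem_lieCentralizer (hT : T.Nonempty) {v : 𝔩} (hv : v ∈ weightPart ξ α T 0)
    (hvC : v ∈ lieCentralizer (lieEigenspace ξ (0 : ℂ) ⊓ lieEigenspace (corootSum α T) 1)) :
    v = 0 := by
  suffices h : weightPart ξ α T 0 ⊓
      lieCentralizer (lieEigenspace ξ (0 : ℂ) ⊓ lieEigenspace (corootSum α T) 1) ≤ ⊥ from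
    h ⟨hv, hvC⟩
  refine F.le_of_rootVector_mem ((F.isLieStable_weightPart T 0).inf
    ((F.isLieStable_grading 0).inf (.lieEigenspace (corootSum_mem T) 1)).lieCentralizer)
    (inf_le_left.trans inf_le_left) fun β hβ v hvN hv => ?_
  by_contra hv0
  obtain ⟨u, hu, hne⟩ := F.exists_lie_rootVector_ne_zero hT hβ
    (sum_pairingIn_eq_zero_of_mem_weightPart hv hv0 hvN.1) hv hv0
  exact hne (mem_lieCentralizer.mp hvN.2 u hu)

end Nondegenerate

/-- The endomorphism of the part of degree one given by the action of `corootSum α T`. Its range is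
the tangent space at `∑ i ∈ T, e i` of the closure of the orbit of this vector. -/
def weightEnd (T : Finset κ) : Module.End ℂ (lieEigenspace ξ (1 : ℂ)) :=
  (ad ℂ 𝔩 (corootSum α T)).restrict (F.isLieStable_grading 1 _ (corootSum_mem T))

theorem coe_weightEnd (T : Finset κ) (y : lieEigenspace ξ (1 : ℂ)) :
    (F.weightEnd T y : 𝔩) = ⁅corootSum α T, (y : 𝔩)⁆ := rfl

variable (A : IsGradedAction ξ ρ)
include A

theorem weightEnd_mem_tangentSpace_self (T : Finset κ) (y : lieEigenspace ξ (1 : ℂ)) :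
    F.weightEnd T y ∈
      tangentSpace (zariskiClosure (repOrbit (A.gradedRep 1) (F.sumE T))) (F.sumE T) := by
  have hz : -⁅∑ i ∈ T, f i, (y : 𝔩)⁆ ∈ lieEigenspace ξ (0 : ℂ) :=
    Submodule.neg_mem _ (lie_mem_lieEigenspace (F.sum_f_mem_grading T) y.2 (by norm_num))
  have hze : ⁅-⁅∑ i ∈ T, f i, (y : 𝔩)⁆, ∑ i ∈ T, e i⁆ = F.weightEnd T y := by
    rw [neg_lie, lie_skew, F.coe_weightEnd, ← F.lie_sum_e_sum_f, lie_lie,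
      F.lie_eq_zero_of_degree_one (F.sum_e_mem_grading T) y.2, lie_zero, sub_zero]
  obtain ⟨γ, E⟩ := A.exists_isExpCurve _ hz
  have hγ : A.gradedRep 1 (γ 0) (F.sumE T) = F.sumE T := by
    rw [E.map_zero, map_one, Module.End.one_apply]
  have htangent := mem_tangentSpace_of_curve (v := F.weightEnd T y)
    (c := fun t => A.gradedRep 1 (γ t) (F.sumE T))
    (fun t => subset_zariskiClosure (repOrbit (A.gradedRep 1) (F.sumE T)) ⟨γ t, rfl⟩) fun φ => by
      obtain ⟨φ', rfl⟩ := LinearMap.exists_extend φ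
      have hderiv := E.hasDerivAt (∑ i ∈ T, e i) φ' 0
      rwa [E.map_zero, map_one, Module.End.one_apply, hze] at hderiv
  rwa [hγ] at htangent

theorem weightEnd_mem_tangentSpace [Finite κ] (hST : S ⊆ T) (y : lieEigenspace ξ (1 : ℂ)) :
    F.weightEnd T y ∈
      tangentSpace (zariskiClosure (repOrbit (A.gradedRep 1) (F.sumE T))) (F.sumE S) := by
  classical
  refine mem_tangentSpace_of_line (v := F.sumE (T \ S)) fun s hs => ?_
  obtain ⟨g, hgH, hg⟩ := F.exists_gradedRep_sumE_eq A hST hs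
  have hcomm : F.weightEnd T y = A.gradedRep 1 g (F.weightEnd T (A.gradedRep 1 g⁻¹ y)) := by
    refine Subtype.ext ?_
    rw [A.coe_gradedRep, F.coe_weightEnd, F.coe_weightEnd, A.map_lie, hgH _ (corootSum_mem T),
      A.coe_gradedRep, ρ.self_inv_apply]
  rw [← hg, tangentSpace_repOrbit_map, hcomm]
  exact Submodule.mem_map_of_mem (F.weightEnd_mem_tangentSpace_self A T _)

theorem two_smul_lie_mem_range_ad_sq {v : lieEigenspace ξ (1 : ℂ)}
    (hv : v ∈ tangentSpace (zariskiClosure (repOrbit (A.gradedRep 1) (F.sumE T))) (F.sumE T))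
    {u : 𝔩} (hu : u ∈ lieEigenspace ξ (0 : ℂ))
    (huT : u ∈ lieEigenspace (corootSum α T) (1 : ℂ)) :
    (2 : ℂ) • ⁅(v : 𝔩), u⁆ ∈ LinearMap.range (ad ℂ 𝔩 (∑ i ∈ T, e i) ^ 2) := by
  obtain ⟨w, -, rfl⟩ := F.exists_lie_sum_e_eq hu huT
  have hzero : ⁅∑ i ∈ T, e i, ⁅∑ i ∈ T, e i, w⁆⁆ = 0 :=
    F.eq_zero_of_mem_weightPart T (k := 3) (by norm_num) (by norm_num) (by norm_num)
      ⟨lie_mem_lieEigenspace (F.sum_e_mem_grading T) hu (add_zero _),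
        lie_mem_lieEigenspace (F.sum_e_mem_lieEigenspace_corootSum T) huT (by norm_num)⟩
  have hcomm : ⁅∑ i ∈ T, e i, ⁅(v : 𝔩), w⁆⁆ = ⁅(v : 𝔩), ⁅∑ i ∈ T, e i, w⁆⁆ := by
    rw [leibniz_lie, F.lie_eq_zero_of_degree_one (F.sum_e_mem_grading T) v.2, zero_lie, zero_add]
  refine mem_range_of_mem_tangentSpace (A := fun x : lieEigenspace ξ (1 : ℂ) => ad ℂ 𝔩 (x : 𝔩) ^ 2)
    (fun φ u => (isPolyFun_ad_sq φ u).comp (lieEigenspace ξ (1 : ℂ)).subtype)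
    (fun y hy => A.adSqRank_le_of_mem_zariskiClosure (A.coe_mem_zariskiClosure hy)) hv
    (u := w) ((ad_sq_apply _ _).trans hzero) fun φ => ?_
  have hderiv := hasDerivAt_ad_sq φ (∑ i ∈ T, e i) v w
  rwa [hcomm, ← two_smul ℂ] at hderiv

variable [(rootSystem H).IsIrreducible]

theorem eq_zero_of_mem_tangentSpace_of_mem_weightPart {v : lieEigenspace ξ (1 : ℂ)}
    (hv : v ∈ tangentSpace (zariskiClosure (repOrbit (A.gradedRep 1) (F.sumE T))) (F.sumE T))
    (hvT : (v : 𝔩) ∈ weightPart ξ α T 0) : v = 0 := by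
  rcases T.eq_empty_or_nonempty with rfl | hT
  · have hzero : F.sumE ∅ = 0 := Subtype.ext (F.coe_sumE ∅)
    rw [hzero, repOrbit_zero] at hv
    exact tangentSpace_zariskiClosure_le (N := ⊥) (by simp) _ hv
  refine Subtype.ext (F.eq_zero_of_mem_lieCentralizer hT hvT (mem_lieCentralizer.mpr ?_))
  rintro u ⟨hu, huT⟩
  have hrange := F.two_smul_lie_mem_range_ad_sq A hv hu huT
  rw [F.range_ad_sq] at hrange
  have hsmul := eq_zero_of_mem_lieEigenspace hrange.2
    (Submodule.smul_mem _ 2 (lie_mem_lieEigenspace hvT.2 huT (zero_add 1))) (by norm_num)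
  rw [← lie_skew, (smul_eq_zero.mp hsmul).resolve_left two_ne_zero, neg_zero]

theorem tangentSpace_sumE_le (T : Finset κ) :
    tangentSpace (zariskiClosure (repOrbit (A.gradedRep 1) (F.sumE T))) (F.sumE T) ≤
      LinearMap.range (F.weightEnd T) := by
  intro v hv
  obtain ⟨_, h01, v₂, ⟨h2, h2T⟩, hsum⟩ := Submodule.mem_sup.mp
    (F.le_sup_lieEigenspace_corootSum T (F.isLieStable_grading 1) le_rfl v.2)
  obtain ⟨v₀, h0, v₁, ⟨h1, h1T⟩, rfl⟩ := Submodule.mem_sup.mp h01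
  have hrange : v - ⟨v₀, h0.1⟩ ∈ LinearMap.range (F.weightEnd T) := by
    refine ⟨⟨v₁ + (2⁻¹ : ℂ) • v₂, Submodule.add_mem _ h1 (Submodule.smul_mem _ _ h2)⟩,
      Subtype.ext ?_⟩
    rw [F.coe_weightEnd, lie_add, lie_smul, mem_lieEigenspace.mp h1T, mem_lieEigenspace.mp h2T,
      one_smul, smul_smul, inv_mul_cancel₀ two_ne_zero, one_smul, Submodule.coe_sub, ← hsum,
      add_assoc, add_sub_cancel_left]
  obtain ⟨y, hy⟩ := hrange
  have hv₀ : (⟨v₀, h0.1⟩ : lieEigenspace ξ (1 : ℂ)) = v - F.weightEnd T y := by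
    rw [hy, sub_sub_cancel]
  have hzero : (⟨v₀, h0.1⟩ : lieEigenspace ξ (1 : ℂ)) = 0 :=
    F.eq_zero_of_mem_tangentSpace_of_mem_weightPart A
      (hv₀ ▸ Submodule.sub_mem _ hv (F.weightEnd_mem_tangentSpace_self A T y)) h0
  exact ⟨y, by rw [hy, hzero, sub_zero]⟩

theorem tangentSpace_sumE (T : Finset κ) :
    tangentSpace (zariskiClosure (repOrbit (A.gradedRep 1) (F.sumE T))) (F.sumE T) =
      LinearMap.range (F.weightEnd T) := by
  refine (F.tangentSpace_sumE_le A T).antisymm ?_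
  rintro _ ⟨y, rfl⟩
  exact F.weightEnd_mem_tangentSpace_self A T y

variable [Finite κ]

theorem isSmoothPoint_sumE (T : Finset κ) :
    IsSmoothPoint (zariskiClosure (repOrbit (A.gradedRep 1) (F.sumE T))) (F.sumE T) := by
  refine ⟨subset_zariskiClosure _ (self_mem_repOrbit _), fun z hz => ?_⟩
  obtain ⟨S, hST, g, rfl⟩ := F.exists_subset_of_mem_zariskiClosure A hz
  rw [F.tangentSpace_sumE A, finrank_tangentSpace_repOrbit_map]
  refine Submodule.finrank_mono ?_
  rintro _ ⟨y, rfl⟩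
  exact F.weightEnd_mem_tangentSpace A hST y

omit [Finite κ] [(rootSystem H).IsIrreducible] A in
theorem lie_corootSum_sum_f (h : Disjoint S T) : ⁅corootSum α T, ∑ i ∈ S, f i⁆ = 0 := by
  refine (mem_lieEigenspace_zero (R := ℂ)).mp (sum_mem fun i hi => ?_)
  simpa only [corootSum_reflectionPerm, lieEigenspace_neg, neg_zero] using
    F.neg.e_mem_lieEigenspace_corootSum_of_notMem (Finset.disjoint_left.mp h hi)

theorem exists_mem_repOrbit_of_lie_corootSum_eq_zero {w : 𝔩} (hw : w ∈ lieEigenspace ξ (-1 : ℂ))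
    (hwT : ⁅corootSum α T, w⁆ = 0) :
    ∃ S, Disjoint S T ∧ w ∈ repOrbit ρ (∑ i ∈ S, f i) := by
  have horth : w ∈ orthogonalPart (-ξ) (fun i => (rootSystem H).reflectionPerm (α i) (α i)) T 1 :=
    F.neg.weightPart_zero_le_orthogonalPart T ⟨by rwa [lieEigenspace_neg], by
      rw [corootSum_reflectionPerm, lieEigenspace_neg, neg_zero]
      exact mem_lieEigenspace_zero.mpr hwT⟩
  obtain ⟨g, -, S, hS, hg⟩ := F.neg.exists_map_eq_sum A.neg T horth
  exact ⟨S, hS, mem_repOrbit_comm.mpr ⟨g, hg⟩⟩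

omit [Finite κ] [(rootSystem H).IsIrreducible] in
theorem lie_corootSum_eq_zero_of_conormal {w : 𝔩} (hw : w ∈ lieEigenspace ξ (-1 : ℂ)) {g : 𝒢}
    (h : ∀ y, killingRestrict ξ w (A.gradedRep 1 g (F.weightEnd T y)) = 0) :
    ⁅corootSum α T, ρ g⁻¹ w⁆ = 0 := by
  refine F.eq_zero_of_killingRestrict_eq_zero (lie_mem_lieEigenspace
    (F.cartan_mem_grading (corootSum_mem T)) (A.map_mem_grading g⁻¹ hw) (zero_add _))
    (LinearMap.ext fun y => ?_)
  rw [killingRestrict_apply, killingForm_lie_left, ← A.killingForm_map g, ρ.self_inv_apply,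
    LinearMap.zero_apply, neg_eq_zero]
  exact h y

variable [Fintype κ] [DecidableEq κ]

omit [Finite κ] in
theorem dualCone_subset (T : Finset κ) :
    dualCone (zariskiClosure (repOrbit (A.gradedRep 1) (F.sumE T))) ⊆
      zariskiClosure (killingRestrict ξ '' repOrbit ρ (∑ i ∈ Tᶜ, f i)) := by
  apply zariskiClosure_subset_of_subset
  rintro φ ⟨y, hy, hφ⟩
  obtain ⟨w, hw, rfl⟩ := F.exists_killingRestrict_eq φ
  obtain ⟨S, hST, g, rfl⟩ := F.exists_subset_of_mem_zariskiClosure A hy.1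
  have hwT : ⁅corootSum α T, ρ g⁻¹ w⁆ = 0 :=
    F.lie_corootSum_eq_zero_of_conormal A hw fun y => hφ _ (by
      rw [tangentSpace_repOrbit_map]
      exact Submodule.mem_map_of_mem (F.weightEnd_mem_tangentSpace A hST y))
  obtain ⟨S', hS', hmem⟩ :=
    F.exists_mem_repOrbit_of_lie_corootSum_eq_zero A (A.map_mem_grading g⁻¹ hw) hwT
  have hcard : S'.card ≤ Tᶜ.card := Finset.card_le_card (le_compl_iff_disjoint_right.mpr hS')
  have hw' : w ∈ repOrbit ρ (∑ i ∈ S', f i) := by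
    simpa only [ρ.self_inv_apply] using mapsTo_repOrbit g _ hmem
  exact map_mem_zariskiClosure (killingRestrict ξ) (Set.mapsTo_image _ _)
    ((F.neg.repOrbit_subset_zariskiClosure_iff A.neg).mpr hcard hw')

omit [Finite κ] in
theorem subset_dualCone (T : Finset κ) :
    zariskiClosure (killingRestrict ξ '' repOrbit ρ (∑ i ∈ Tᶜ, f i)) ⊆
      dualCone (zariskiClosure (repOrbit (A.gradedRep 1) (F.sumE T))) := by
  apply zariskiClosure_mono
  rintro _ ⟨_, ⟨g, rfl⟩, rfl⟩
  refine ⟨_, isSmoothPoint_map (F.isSmoothPoint_sumE A T) g, fun v hv => ?_⟩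
  rw [tangentSpace_repOrbit_map, F.tangentSpace_sumE A] at hv
  obtain ⟨_, ⟨y, rfl⟩, rfl⟩ := hv
  rw [killingRestrict_apply, A.coe_gradedRep, A.killingForm_map, F.coe_weightEnd, ← neg_eq_zero,
    ← killingForm_lie_left, F.lie_corootSum_sum_f disjoint_compl_left, map_zero,
    LinearMap.zero_apply]

omit [Finite κ] in
theorem pyasetskiiCorresponds (T : Finset κ) :
    PyasetskiiCorresponds (V := lieEigenspace ξ (1 : ℂ)) (Subtype.val ⁻¹' repOrbit ρ (∑ i ∈ T, e i))
      (killingRestrict ξ '' repOrbit ρ (∑ i ∈ Tᶜ, f i)) := by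
  rw [PyasetskiiCorresponds, ← F.coe_sumE, ← A.repOrbit_gradedRep]
  exact (F.dualCone_subset A T).antisymm (F.subset_dualCone A T)

end IsFrame

end Frame

/-! ### The adjoint action of an algebraic group -/

section ZariskiContinuity

theorem continuous_zariskiTopology_of_dual {X V : Type*} [TopologicalSpace X] [AddCommGroup V]
    [Module ℂ V] {u : X → V} (hu : ∀ φ : Dual ℂ V, Continuous fun t => φ (u t)) :
    Continuous[_, zariskiTopology V] u := by
  let := zariskiTopology V
  refine continuous_iff_isClosed.mpr fun Z hZ => ?_
  rw [isClosed_zariski_iff] at hZ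
  have preimage_eq : u ⁻¹' Z = ⋂ p ∈ vanishing Z, {t | polyEval p (u t) = 0} := by
    ext t
    simp only [Set.mem_preimage, Set.mem_iInter]
    exact ⟨fun h p hp => hp _ h, fun h => hZ fun p hp => h p hp⟩
  rw [preimage_eq]
  refine isClosed_biInter fun p _ => isClosed_eq ?_ continuous_const
  exact (MvPolynomial.continuous_eval p).comp (continuous_pi hu)

variable {n : ℕ} {C : Subgroup (GL (Fin n) ℂ)}

theorem identityComponent_le : identityComponent C ≤ C :=
  fun _ hg => @connectedComponentIn_subset _ (zariskiGL n) _ _ _ hg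

theorem mem_identityComponent_of_continuous {X : Type*} [TopologicalSpace X] [PreconnectedSpace X]
    {u : X → GL (Fin n) ℂ} (hu : Continuous fun t => (u t : Matrix (Fin n) (Fin n) ℂ))
    (huC : ∀ t, u t ∈ C) {s : X} (hs : u s = 1) (t : X) : u t ∈ identityComponent C := by
  have hdual : ∀ φ : Dual ℂ (Matrix (Fin n) (Fin n) ℂ), Continuous fun t => φ (u t) :=
    fun φ => φ.continuous_of_finiteDimensional.comp hu
  let := zariskiTopology (Matrix (Fin n) (Fin n) ℂ)
  let := zariskiGL n
  have hcont : Continuous u := continuous_induced_rng.mpr (continuous_zariskiTopology_of_dual hdual)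
  exact (isPreconnected_range hcont).subset_connectedComponentIn ⟨s, hs⟩
    (Set.range_subset_iff.mpr huC) ⟨t, rfl⟩

end ZariskiContinuity

section AdjointAction

variable {n : ℕ} {L G : Subgroup (GL (Fin n) ℂ)} {𝔩 : LieSubalgebra ℂ (Matrix (Fin n) (Fin n) ℂ)}

theorem IsLieAlgebraOf.conj_mem (h𝔩 : IsLieAlgebraOf L 𝔩) {g : GL (Fin n) ℂ} (hg : g ∈ L)
    {X : Matrix (Fin n) (Fin n) ℂ} (hX : X ∈ 𝔩) :
    (g : Matrix (Fin n) (Fin n) ℂ) * X * ((g⁻¹ : GL (Fin n) ℂ) : Matrix (Fin n) (Fin n) ℂ) ∈ 𝔩 := by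
  rw [h𝔩] at hX ⊢
  intro t
  obtain ⟨u, hu, hut⟩ := hX t
  refine ⟨g * u * g⁻¹, L.mul_mem (L.mul_mem hg hu) (L.inv_mem hg), ?_⟩
  rw [Units.val_mul, Units.val_mul, hut, ← Matrix.exp_units_conj, mul_smul_comm, smul_mul_assoc]

/-- The adjoint action of a subgroup `G` of `L` on the Lie algebra of `L`. -/
def adRep (h𝔩 : IsLieAlgebraOf L 𝔩) (hG : G ≤ L) : Representation ℂ G 𝔩 where
  toFun g :=
    { toFun := fun x => ⟨_, h𝔩.conj_mem (hG g.2) x.2⟩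
      map_add' := fun x y => Subtype.ext (by simp [mul_add, add_mul])
      map_smul' := fun c x => Subtype.ext (by simp) }
  map_one' := LinearMap.ext fun x => Subtype.ext (by simp)
  map_mul' g h := LinearMap.ext fun x => Subtype.ext (by simp [mul_assoc])

theorem coe_adRep (h𝔩 : IsLieAlgebraOf L 𝔩) (hG : G ≤ L) (g : G) (x : 𝔩) :
    (adRep h𝔩 hG g x : Matrix (Fin n) (Fin n) ℂ) =
      ((g : GL (Fin n) ℂ) : Matrix (Fin n) (Fin n) ℂ) * x *
        (((g : GL (Fin n) ℂ)⁻¹ : GL (Fin n) ℂ) : Matrix (Fin n) (Fin n) ℂ) := rfl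

theorem adOrbit_eq_repOrbit (h𝔩 : IsLieAlgebraOf L 𝔩) (hG : G ≤ L) (x : 𝔩) :
    adOrbit G x = repOrbit (adRep h𝔩 hG) x := by
  ext y
  constructor
  · rintro ⟨g, hg, h⟩
    exact ⟨⟨g, hg⟩, Subtype.ext h.symm⟩
  · rintro ⟨g, rfl⟩
    exact ⟨g, g.2, rfl⟩

theorem adRep_lie (h𝔩 : IsLieAlgebraOf L 𝔩) (hG : G ≤ L) (g : G) (x y : 𝔩) :
    adRep h𝔩 hG g ⁅x, y⁆ = ⁅adRep h𝔩 hG g x, adRep h𝔩 hG g y⁆ := by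
  apply Subtype.ext
  simp only [LieSubalgebra.coe_bracket, coe_adRep, LieRing.of_associative_ring_bracket]
  simp [mul_sub, sub_mul, mul_assoc]

theorem lie_eq_zero_iff_commute {x y : 𝔩} :
    ⁅x, y⁆ = 0 ↔ Commute (x : Matrix (Fin n) (Fin n) ℂ) y := by
  rw [← LieSubalgebra.coe_zero_iff_zero, LieSubalgebra.coe_bracket, commute_iff_lie_eq]

section Exponential

attribute [local instance] Matrix.linftyOpNormedRing Matrix.linftyOpNormedAlgebra

theorem hasDerivAt_exp_conj (z x : Matrix (Fin n) (Fin n) ℂ) (t : ℂ) :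
    HasDerivAt (fun t : ℂ => NormedSpace.exp (t • z) * x * NormedSpace.exp (t • -z))
      (NormedSpace.exp (t • z) * ⁅z, x⁆ * NormedSpace.exp (t • -z)) t := by
  refine (((hasDerivAt_exp_smul_const z t).mul_const x).mul
    (hasDerivAt_exp_smul_const' (-z) t)).congr_deriv ?_
  rw [LieRing.of_associative_ring_bracket]
  noncomm_ring

theorem isExpCurve_adRep (h𝔩 : IsLieAlgebraOf L 𝔩) (hG : G ≤ L) {z : 𝔩} {γ : ℂ → G}
    (hγ : ∀ t, ((γ t : GL (Fin n) ℂ) : Matrix (Fin n) (Fin n) ℂ) =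
      NormedSpace.exp (t • (z : Matrix (Fin n) (Fin n) ℂ))) :
    IsExpCurve (adRep h𝔩 hG) z γ where
  map_zero := Subtype.ext <| Units.ext <| by
    rw [hγ, zero_smul, NormedSpace.exp_zero, OneMemClass.coe_one, Units.val_one]
  hasDerivAt x φ t := by
    have hinv : ∀ t, (((γ t : GL (Fin n) ℂ)⁻¹ : GL (Fin n) ℂ) : Matrix (Fin n) (Fin n) ℂ) =
        NormedSpace.exp (t • -(z : Matrix (Fin n) (Fin n) ℂ)) := fun t => by
      rw [smul_neg, Matrix.exp_neg, ← hγ, Matrix.coe_units_inv]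
    obtain ⟨Φ, hΦ⟩ := LinearMap.exists_extend (p := 𝔩.toSubmodule) φ
    have hφ : ∀ y : 𝔩, φ y = Φ y := fun y => (LinearMap.congr_fun hΦ y).symm
    simp only [hφ, coe_adRep, hγ, hinv, LieSubalgebra.coe_bracket]
    exact Φ.toContinuousLinearMap.hasFDerivAt.comp_hasDerivAt t (hasDerivAt_exp_conj _ _ t)

theorem exists_exp_mem_identityComponent_centralizerIn (h𝔩 : IsLieAlgebraOf L 𝔩)
    {ξ : Matrix (Fin n) (Fin n) ℂ} {z : 𝔩} (hz : Commute ξ z) :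
    ∃ γ : ℂ → identityComponent (centralizerIn L ξ),
      ∀ t, ((γ t : GL (Fin n) ℂ) : Matrix (Fin n) (Fin n) ℂ) =
        NormedSpace.exp (t • (z : Matrix (Fin n) (Fin n) ℂ)) := by
  choose u hu hut using (h𝔩 z).mp z.2
  have hu0 : u 0 = 1 := Units.ext (by rw [hut, zero_smul, NormedSpace.exp_zero, Units.val_one])
  have hmem : ∀ t, u t ∈ centralizerIn L ξ := fun t => by
    refine ⟨hu t, ?_⟩
    rw [hut]
    exact (hz.smul_right t).exp_right.symm
  have hcont : Continuous fun t => (u t : Matrix (Fin n) (Fin n) ℂ) := by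
    simp only [hut]
    exact continuous_iff_continuousAt.mpr fun t => (hasDerivAt_exp_smul_const _ t).continuousAt
  exact ⟨fun t => ⟨u t, mem_identityComponent_of_continuous hcont hmem hu0 t⟩, hut⟩

end Exponential

theorem identityComponent_centralizerIn_le (L : Subgroup (GL (Fin n) ℂ))
    (ξ : Matrix (Fin n) (Fin n) ℂ) : identityComponent (centralizerIn L ξ) ≤ L :=
  fun _ hg => (identityComponent_le hg).1

theorem isGradedAction_adRep (h𝔩 : IsLieAlgebraOf L 𝔩) (ξ : 𝔩) :
    IsGradedAction ξ (adRep h𝔩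
      (identityComponent_centralizerIn_le L (ξ : Matrix (Fin n) (Fin n) ℂ))) where
  map_lie := adRep_lie h𝔩 _
  map_grading g := by
    apply Subtype.ext
    rw [coe_adRep, (identityComponent_le g.2).2, mul_assoc, Units.mul_inv, mul_one]
  exists_isExpCurve z hz := by
    obtain ⟨γ, hγ⟩ := exists_exp_mem_identityComponent_centralizerIn h𝔩
      (lie_eq_zero_iff_commute.mp (mem_lieEigenspace_zero.mp hz))
    exact ⟨γ, isExpCurve_adRep h𝔩 _ hγ⟩

end AdjointAction

/-! ### The frame of a maximal sequence of roots -/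

section GradingElement

section DegreeOperator

variable {V : Type*} [AddCommGroup V] [Module ℂ V] (ℒ : ℤ → Submodule ℂ V)
  [DirectSum.Decomposition ℒ] {T : V →ₗ[ℂ] V}

theorem decompose_degreeOperator (hT : ∀ (k : ℤ), ∀ x ∈ ℒ k, T x = (k : ℂ) • x) (x : V) (k : ℤ) :
    (DirectSum.decompose ℒ (T x) k : V) = (k : ℂ) • (DirectSum.decompose ℒ x k : V) := by
  induction x using DirectSum.Decomposition.inductionOn ℒ with
  | zero => simp
  | @homogeneous i m =>
    rw [hT i m m.2, DirectSum.decompose_smul, DirectSum.smul_apply, Submodule.coe_smul]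
    obtain rfl | h := eq_or_ne i k
    · rfl
    · rw [DirectSum.decompose_of_mem_ne ℒ m.2 h, smul_zero, smul_zero]
  | add a b ha hb =>
    rw [map_add, DirectSum.decompose_add, DirectSum.decompose_add, DirectSum.add_apply,
      DirectSum.add_apply, Submodule.coe_add, Submodule.coe_add, ha, hb, smul_add]

theorem decompose_eq_zero_or_eq_degree (hT : ∀ (k : ℤ), ∀ x ∈ ℒ k, T x = (k : ℂ) • x) {x : V}
    {c : ℂ} (hx : T x = c • x) (k : ℤ) : (DirectSum.decompose ℒ x k : V) = 0 ∨ c = k := by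
  have h := decompose_degreeOperator ℒ hT x k
  rw [hx, DirectSum.decompose_smul, DirectSum.smul_apply, Submodule.coe_smul, ← sub_eq_zero,
    ← sub_smul, smul_eq_zero, sub_eq_zero] at h
  exact h.symm

theorem mem_iff_degreeOperator_eq (hT : ∀ (k : ℤ), ∀ x ∈ ℒ k, T x = (k : ℂ) • x) (k : ℤ) (x : V) :
    x ∈ ℒ k ↔ T x = (k : ℂ) • x := by
  classical
  refine ⟨hT k x, fun h => ?_⟩
  rw [← DirectSum.sum_support_decompose ℒ x]
  refine sum_mem fun i _ => ?_
  obtain h0 | hik := decompose_eq_zero_or_eq_degree ℒ hT h i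
  · rw [h0]
    exact Submodule.zero_mem _
  · rw [Int.cast_inj.mp hik]
    exact SetLike.coe_mem _

theorem exists_degree_eq (hT : ∀ (k : ℤ), ∀ x ∈ ℒ k, T x = (k : ℂ) • x) {x : V} (hx0 : x ≠ 0)
    {c : ℂ} (hx : T x = c • x) : ∃ k : ℤ, c = k ∧ ℒ k ≠ ⊥ := by
  classical
  obtain ⟨k, hk⟩ : ∃ k, (DirectSum.decompose ℒ x k : V) ≠ 0 := by
    by_contra! h
    apply hx0
    rw [← DirectSum.sum_support_decompose ℒ x]
    exact Finset.sum_eq_zero fun i _ => h i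
  exact ⟨k, (decompose_eq_zero_or_eq_degree ℒ hT hx k).resolve_left hk,
    Submodule.ne_bot_iff _ |>.mpr ⟨_, SetLike.coe_mem _, hk⟩⟩

end DegreeOperator

variable {𝔩 : Type*} [LieRing 𝔩] [LieAlgebra ℂ 𝔩] {ℒ : ℤ → Submodule ℂ 𝔩}

theorem isGradingElement_of_lie_eq [DirectSum.Decomposition ℒ] {ξ : 𝔩}
    (hξ : ∀ (k : ℤ), ∀ x ∈ ℒ k, ⁅ξ, x⁆ = (k : ℂ) • x) : IsGradingElement ℒ ξ :=
  mem_iff_degreeOperator_eq ℒ (T := ad ℂ 𝔩 ξ) hξ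

theorem IsGradingElement.eq_lieEigenspace {ξ : 𝔩} (hξ : IsGradingElement ℒ ξ) (k : ℤ) :
    ℒ k = lieEigenspace ξ (k : ℂ) :=
  Submodule.ext fun x => (hξ k x).trans mem_lieEigenspace.symm

variable [FiniteDimensional ℂ 𝔩] [LieAlgebra.IsKilling ℂ 𝔩]

theorem IsGradingElement.unique [DirectSum.Decomposition ℒ] {ξ η : 𝔩}
    (hξ : IsGradingElement ℒ ξ) (hη : IsGradingElement ℒ η) : ξ = η := by
  classical
  suffices LieDerivation.ad ℂ 𝔩 (ξ - η) = 0 from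
    sub_eq_zero.mp ((LieDerivation.IsKilling.ad_apply_eq_zero_iff ℂ 𝔩 _).mp this)
  ext x
  rw [← DirectSum.sum_support_decompose ℒ x, map_sum, LieDerivation.zero_apply]
  refine Finset.sum_eq_zero fun i _ => ?_
  have hi := SetLike.coe_mem (DirectSum.decompose ℒ x i)
  rw [LieDerivation.ad_apply_apply, sub_lie, (hξ i _).mp hi, (hη i _).mp hi, sub_self]

theorem existsUnique_isGradingElement (ℒ : ℤ → Submodule ℂ 𝔩) [GradedLieAlgebra ℒ] :
    ∃! ξ : 𝔩, IsGradingElement ℒ ξ := by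
  obtain ⟨ξ, hξ⟩ := LieDerivation.IsKilling.exists_eq_ad
    (LieDerivation.ofGrading ℒ (Int.castAddHom ℂ))
  have hξ' : IsGradingElement ℒ ξ := isGradingElement_of_lie_eq fun k x hx => by
    rw [← LieDerivation.ad_apply_apply ℂ, hξ, LieDerivation.ofGrading_apply_apply ℒ _ hx,
      Int.coe_castAddHom]
  exact ⟨ξ, hξ', fun η hη => hη.unique hξ'⟩

variable {H : LieSubalgebra ℂ 𝔩} [H.IsCartanSubalgebra] {ξ : 𝔩}

omit [FiniteDimensional ℂ 𝔩] [LieAlgebra.IsKilling ℂ 𝔩] in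
theorem IsGradingElement.mem_cartan (hξ : IsGradingElement ℒ ξ) (hH : H.toSubmodule ≤ ℒ 0) :
    ξ ∈ H := by
  rw [← LieSubalgebra.IsCartanSubalgebra.self_normalizing (H := H),
    LieSubalgebra.mem_normalizer_iff]
  intro y hy
  rw [(hξ 0 y).mp (hH hy), Int.cast_zero, zero_smul]
  exact H.zero_mem

theorem IsGradingElement.exists_degree [DirectSum.Decomposition ℒ] (hξ : IsGradingElement ℒ ξ)
    (hshort : IsShort ℒ) (hmem : ξ ∈ H) : ∃ d : H.root → ℤ, ∀ β, β.1 ⟨ξ, hmem⟩ = d β ∧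
      (d β = -1 ∨ d β = 0 ∨ d β = 1) ∧ ∀ k, β ∈ rootsOfDegree H ℒ k ↔ d β = k := by
  have exists_int : ∀ β : H.root, ∃ k : ℤ, β.1 ⟨ξ, hmem⟩ = k ∧ (k = -1 ∨ k = 0 ∨ k = 1) :=
    fun β => by
      obtain ⟨v, hv, hv0⟩ := β.1.exists_ne_zero
      obtain ⟨k, hk, hk'⟩ := exists_degree_eq ℒ (T := ad ℂ 𝔩 ξ) (fun k x hx => (hξ k x).mp hx) hv0
        (mem_lieEigenspace.mp (mem_lieEigenspace_of_mem_rootSpace hv hmem))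
      exact ⟨k, hk, (hshort k).mp hk'⟩
  choose d hd hd' using exists_int
  refine ⟨d, fun β => ⟨hd β, hd' β, fun k => ⟨fun h => ?_, ?_⟩⟩⟩
  · obtain ⟨v, hv, hv0⟩ := β.1.exists_ne_zero
    by_contra hne
    exact hv0 (eq_zero_of_mem_lieEigenspace (mem_lieEigenspace.mpr ((hξ k v).mp (h hv)))
      (mem_lieEigenspace_of_mem_rootSpace hv hmem) (by rw [hd]; exact_mod_cast Ne.symm hne))
  · rintro rfl v hv
    rw [hξ, ← hd, ← mem_lieEigenspace]
    exact mem_lieEigenspace_of_mem_rootSpace hv hmem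

end GradingElement

section FrameOfRoots

variable {𝔩 : Type*} [LieRing 𝔩] [LieAlgebra ℂ 𝔩] [FiniteDimensional ℂ 𝔩]
  [LieAlgebra.IsKilling ℂ 𝔩] {H : LieSubalgebra ℂ 𝔩} [H.IsCartanSubalgebra]

theorem isOrthogonal_iff_pairingIn_eq_zero {a b : H.root} :
    (rootSystem H).IsOrthogonal a b ↔ (rootSystem H).pairingIn ℤ a b = 0 := by
  have hcast : ∀ a b, (rootSystem H).pairing a b = 0 ↔ (rootSystem H).pairingIn ℤ a b = 0 :=
    fun a b => by rw [← (rootSystem H).algebraMap_pairingIn ℤ, algebraMap_int_eq, eq_intCast,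
      Int.cast_eq_zero]
  rw [RootPairing.IsOrthogonal, hcast, hcast, pairingIn_eq_zero_comm (a := b), and_self]

theorem isSl2Triple_of_lie_eq_corootElement (a : H.root) {e f : 𝔩} (he : e ∈ rootSpace H a.1)
    (hf : f ∈ rootSpace H ((rootSystem H).reflectionPerm a a).1)
    (h : ⁅e, f⁆ = corootElement H a) : IsSl2Triple (corootElement H a) e f where
  h_ne_zero h0 := by
    have h2 := root_apply_coroot (LieSubalgebra.isNonZero_coe_root a)
    rw [show coroot a.1 = 0 from Subtype.ext h0, ← LieModule.Weight.toLinear_apply, map_zero] at h2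
    exact two_ne_zero h2.symm
  lie_e_f := h
  lie_h_e_nsmul := by
    simpa [ofNat_smul_eq_nsmul] using mem_lieEigenspace.mp (mem_lieEigenspace_corootElement he a)
  lie_h_f_nsmul := by
    simpa [ofNat_smul_eq_nsmul] using mem_lieEigenspace.mp (mem_lieEigenspace_corootElement hf a)

theorem IsMaximalOrthogonalLong.exists_isFrame {ℒ : ℤ → Submodule ℂ 𝔩} [DirectSum.Decomposition ℒ]
    {ξ : 𝔩} (hξ : IsGradingElement ℒ ξ) (hshort : IsShort ℒ) (hH : H.toSubmodule ≤ ℒ 0) {r : ℕ}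
    {α : Fin r → H.root} (hα : IsMaximalOrthogonalLong H ℒ α) :
    ∃ d : H.root → ℤ, ∀ e f : Fin r → 𝔩, (∀ i, e i ∈ rootSpace H (α i).1) →
      (∀ i, f i ∈ rootSpace H ((rootSystem H).reflectionPerm (α i) (α i)).1) →
      (∀ i, ⁅e i, f i⁆ = corootElement H (α i)) → IsFrame H ξ d α e f := by
  obtain ⟨d, hd⟩ := hξ.exists_degree hshort (hξ.mem_cartan hH)
  exact ⟨d, fun e f he hf hef =>
    { mem_cartan := hξ.mem_cartan hH
      apply_eq := fun β => (hd β).1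
      degree_mem := fun β => (hd β).2.1
      degree_one := fun i => ((hd _).2.2 1).mp (hα.mem i)
      long := hα.long
      orthogonal := fun i j hij => isOrthogonal_iff_pairingIn_eq_zero.mp (hα.orthogonal i j hij)
      maximal := fun β hβ hl => by
        obtain ⟨i, hi⟩ := hα.maximal β (((hd β).2.2 1).mpr hβ) hl
        exact ⟨i, fun h => hi (isOrthogonal_iff_pairingIn_eq_zero.mpr h)⟩
      triple := fun i => isSl2Triple_of_lie_eq_corootElement (α i) (he i) (hf i) (hef i)
      e_mem := he
      f_mem := hf }⟩

end FrameOfRoots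

/-! ### Orbits of the partial sums -/

section InitialSegment

/-- The first `k` elements of `Fin r`. They index the summands of `partialSum v k`. -/
def initialSegment (r k : ℕ) : Finset (Fin r) := {i | i.val < k}

theorem partialSum_eq_sum_initialSegment {M : Type*} [AddCommMonoid M] {r : ℕ} (v : Fin r → M)
    (k : ℕ) : partialSum v k = ∑ i ∈ initialSegment r k, v i := rfl

variable {r k : ℕ}

theorem card_initialSegment (hk : k ≤ r) : (initialSegment r k).card = k := by
  rw [initialSegment, Fin.card_filter_val_lt, min_eq_right hk]

theorem initialSegment_nonempty (hk0 : 1 ≤ k) (hk : k ≤ r) : (initialSegment r k).Nonempty := by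
  rwa [← Finset.card_pos, card_initialSegment hk]

theorem card_compl_initialSegment (hk : k ≤ r) :
    (initialSegment r k)ᶜ.card = (initialSegment r (r - k)).card := by
  rw [Finset.card_compl, card_initialSegment hk, card_initialSegment (Nat.sub_le r k),
    Fintype.card_fin]

end InitialSegment

section PartialSums

variable {𝔩 : Type*} [LieRing 𝔩] [LieAlgebra ℂ 𝔩] [FiniteDimensional ℂ 𝔩]
  [LieAlgebra.IsKilling ℂ 𝔩] {H : LieSubalgebra ℂ 𝔩} [H.IsCartanSubalgebra]
  {ξ : 𝔩} {d : H.root → ℤ} {r : ℕ} {α : Fin r → H.root} {e f : Fin r → 𝔩}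
  {𝒢 : Type*} [Group 𝒢] {ρ : Representation ℂ 𝒢 𝔩}

namespace IsFrame

variable (F : IsFrame H ξ d α e f)

section Action

variable (A : IsGradedAction ξ ρ)
include F A

theorem repOrbit_partialSum_eq {v : Fin r → 𝔩}
    (hv : ∀ i, v i ∈ rootSpace H (α i).1 ∧ v i ≠ 0) (k : ℕ) :
    repOrbit ρ (partialSum v k) = repOrbit ρ (partialSum e k) := by
  choose c hc using fun i =>
    exists_eq_smul_of_mem_rootSpace (F.e_mem i) (F.triple i).e_ne_zero (hv i).1
  have hc0 : ∀ i, c i ≠ 0 := fun i h => (hv i).2 (by rw [hc, h, zero_smul])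
  obtain ⟨g, -, hg, -⟩ := F.exists_scaling A c hc0
  refine repOrbit_eq_of_mem ⟨g, ?_⟩
  simp only [partialSum, map_sum, hg, hc]

variable [(rootSystem H).IsIrreducible]

theorem grading_one_eq_iUnion_repOrbit : (lieEigenspace ξ (1 : ℂ) : Set 𝔩) =
    ⋃ k ∈ Set.Iic r, repOrbit ρ (partialSum e k) := by
  refine Set.Subset.antisymm (fun y hy => Set.mem_iUnion₂.mpr ?_)
    (Set.iUnion₂_subset fun k _ => ?_)
  · obtain ⟨T, hT⟩ := F.exists_mem_repOrbit A hy
    have hle : T.card ≤ r := by simpa using T.card_le_univ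
    exact ⟨T.card, hle, repOrbit_subset_of_mem
      (F.sum_mem_repOrbit_of_card_eq A (card_initialSegment hle).symm) hT⟩
  · rintro _ ⟨g, rfl⟩
    exact A.map_mem_grading g (F.sum_e_mem_grading _)

theorem pairwiseDisjoint_repOrbit :
    (Set.Iic r).PairwiseDisjoint fun k => repOrbit ρ (partialSum e k) :=
  fun i hi j hj hij => F.disjoint_repOrbit A (S := initialSegment r i)
    (T := initialSegment r j) (by rwa [card_initialSegment hi, card_initialSegment hj])

theorem repOrbit_partialSum_subset_iff {i j : ℕ} (hi : i ≤ r) (hj : j ≤ r) :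
    repOrbit ρ (partialSum e i) ⊆ zariskiClosure (repOrbit ρ (partialSum e j)) ↔ i ≤ j := by
  rw [partialSum_eq_sum_initialSegment, partialSum_eq_sum_initialSegment,
    F.repOrbit_subset_zariskiClosure_iff A, card_initialSegment hi, card_initialSegment hj]

theorem pyasetskiiCorresponds_partialSum {V : Submodule ℂ 𝔩} (hV : V = lieEigenspace ξ (1 : ℂ))
    {k : ℕ} (hk : k ≤ r) :
    PyasetskiiCorresponds (V := V) (Subtype.val ⁻¹' repOrbit ρ (partialSum e k))
      ((fun y => (killingForm ℂ 𝔩 y).domRestrict V) '' repOrbit ρ (partialSum f (r - k))) := by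
  subst hV
  rw [partialSum_eq_sum_initialSegment f, repOrbit_eq_of_mem
    (F.neg.sum_mem_repOrbit_of_card_eq A.neg (card_compl_initialSegment hk).symm)]
  exact F.pyasetskiiCorresponds A _

end Action

variable {ℒ : ℤ → Submodule ℂ 𝔩}
include F

theorem isSl2Triple_partialSum (hξ : IsGradingElement ℒ ξ) {k : ℕ} (hk0 : 1 ≤ k) (hk : k ≤ r) :
    IsSl2Triple (partialSum (fun i => corootElement H (α i)) k) (partialSum e k) (partialSum f k) ∧
      partialSum e k ∈ ℒ 1 ∧ partialSum (fun i => corootElement H (α i)) k ∈ ℒ 0 ∧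
      partialSum f k ∈ ℒ (-1) := by
  simp only [hξ.eq_lieEigenspace, Int.cast_one, Int.cast_zero, Int.cast_neg]
  exact ⟨F.isSl2Triple_sum (initialSegment_nonempty hk0 hk), F.sum_e_mem_grading _,
    F.cartan_mem_grading (corootSum_mem _), F.sum_f_mem_grading _⟩

end IsFrame

end PartialSums

theorem theorem2p17_general {n : ℕ} (L : Subgroup (GL (Fin n) ℂ))
    (𝔩 : LieSubalgebra ℂ (Matrix (Fin n) (Fin n) ℂ)) (h𝔩 : IsLieAlgebraOf L 𝔩)
    [LieAlgebra.IsSimple ℂ 𝔩] (ℒ : ℤ → Submodule ℂ 𝔩) [GradedLieAlgebra ℒ] (hshort : IsShort ℒ)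
    (H : LieSubalgebra ℂ 𝔩) [H.IsCartanSubalgebra] (hH : H.toSubmodule ≤ ℒ 0)
    {r : ℕ} (α : Fin r → H.root) (hα : IsMaximalOrthogonalLong H ℒ α) (e f : Fin r → 𝔩)
    (he : ∀ i, e i ∈ rootSpace H (α i).1 ∧ e i ≠ 0)
    (hf : ∀ i, f i ∈ rootSpace H (-(α i).1 : LieModule.Weight ℂ H 𝔩) ∧ f i ≠ 0) :
    (∃! ξ : 𝔩, IsGradingElement ℒ ξ) ∧
    ∀ ξ : 𝔩, IsGradingElement ℒ ξ →
      let G : Subgroup (GL (Fin n) ℂ) :=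
        identityComponent (centralizerIn L (ξ : Matrix (Fin n) (Fin n) ℂ))
      let O : ℕ → Set 𝔩 := fun k => adOrbit G (partialSum e k)
      let O' : ℕ → Set 𝔩 := fun k => adOrbit G (partialSum f k)
      ((ℒ 1 : Set 𝔩) = ⋃ k ∈ Set.Iic r, O k) ∧ (Set.Iic r).PairwiseDisjoint O ∧
      ((ℒ (-1) : Set 𝔩) = ⋃ k ∈ Set.Iic r, O' k) ∧ (Set.Iic r).PairwiseDisjoint O' ∧
      (∀ i ≤ r, ∀ j ≤ r, (O i ⊆ zariskiClosure (O j) ↔ i ≤ j) ∧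
        (i ≤ j ↔ O' i ⊆ zariskiClosure (O' j))) ∧
      (∀ k ≤ r,
        PyasetskiiCorresponds (V := ℒ 1) (Subtype.val ⁻¹' O k)
          ((fun y => (killingForm ℂ 𝔩 y).domRestrict (ℒ 1)) '' O' (r - k)) ∧
        PyasetskiiCorresponds (V := ℒ (-1)) (Subtype.val ⁻¹' O' (r - k))
          ((fun x => (killingForm ℂ 𝔩 x).domRestrict (ℒ (-1))) '' O k)) ∧
      ((∀ i, ⁅e i, f i⁆ = corootElement H (α i)) →
        ∀ k, 1 ≤ k → k ≤ r →
          let h : Fin r → 𝔩 := fun i => corootElement H (α i)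
          IsSl2Triple (partialSum h k) (partialSum e k) (partialSum f k) ∧
          partialSum e k ∈ ℒ 1 ∧ partialSum h k ∈ ℒ 0 ∧ partialSum f k ∈ ℒ (-1)) := by
  refine ⟨existsUnique_isGradingElement ℒ, fun ξ hξ => ?_⟩
  intro G O O'
  have A := isGradedAction_adRep h𝔩 ξ
  set ρ := adRep h𝔩 (identityComponent_centralizerIn_le L (ξ : Matrix (Fin n) (Fin n) ℂ))
  obtain ⟨d, hd⟩ := hα.exists_isFrame hξ hshort hH
  choose f' hf' hef' using fun i => exists_lie_eq_corootElement (he i).1 (he i).2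
  have F := hd e f' (fun i => (he i).1) hf' hef'
  simp only [← coe_reflectionPerm_self] at hf
  have hO : O = fun k => repOrbit ρ (partialSum e k) := funext fun k => adOrbit_eq_repOrbit h𝔩 _ _
  have hO' : O' = fun k => repOrbit ρ (partialSum f' k) := funext fun k =>
    (adOrbit_eq_repOrbit h𝔩 _ _).trans (F.neg.repOrbit_partialSum_eq A.neg hf k)
  have h1 : ℒ 1 = lieEigenspace ξ 1 := by rw [hξ.eq_lieEigenspace, Int.cast_one]
  have hneg1 : ℒ (-1) = lieEigenspace (-ξ) 1 := by
    rw [hξ.eq_lieEigenspace, lieEigenspace_neg, Int.cast_neg, Int.cast_one]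
  rw [hO, hO']
  exact ⟨h1 ▸ F.grading_one_eq_iUnion_repOrbit A, F.pairwiseDisjoint_repOrbit A,
    hneg1 ▸ F.neg.grading_one_eq_iUnion_repOrbit A.neg, F.neg.pairwiseDisjoint_repOrbit A.neg,
    fun i hi j hj => ⟨F.repOrbit_partialSum_subset_iff A hi hj,
      (F.neg.repOrbit_partialSum_subset_iff A.neg hi hj).symm⟩,
    fun k hk => ⟨F.pyasetskiiCorresponds_partialSum A h1 hk, by
      simpa only [Nat.sub_sub_self hk] using
        F.neg.pyasetskiiCorresponds_partialSum A.neg hneg1 (Nat.sub_le r k)⟩,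
    fun hef k =>
      (hd e f (fun i => (he i).1) (fun i => (hf i).1) hef).isSl2Triple_partialSum hξ⟩

end ShortGrading

end

open ShortGrading in
theorem theorem2p17 {n : ℕ}
    -- a simple complex algebraic group `L` with Lie algebra `𝔩`
    (L : Subgroup (GL (Fin n) ℂ)) (hL : IsConnectedAlgebraicGroup L)
    (𝔩 : LieSubalgebra ℂ (Matrix (Fin n) (Fin n) ℂ)) (h𝔩 : IsLieAlgebraOf L 𝔩)
    [LieAlgebra.IsSimple ℂ 𝔩]
    -- a short grading of `𝔩`
    (ℒ : ℤ → Submodule ℂ 𝔩) [GradedLieAlgebra ℒ] (hshort : IsShort ℒ)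
    -- a Cartan subalgebra `H` of `𝔩` contained in `𝔩_0` (the Lie algebra of a maximal torus of `G`)
    (H : LieSubalgebra ℂ 𝔩) [H.IsCartanSubalgebra] (hH : H.toSubmodule ≤ ℒ 0)
    -- a maximal sequence of pairwise orthogonal long roots of degree one, and root vectors
    {r : ℕ} (α : Fin r → H.root) (hα : IsMaximalOrthogonalLong H ℒ α)
    (e f : Fin r → 𝔩)
    (he : ∀ i, e i ∈ LieAlgebra.rootSpace H (α i).1 ∧ e i ≠ 0)
    (hf : ∀ i, f i ∈ LieAlgebra.rootSpace H (-(α i).1 : LieModule.Weight ℂ H 𝔩) ∧ f i ≠ 0) :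
    (∃! ξ : 𝔩, IsGradingElement ℒ ξ) ∧
    ∀ ξ : 𝔩, IsGradingElement ℒ ξ →
      let G : Subgroup (GL (Fin n) ℂ) :=
        identityComponent (centralizerIn L (ξ : Matrix (Fin n) (Fin n) ℂ))
      let O : ℕ → Set 𝔩 := fun k => adOrbit G (partialSum e k)
      let O' : ℕ → Set 𝔩 := fun k => adOrbit G (partialSum f k)
      -- orbit decompositions
      ((ℒ 1 : Set 𝔩) = ⋃ k ∈ Set.Iic r, O k) ∧ (Set.Iic r).PairwiseDisjoint O ∧
      ((ℒ (-1) : Set 𝔩) = ⋃ k ∈ Set.Iic r, O' k) ∧ (Set.Iic r).PairwiseDisjoint O' ∧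
      -- closure order
      (∀ i ≤ r, ∀ j ≤ r, (O i ⊆ zariskiClosure (O j) ↔ i ≤ j) ∧
        (i ≤ j ↔ O' i ⊆ zariskiClosure (O' j))) ∧
      -- Pyasetskii pairing, where `𝔩_1` and `𝔩_{-1}` are dual to each other by the Killing form
      (∀ k ≤ r,
        PyasetskiiCorresponds (V := ℒ 1) (Subtype.val ⁻¹' O k)
          ((fun y => (killingForm ℂ 𝔩 y).domRestrict (ℒ 1)) '' O' (r - k)) ∧
        PyasetskiiCorresponds (V := ℒ (-1)) (Subtype.val ⁻¹' O' (r - k))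
          ((fun x => (killingForm ℂ 𝔩 x).domRestrict (ℒ (-1))) '' O k)) ∧
      -- homogeneous `sl_2`-triples, for root vectors normalized by `[e_α, e_{-α}] = α^∨`
      ((∀ i, ⁅e i, f i⁆ = corootElement H (α i)) →
        ∀ k, 1 ≤ k → k ≤ r →
          let h : Fin r → 𝔩 := fun i => corootElement H (α i)
          IsSl2Triple (partialSum h k) (partialSum e k) (partialSum f k) ∧
          partialSum e k ∈ ℒ 1 ∧ partialSum h k ∈ ℒ 0 ∧ partialSum f k ∈ ℒ (-1)) :=
  theorem2p17_general L 𝔩 h𝔩 ℒ hshort H hH α hα e f he hf
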